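/- **Setting.** Let $M=\mathbb R^4$ be Minkowski space. A *system of free fields* consists of a Hilbert space $\mathcal F$, a domain $D_0\subset\mathcal F$, a unit vector $\Omega\in D_0$, integers $z_A$ ($A=1,\dots,N$), tempered operator-valued distributions $\phi^A=\phi^A_++\phi^A_-$ mapping $D_0$ into itself, and tempered distributions $D^{AB}_\pm$, $D^{AB}=D^{AB}_++D^{AB}_-$, such that: the span $\mathcal D$ of the vectors $\phi^{A_1}(f_1)\cdots\phi^{A_k}(f_k)\Omega$ is dense in $\mathcal F$; $\phi^A_\pm$ and $D^{AB}_\pm$ are the positive/negative frequency parts of $\phi^A$ and $D^{AB}$ (the Fourier transform is multiplied by the Heaviside function of $\pm p_0$, understood as a limit of smooth cut-offs, so that there is no contribution from $p=0$); $$\phi^A_\pm(x)\phi^B_\pm(y)=(-1)^{z_Az_B}\phi^B_\pm(y)\phi^A_\pm(x),\qquad \phi^A_\pm(x)\phi^B_\mp(y)-(-1)^{z_Az_B}\phi^B_\mp(y)\phi^A_\pm(x)=D^{AB}_\pm(x-y)\,\mathbf 1 ;$$ $D^{AB}_\pm=0$ if $z_A+z_B\ne0$; $\phi^A_-\Omega=0$;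 the Hermitian conjugates of the $\phi^A_\pm$ are linear combinations of the $\phi^B_\mp$. (Poincaré covariance, mass shells, field equations and causal support are not needed.) Let $\mathcal G=\bigoplus_{k\in\mathbb Z}\mathcal G_k$ be a graded-commutative algebra over $\mathbb C$ ($ab=(-1)^{kl}ba$ for $a\in\mathcal G_k$, $b\in\mathcal G_l$) such that, for each $A$, no non-zero $x\in\mathcal G$ satisfies $\mathcal G_{z_A}x=0$. Call $x\in\mathcal G$ *bosonic* if it commutes with $\mathcal G_{z_A}$ for every $A$. Fix $r\ge0$. A *classical field* is a family $u=(u^\alpha_A)_{|\alpha|\le r}$ with $u^\alpha_A\in\mathcal G_{z_A}$; put $$\varphi_u=\sum_{A,\alpha}u^\alpha_A\otimes\partial_\alpha\phi^A,\qquad \Delta_{uw}(x-y)=\sum u^\alpha_Aw^\beta_B\,\partial^x_\alpha\partial^y_\beta D^{AB}(x-y),$$ so that $[\varphi_u(x),\varphi_w(y)]=\Delta_{uw}(x-y)$. For finite multisets $U_1,\dots,U_n$ of classical fields, $N(W_{U_1}(x_1),\dots,W_{U_n}(x_n))$ is the normal product of all $\varphi_u(x_l)$, $u\in U_l$, i.e.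 all negative frequency parts are put to the right of all positive frequency parts. The same notation is used, by $\mathcal G$-multilinearity, for ordered sequences of classical fields with arbitrary coordinates in $\mathcal G$; ordinary normal products of the $\partial_\alpha\phi^A$ carry the usual signs. Its matrix elements between vectors of $\mathcal D$ are smooth functions of $x_1,\dots,x_n$, so that it can be multiplied with any distribution $d(x_1,\dots,x_n)$, as a form on $\mathcal D\times\mathcal D$. An ensemble of tempered distributions $E(W_{U_1}(x_1),\dots,W_{U_n}(x_n))$ with values in $\mathcal G\otimes\mathcal L(D_0)$, one for each $(U_1,\dots,U_n)$, is *of Wick type* if its vacuum expectation values are bosonic, $E(\emptyset,\dots,\emptyset)$ is a multiple of $\mathbf 1$ (by a distribution), on $\mathcal D$ $$E(\emptyset,\dots,\varphi_u(x_l),\dots,\emptyset)=\langle\Omega,E(\emptyset,\dots,\varphi_u(x_l),\dots,\emptyset)\Omega\rangle\mathbf 1+E(\emptyset,\dots,\emptyset)\,\varphi_u(x_l),$$ and, for all classical fields $w$, $$[E(W_{U_1}(x_1),\dots,W_{U_n}(x_n)),\varphi_w(y)]=\sum_{l=1}^n\sum_{u\in U_l}E(W_{U_1}(x_1),\dots,W_{U_l-\{u\}}(x_l),\dots,W_{U_n}(x_n))\,\Delta_{uw}(x_l-y).$$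 **Theorem.** Let $E$ be of Wick type. (1) As forms on $\mathcal D\times\mathcal D$, $$E(W_{U_1}(x_1),\dots,W_{U_n}(x_n))=\sum_{U'_i\subset U_i}\langle\Omega,E(W_{U_1-U'_1}(x_1),\dots,W_{U_n-U'_n}(x_n))\Omega\rangle\;N(W_{U'_1}(x_1),\dots,W_{U'_n}(x_n)),$$ where sub-multisets are counted with multiplicity. Wick polynomials are finite (formal) sums $\sum_UW_Uc_U$ with bosonic $c_U\in\mathcal G$, and $E$ is extended to them by $E(W_{U_1}c_1,\dots,W_{U_n}c_n)=E(W_{U_1},\dots,W_{U_n})c_1\cdots c_n$. Let $J$ be the space of complex jets $(u^\alpha_A)_{|\alpha|\le r}$, $\mathcal M\subset J$ the mass-shell, i.e. the set of $u\in J$ with $\sum_{A:\,z_A=k}\sum_\alpha u^\alpha_A\partial_\alpha\phi^A=0$ for every $k$, and $\mathcal M^0=\{v\in J^*:\langle v,u\rangle=0\ \forall u\in\mathcal M\}$. For $v\in\mathcal M^0$ put $\rho(v)(W_Uc)=\sum_{u\in U}W_{U-\{u\}}\langle v,u\rangle c$ with $\langle v,u\rangle=\sum v^A_\alpha u^\alpha_A$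 (this also for arbitrary coefficients $c\in\mathcal G$, with $E$ extended by the same formula). Let $(v_j)$ be a basis of $\mathcal M^0$ and let $v^*_j\in J$ satisfy $\langle v_i,v_j^*\rangle=\delta_{ij}$. Let $W_1,\dots,W_n$ be Wick polynomials with bosonic coefficients. (2) For every classical field $w$, $$[E(W_1(x_1),\dots,W_n(x_n)),\varphi_w(y)]=\sum_{l=1}^n\sum_jE(W_1(x_1),\dots,\rho(v_j)W_l(x_l),\dots,W_n(x_n))\,\Delta_{v_j^*w}(x_l-y).$$ In particular, if the Wick monomials are realized by operators $W_U(x)=N(W_U(x))$, then for every Wick polynomial $W$, in matrix elements between vectors of $\mathcal D$, $[W(x),\varphi_w(y)]=\sum_j(\rho(v_j)W)(x)\,\Delta_{v_j^*w}(x-y)$. (3) As forms on $\mathcal D\times\mathcal D$, $$E(W_1(x_1),\dots,W_n(x_n))=\sum_{V_1,\dots,V_n}\frac1{|V_1|!\cdots|V_n|!}\,\langle\Omega,E(\rho(V_1)W_1(x_1),\dots,\rho(V_n)W_n(x_n))\Omega\rangle\;N(W_{V_1^*}(x_1),\dots,W_{V_n^*}(x_n)),$$ where the $V_i=(v_{j_1},\dots,v_{j_k})$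 run over all finite sequences of elements of the basis, $|V_i|=k$, $\rho(V_i)=\rho(v_{j_1})\cdots\rho(v_{j_k})$ and $V_i^*=(v_{j_1}^*,\dots,v_{j_k}^*)$ (only finitely many terms are non-zero). -/

import Mathlib

open scoped SchwartzMap TensorProduct ComplexConjugate

namespace WickFormalism

noncomputable section

/-! ### Test functions and distributions on Minkowski space -/

/-- Minkowski space `M`, with coordinate `0` as time. Only its structure as a real vector space with
Lebesgue measure enters; the Euclidean norm is used for nothing but the Schwartz seminorms. -/
abbrev Mink : Type := EuclideanSpace ℝ (Fin 4)

/-- Test functions on `M`. -/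
abbrev Test1 : Type := 𝓢(Mink, ℂ)

/-- Test functions of `n` points `x₁, …, xₙ` of `M`. -/
abbrev Test (n : ℕ) : Type := 𝓢(Fin n → Mink, ℂ)

/-- (Numerical) tempered distributions on `M`. -/
abbrev Dist1 : Type := Test1 →L[ℂ] ℂ

/-- The test function `y ↦ g (x - y)`. -/
def reflectAt (g : Test1) (x : Mink) : Test1 :=
  SchwartzMap.compSubConstCLM ℂ x
    (SchwartzMap.compCLMOfContinuousLinearEquiv ℂ (ContinuousLinearEquiv.neg ℝ) g)

/-- The smooth function `x ↦ ∫ D(x - y) g(y) dy`, for a distribution `D`. -/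
def smear (D : Dist1) (g : Test1) (x : Mink) : ℂ := D (reflectAt g x)

/-- The complex conjugate of a test function. -/
def conjTest (f : Test1) : Test1 :=
  SchwartzMap.postcompCLM (𝕜 := ℝ) (Complex.conjCLE : ℂ →L[ℝ] ℂ) f

/-- `∂_α` on test functions, for a Schwartz multi-index `α`. -/
def pderiv (α : Fin 4 → ℕ) : Test1 →L[ℂ] Test1 :=
  (List.ofFn fun μ : Fin 4 =>
    (LineDeriv.lineDerivOpCLM ℂ Test1 (EuclideanSpace.single μ (1 : ℝ))) ^ α μ).prod

/-- `|α|`. -/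
def order (α : Fin 4 → ℕ) : ℕ := ∑ μ, α μ

/-- The distributional derivative `∂_α D`. -/
def distDeriv (α : Fin 4 → ℕ) (D : Dist1) : Dist1 :=
  (-1 : ℂ) ^ order α • D.comp (pderiv α)

/-- The test function with Fourier transform cut off smoothly to positive (`s = 1`) or negative
(`s = -1`) frequencies: if `f̂(p) = ∫ exp(i p·x) f(x) dx` with the Minkowski product `p·x`, then
`f̂(p)` is multiplied by `κ(s p₀ / (2πε))`, where `κ` is smooth, `κ(t) = 0` for `t ≤ 0` and
`κ(t) = 1` for `t ≥ 1`. (In Mathlib's convention `p₀ = -2π ξ₀`.) -/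
def freqCut (s ε : ℝ) : Test1 →L[ℂ] Test1 :=
  SchwartzMap.fourierMultiplierCLM ℂ
    (fun ξ : Mink => ((Real.smoothTransition (-(s * ξ 0) / ε) : ℝ) : ℂ))

/-- `T'` is the positive (`s = 1`) or negative (`s = -1`) frequency part of `T`, that is,
the Fourier transform of `T` is multiplied by the Heaviside function of `s p₀`, understood as the
limit of the smooth cut-offs. -/
def IsFreqPart (s : ℝ) (T T' : Test1 → ℂ) : Prop :=
  ∀ f : Test1, Filter.Tendsto (fun ε : ℝ => T (freqCut s ε f)) (nhdsWithin 0 (Set.Ioi 0))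
    (nhds (T' f))

/-! ### Systems of free fields -/

/-- The sign `(-1)^m`. -/
def sgn (m : ℤ) : ℂ := ((m.negOnePow : ℤ) : ℂ)

/-- A system of free fields `φ^A = φ^A_+ + φ^A_-`, `A = 1, …, N`, in the Hilbert (Fock) space `F`,
given by its frequency components `φ^A_±`. Covariance, mass shells, equations of motion and causal
support of the commutators are not imposed, so that the notion is more general than the one in use.
-/
structure FreeFields (N : ℕ) (F : Type*) [NormedAddCommGroup F] [InnerProductSpace ℂ F]
    [CompleteSpace F] where
  /-- the common dense domain -/
  dom : Submodule ℂ F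
  /-- `φ^A_+` -/
  plus : Fin N → Test1 →ₗ[ℂ] Module.End ℂ dom
  /-- `φ^A_-` -/
  minus : Fin N → Test1 →ₗ[ℂ] Module.End ℂ dom
  /-- the degrees `z_A` -/
  z : Fin N → ℤ
  /-- `D^{AB}_+` -/
  Dplus : Fin N → Fin N → Dist1
  /-- `D^{AB}_-` -/
  Dminus : Fin N → Fin N → Dist1
  /-- the vacuum -/
  vac : dom
  norm_vac : ‖(vac : F)‖ = 1
  plus_tempered : ∀ A (ψ χ : dom), Continuous fun f => inner ℂ (ψ : F) (plus A f χ : F)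
  minus_tempered : ∀ A (ψ χ : dom), Continuous fun f => inner ℂ (ψ : F) (minus A f χ : F)
  /-- the vectors `φ^{A₁}(f₁) ⋯ φ^{A_k}(f_k) Ω` generate `F` -/
  cyclic : ((Submodule.span ℂ {χ : dom | ∃ L : List (Fin N × Test1),
      χ = (L.map fun p => plus p.1 p.2 + minus p.1 p.2).prod vac}).map
        dom.subtype).topologicalClosure = ⊤
  /-- `φ^A_±` are the positive and negative frequency components of `φ^A` -/
  plus_freq : ∀ A (ψ χ : dom), IsFreqPart 1
    (fun f => inner ℂ (ψ : F) ((plus A f + minus A f) χ : F))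
    (fun f => inner ℂ (ψ : F) (plus A f χ : F))
  minus_freq : ∀ A (ψ χ : dom), IsFreqPart (-1)
    (fun f => inner ℂ (ψ : F) ((plus A f + minus A f) χ : F))
    (fun f => inner ℂ (ψ : F) (minus A f χ : F))
  /-- the canonical (anti)commutation relations -/
  plus_plus : ∀ A B f g,
    plus A f * plus B g = sgn (z A * z B) • (plus B g * plus A f)
  minus_minus : ∀ A B f g,
    minus A f * minus B g = sgn (z A * z B) • (minus B g * minus A f)
  plus_minus : ∀ A B f g,
    plus A f * minus B g - sgn (z A * z B) • (minus B g * plus A f)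
      = (∫ x, f x * smear (Dplus A B) g x) • (1 : Module.End ℂ dom)
  minus_plus : ∀ A B f g,
    minus A f * plus B g - sgn (z A * z B) • (plus B g * minus A f)
      = (∫ x, f x * smear (Dminus A B) g x) • (1 : Module.End ℂ dom)
  D_eq_zero : ∀ A B, z A + z B ≠ 0 → Dplus A B = 0 ∧ Dminus A B = 0
  /-- `D^{AB}_±` are the frequency components of `D^{AB} = D^{AB}_+ + D^{AB}_-` -/
  Dplus_freq : ∀ A B, IsFreqPart 1 (Dplus A B + Dminus A B) (Dplus A B)
  Dminus_freq : ∀ A B, IsFreqPart (-1) (Dplus A B + Dminus A B) (Dminus A B)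
  minus_vac : ∀ A f, minus A f vac = 0
  /-- the Hermitian conjugates of the fields are combinations of the fields. (The coefficients for
  the two frequency components may differ: this happens for ghost fields, whose simple conjugation
  rule refers to an indefinite form instead of the scalar product of `F`.) -/
  plus_adjoint : ∃ c : Fin N → Fin N → ℂ, ∀ A f (ψ χ : dom),
    inner ℂ (ψ : F) (plus A f χ : F) =
      ∑ B, c A B * inner ℂ (minus B (conjTest f) ψ : F) (χ : F)
  minus_adjoint : ∃ c : Fin N → Fin N → ℂ, ∀ A f (ψ χ : dom),
    inner ℂ (ψ : F) (minus A f χ : F) =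
      ∑ B, c A B * inner ℂ (plus B (conjTest f) ψ : F) (χ : F)

/-- The multi-indices `α` with `|α| ≤ r`. -/
def multiIdx (r : ℕ) : Finset (Fin 4 → ℕ) :=
  (Finset.Iic fun _ => r).filter fun α => order α ≤ r

/-- The index set of the fibre coordinates `u^α_A`, `|α| ≤ r`, of the jet bundle. -/
abbrev JetIdx (N r : ℕ) : Type := Fin N × multiIdx r

namespace FreeFields

variable {N r : ℕ} {F : Type*} [NormedAddCommGroup F] [InnerProductSpace ℂ F] [CompleteSpace F]
  (S : FreeFields N F)

/-- The dense domain spanned by the vectors `φ^{A₁}(f₁) ⋯ φ^{A_k}(f_k) Ω`. -/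
def poly : Submodule ℂ S.dom :=
  Submodule.span ℂ {χ | ∃ L : List (Fin N × Test1),
    χ = (L.map fun p => S.plus p.1 p.2 + S.minus p.1 p.2).prod S.vac}

/-- `∂_α φ^A_+` -/
def jetPlus (a : JetIdx N r) (f : Test1) : Module.End ℂ S.dom :=
  (-1 : ℂ) ^ order a.2 • S.plus a.1 (pderiv a.2 f)

/-- `∂_α φ^A_-` -/
def jetMinus (a : JetIdx N r) (f : Test1) : Module.End ℂ S.dom :=
  (-1 : ℂ) ^ order a.2 • S.minus a.1 (pderiv a.2 f)

/-- The distribution `∂_α^x ∂_β^y D^{AB}(x - y)`, as a distribution in the difference `x - y`. -/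
def jetD (a b : JetIdx N r) : Dist1 :=
  (-1 : ℂ) ^ order b.2 • distDeriv a.2 (distDeriv b.2 (S.Dplus a.1 b.1 + S.Dminus a.1 b.1))

/-- The ordinary normal product `:∂_{α₁}φ^{A₁}(f₁) ⋯ ∂_{α_k}φ^{A_k}(f_k):` of the basic fields, with
the Jordan signs: each factor is split into frequency components, and all the `φ_-` are moved to the
right of all the `φ_+`. -/
def normal : List (JetIdx N r × Test1) → Module.End ℂ S.dom
  | [] => 1
  | p :: L => S.jetPlus p.1 p.2 * normal L +
      sgn (S.z p.1.1 * (L.map fun q => S.z q.1.1).sum) • (normal L * S.jetMinus p.1 p.2)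

/-- `K` is the smooth function `(x₁, …, x_k) ↦ ⟨ψ, :∂_{α₁}φ^{A₁}(x₁) ⋯ ∂_{α_k}φ^{A_k}(x_k): χ⟩`. -/
def IsKernel (ψ χ : S.dom) {k : ℕ} (a : Fin k → JetIdx N r) (K : (Fin k → Mink) → ℂ) : Prop :=
  K.HasTemperateGrowth ∧ ∀ f : Fin k → Test1,
    ∫ x, (∏ i, f i (x i)) * K x =
      inner ℂ (ψ : F) (S.normal (List.ofFn fun i => (a i, f i)) χ : F)

open scoped Classical in
/-- The smooth function `(x₁, …, x_k) ↦ ⟨ψ, :∂_{α₁}φ^{A₁}(x₁) ⋯ ∂_{α_k}φ^{A_k}(x_k): χ⟩`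
for `ψ, χ` in the domain `S.poly`. (It is unique, being continuous, and it exists, because the
`φ_-` act on `χ`, and the adjoints of the `φ_+` on `ψ`, by contractions with smooth functions.) Its
values at coinciding arguments are what gives a meaning to normal products with collapsed
arguments. -/
def kernel (ψ χ : S.dom) {k : ℕ} (a : Fin k → JetIdx N r) : (Fin k → Mink) → ℂ :=
  if h : ∃ K, S.IsKernel ψ χ a K then h.choose else 0

/-! ### Grassmann-valued classical fields and supersymmetric fields -/

section Grassmann

variable {G : Type*} [Ring G] [Algebra ℂ G] (gr : ℤ → Submodule ℂ G)

/-- `G = ⨁ gr k` is a graded-commutative algebra with enough Grassmann numbers: for every field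
`φ^A`, no non-zero element of `G` is annihilated by all the Grassmann numbers of degree `z_A`.
(This is so if there is an invertible Grassmann number of degree `z_A`.) -/
structure IsGrassmann [GradedAlgebra gr] : Prop where
  graded_comm : ∀ (m n : ℤ), ∀ x ∈ gr m, ∀ y ∈ gr n, x * y = sgn (m * n) • (y * x)
  enough : ∀ (A : Fin N) (x : G), (∀ c ∈ gr (S.z A), c * x = 0) → x = 0

/-- The Grassmann-valued classical fields: jets `u` whose coordinate `u^α_A` (`g_A u^α_A` if one
writes out Grassmann numbers `g_A`) is a Grassmann number of degree `z_A`. -/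
def Jet (r : ℕ) : Type _ := {u : JetIdx N r → G // ∀ a, u a ∈ gr (S.z a.1)}

/-- `x` commutes with all the Grassmann numbers of degrees `z_A`. -/
def Bosonic (x : G) : Prop := ∀ (A : Fin N), ∀ c ∈ gr (S.z A), Commute x c

/-- The algebra `𝒢 ⊗ 𝓛(F)` of Grassmann-valued operators (on the dense domain). -/
abbrev Op (G : Type*) [Ring G] [Algebra ℂ G] : Type _ := G ⊗[ℂ] Module.End ℂ S.dom

/-- The Grassmann-valued matrix element `⟨ψ, X χ⟩`. -/
def mel (ψ χ : S.dom) : S.Op G →ₗ[ℂ] G :=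
  (TensorProduct.rid ℂ G).toLinearMap ∘ₗ LinearMap.lTensor G
    (((innerSL ℂ (ψ : F)).toLinearMap ∘ₗ S.dom.subtype) ∘ₗ LinearMap.applyₗ χ)

/-- The supersymmetric field `φ_u(f) = ∑ u^α_A ⊗ ∂_α φ^A(f)`. -/
def superField (u : JetIdx N r → G) (f : Test1) : S.Op G :=
  ∑ a, u a ⊗ₜ[ℂ] (S.jetPlus a f + S.jetMinus a f)

/-- For a distribution `T(x₁, …, xₙ)` with values in `𝒢 ⊗ 𝓛(F)`, the distribution
`T(x₁, …, xₙ) Δ_{uw}(x_l - y)` smeared with `f(x₁, …, xₙ) g(y)`, where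
`Δ_{uw}(x - y) = ∑ u^α_A w^β_B ∂_α^x ∂_β^y D^{AB}(x - y)`. -/
def mulDelta {n : ℕ} (T : Test n →ₗ[ℂ] S.Op G) (l : Fin n) (u w : JetIdx N r → G) (g : Test1)
    (f : Test n) : S.Op G :=
  ∑ a, ∑ b, T (SchwartzMap.smulLeftCLM ℂ (fun x : Fin n → Mink => smear (S.jetD a b) g (x l)) f) *
    ((u a * w b) ⊗ₜ[ℂ] (1 : Module.End ℂ S.dom))

/-- For a Grassmann-valued distribution `d(x₁, …, xₙ)`, and a list of pairs `(l₁, u₁), …, (l_k, u_k)`,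
the matrix element between `ψ` and `χ` of
`d(x₁, …, xₙ) N(φ_{u₁}(x_{l₁}), …, φ_{u_k}(x_{l_k}))` smeared with `f(x₁, …, xₙ)`, where
`N(φ_{u₁}(x_{l₁}), …) = ∑ (u₁)^{α₁}_{A₁} ⋯ (u_k)^{α_k}_{A_k} ⊗ :∂_{α₁}φ^{A₁}(x_{l₁}) ⋯:`. -/
def mulNormal {n : ℕ} (d : Test n →ₗ[ℂ] G) (L : List (Fin n × (JetIdx N r → G))) (ψ χ : S.dom)
    (f : Test n) : G :=
  ∑ a : Fin L.length → JetIdx N r,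
    d (SchwartzMap.smulLeftCLM ℂ
        (fun x : Fin n → Mink => S.kernel ψ χ a fun i => x (L.get i).1) f) *
      (List.ofFn fun i => (L.get i).2 (a i)).prod

/-! ### Expressions of Wick type -/

/-- A configuration of letters `u` placed at the points `x_l`: it stands for
`(W_{U₁}(x₁), …, W_{Uₙ}(xₙ))`, with `U_l` the multiset of all the `u` for which `(l, u)` belongs
to it. -/
abbrev Config (n r : ℕ) : Type _ := Multiset (Fin n × S.Jet gr r)

/-- An ensemble of distributions `E(W_{U₁}(x₁), …, W_{Uₙ}(xₙ))` with values in `𝒢 ⊗ 𝓛(F)`. -/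
abbrev Ensemble (n r : ℕ) : Type _ := S.Config gr n r → Test n →ₗ[ℂ] S.Op G

/-- The vacuum expectation value `⟨Ω, T(x₁, …, xₙ) Ω⟩`. -/
def vev {n : ℕ} (T : Test n →ₗ[ℂ] S.Op G) : Test n →ₗ[ℂ] G := S.mel S.vac S.vac ∘ₗ T

variable {gr}

/-- The list of letters of a configuration. The order is chosen arbitrarily; normal products do not
depend on it. -/
def letters {n : ℕ} (W : S.Config gr n r) : List (Fin n × (JetIdx N r → G)) :=
  W.toList.map fun p => (p.1, p.2.1)

open scoped Classical in
/-- Expressions of (supersymmetric) Wick type. -/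
structure IsWickType {n : ℕ} (E : S.Ensemble gr n r) : Prop where
  /-- the `E(…)` are operator-valued tempered distributions -/
  tempered : ∀ W (ψ χ : S.dom) (l : Module.Dual ℂ G), Continuous fun f => l (S.mel ψ χ (E W f))
  /-- vacuum expectation values are commuting quantities -/
  bosonic : ∀ W f, S.Bosonic gr (S.vev (E W) f)
  /-- `E(∅, …, ∅) = const.` -/
  empty : ∀ f, E 0 f = S.vev (E 0) f ⊗ₜ[ℂ] (1 : Module.End ℂ S.dom)
  /-- `E(∅, …, φ_u(x_l), …, ∅) = ⟨Ω, E(∅, …, φ_u(x_l), …, ∅) Ω⟩ 1 + E(∅, …, ∅) φ_u(x_l)` -/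
  single : ∀ (l : Fin n) (u : S.Jet gr r) (f : Test n), ∀ ψ ∈ S.poly, ∀ χ ∈ S.poly,
    S.mel ψ χ (E {(l, u)} f) =
      inner ℂ (ψ : F) (χ : F) • S.vev (E {(l, u)}) f +
        S.mulNormal (S.vev (E 0)) [(l, u.1)] ψ χ f
  /-- `[E(W_{U₁}(x₁), …, W_{Uₙ}(xₙ)), φ_w(y)]
    = ∑_l ∑_{u ∈ U_l} E(W_{U₁}(x₁), …, W_{U_l - {u}}(x_l), …, W_{Uₙ}(xₙ)) Δ_{uw}(x_l - y)` -/
  comm : ∀ (W : S.Config gr n r) (w : S.Jet gr r) (f : Test n) (g : Test1),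
    E W f * S.superField w.1 g - S.superField w.1 g * E W f =
      (W.map fun p => S.mulDelta (E (W.erase p)) p.1 p.2.1 w.1 g f).sum

/-- The operators `E(W_U(x))` are the operators `W_U(x) = N(φ_{u₁}(x), …, φ_{u_k}(x))` themselves
(smeared, and as matrix elements on the domain `poly`). -/
def IsWickMonomials (E : S.Ensemble gr 1 r) : Prop :=
  ∀ (W : S.Config gr 1 r) (f : Test 1), ∀ ψ ∈ S.poly, ∀ χ ∈ S.poly,
    S.mel ψ χ (E W f) = ∑ a : Fin (S.letters W).length → JetIdx N r,
      (∫ x, f x * S.kernel ψ χ a fun i => x ((S.letters W).get i).1) •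
        (List.ofFn fun i => ((S.letters W).get i).2 (a i)).prod

/-! ### Wick polynomials and their derivatives -/

variable (gr) in
/-- Wick polynomials `∑ W_U c_U` in one variable, `c_U ∈ 𝒢`. -/
abbrev WickPoly (r : ℕ) : Type _ := Multiset (S.Jet gr r) →₀ G

/-- The configuration with the letters of `U l` at `x_l`. -/
def config {n : ℕ} (U : Fin n → Multiset (S.Jet gr r)) : S.Config gr n r :=
  ∑ l, (U l).map fun u => (l, u)

/-- The extension by linearity of an ensemble to Wick polynomials:
`E(∑ W_{U₁} c_{U₁}, …, ∑ W_{Uₙ} c_{Uₙ}) = ∑ E(W_{U₁}, …, W_{Uₙ}) c_{U₁} ⋯ c_{Uₙ}`. -/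
def extend {n : ℕ} (E : S.Ensemble gr n r) (P : Fin n → S.WickPoly gr r) : Test n →ₗ[ℂ] S.Op G :=
  ∑ U ∈ Fintype.piFinset fun l => (P l).support,
    LinearMap.mulRight ℂ
      ((List.ofFn fun l => P l (U l)).prod ⊗ₜ[ℂ] (1 : Module.End ℂ S.dom)) ∘ₗ E (S.config U)

/-- The mass-shell: the classical fields `u` with `φ_u = 0`. (The parts of `φ_u` of different
degrees are multiplied by Grassmann numbers of different degrees, so they vanish separately.) -/
def massShell (r : ℕ) : Submodule ℂ (JetIdx N r → ℂ) where
  carrier := {u | ∀ (k : ℤ) (f : Test1),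
    ∑ a with S.z a.1 = k, u a • (S.jetPlus a f + S.jetMinus a f) = 0}
  zero_mem' := by intro k f; simp
  add_mem' := by
    intro u v hu hv k f
    simp only [Pi.add_apply, add_smul, Finset.sum_add_distrib, hu k f, hv k f, add_zero]
  smul_mem' := by
    intro c u hu k f
    simp only [Pi.smul_apply, smul_eq_mul, mul_smul, ← Finset.smul_sum, hu k f, smul_zero]

/-- The duality form `⟨v, u⟩ = ∑ v^A_α u^α_A`. -/
def pair {R : Type*} [AddCommGroup R] [Module ℂ R] (v : JetIdx N r → ℂ) (u : JetIdx N r → R) : R :=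
  ∑ a, v a • u a

/-- The polar of the mass-shell. -/
def polar (r : ℕ) : Submodule ℂ (JetIdx N r → ℂ) where
  carrier := {v | ∀ u ∈ S.massShell r, pair v u = 0}
  zero_mem' := by intro u _; simp [pair]
  add_mem' := by
    intro v w hv hw u hu
    have h1 := hv u hu
    have h2 := hw u hu
    simp only [pair] at h1 h2 ⊢
    simp only [Pi.add_apply, add_smul, Finset.sum_add_distrib, h1, h2, add_zero]
  smul_mem' := by
    intro c v hv u hu
    have h1 := hv u hu
    simp only [pair] at h1 ⊢
    simp only [Pi.smul_apply, smul_assoc, ← Finset.smul_sum, h1, smul_zero]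

open scoped Classical in
/-- The derivative operator `ρ(v) (∑ W_U c_U) = ∑ ∑_{u ∈ U} W_{U - {u}} ⟨v, u⟩ c_U`. -/
def rho (v : JetIdx N r → ℂ) (P : S.WickPoly gr r) : S.WickPoly gr r :=
  P.sum fun U c => (U.map fun u => Finsupp.single (U.erase u) (pair v u.1 * c)).sum

/-- `ρ(V) = ρ(v_{j₁}) ⋯ ρ(v_{j_k})` for the sequence `V = (v_{j₁}, …, v_{j_k})`. -/
def rhoSeq {d : ℕ} (v : Fin d → JetIdx N r → ℂ) (V : List (Fin d)) (P : S.WickPoly gr r) :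
    S.WickPoly gr r :=
  V.foldr (fun j Q => S.rho (v j) Q) P

/-- A classical field with complex coordinates, with the coordinates regarded as elements of `𝒢`. -/
def toG (G : Type*) [Ring G] [Algebra ℂ G] (u : JetIdx N r → ℂ) : JetIdx N r → G :=
  fun a => algebraMap ℂ G (u a)

/-- The letters of `(W_{V₁^*}(x₁), …, W_{Vₙ^*}(xₙ))`, where `V^* = (v^*_{j₁}, …, v^*_{j_k})` for the
sequence `V = (v_{j₁}, …, v_{j_k})`. -/
def dualLetters (G : Type*) [Ring G] [Algebra ℂ G] {n d : ℕ} (vs : Fin d → JetIdx N r → ℂ)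
    (V : Fin n → List (Fin d)) : List (Fin n × (JetIdx N r → G)) :=
  (List.ofFn fun l => (V l).map fun j => (l, toG G (vs j))).flatten

end Grassmann

end FreeFields

end

end WickFormalism

/-!
An expression of Wick type is determined by its vacuum expectation values, because its commutators
with the free fields are expressions of Wick type with one letter less. The right-hand side of the
Wick expansion has the same commutators and the same vacuum expectation values, hence is equal to
it. The other statements follow by linear algebra on the mass-shell.

*Normal products have smooth kernels.* The span `S.poly` of the vectors
`φ^{A₁}(f₁) ⋯ φ^{A_k}(f_k) Ω` consists of polynomials in the creation operators applied to the
vacuum. On it the annihilation operator `φ^A_-(f)` acts by contractions with the factors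
`φ^{A_i}(f_i)`, which are the integrals of `f` against the functions `D_-^{A A_i} * f_i`. These are
smooth and of temperate growth. The annihilation operator therefore exists at a point, as the
operator `annih`, and so does the adjoint `creaAdj` of a creation operator. A kernel of a normal product is
`kerL`, a signed sum of matrix elements of products of these operators (`kernel_eq`). It is graded
symmetric (`kerL_swap`), and its commutator with a field is a signed sum over contractions
(`IsFieldLike.kerL`). Multiplied with Grassmann numbers and a bosonic distribution, the signs
disappear (`mulNormal_comm`).

*The Wick expansion* (`mel_eq_wickSum`) is proved by induction on the number of letters. It holds
between vacuum vectors, since every non-trivial normal product has vanishing vacuum expectation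
value. In a matrix element `⟨ψ, E χ⟩` the fields that generate `χ` from the vacuum are moved to `ψ`;
their commutators with `E` are part of the assumptions and have fewer letters. When `χ = Ω`, the
creation operators that generate `ψ` are adjoints of annihilation operators, which are moved to `Ω`
and vanish there. The commutator with the part `φ^A_-(g)` alone, which is needed here, is obtained
from test functions whose positive frequencies have been cut off (`mel_minus_mul_vac`). By
definition of the frequency parts, these test functions `g_m` fulfil `D^{AB} * g_m → D_+^{AB} * g`
at each point. The convergence of the products of `E` with `D^{AB} * g_m` follows from the principle
of uniform boundedness on the Schwartz space (`tendsto_smulLeftCLM_smear_zero`). Each of these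
relations carries a Grassmann number from the classical field `w` as a factor, which is cancelled
because nothing but zero is annihilated by all of `𝒢_{z_A}` (`eq_of_mul_right_eq`).

*Derivative operators.* If a complex linear combination of fields vanishes, then so does the same
combination of kernels and of commutator functions. Both belong to the polar of the mass-shell as
functions of the index `a = (A, α)` of a factor (`kerL_mem_polar`, `smear_jetD_mem_polar`), so that
such a function satisfies `t_a = ∑ (v_j)_a ⟨v_j^*, t⟩` (`apply_eq_sum_of_mem_polar`). As `ρ(v)` is
a derivation (`polySum_update_rho`), inserting this in the commutator formulas for monomials gives
those with derivative operators.

*The expansion in powers of derivative operators* is a Taylor expansion. It takes place in the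
algebra of operators on `symbols`, i.e. on families of numbers that are graded symmetric and belong
to the polar of the mass-shell, as the kernels do. There, appending a letter `u` to the normal
product is an operator `û`. All these operators commute (`commute_opLetter`), and
`û = ∑ v̂_j^* ⟨v_j, u⟩` (`opLetter_eq_sum`). The sum over the sub-multisets of `U` is the
product of `û + t_u` over `u ∈ U`, where `t_u` inserts `u` in the vacuum expectation value
(`expand`). By the multinomial theorem its terms of order `k` in the `û` are `1 / k!` times the sum
over all sequences of `k` elements of the basis (`sum_dualProd_mul_opPoly`, `sum_expand_eq`). The
expansions at the points `x₁, …, xₙ` are multiplied in `polySum_wickExpansion`, and the evaluation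
on the symbol of the matrix elements of `E` gives `IsWickType.mel_extend_eq`.
-/

namespace WickFormalism

noncomputable section

open Filter Topology LineDeriv

/-! ### Schwartz seminorms and translations -/

section Schwartz

variable {E : Type*} [NormedAddCommGroup E] [NormedSpace ℝ E]

/-- Derivatives of order `n + 1` are controlled by those of order `n` of the partial derivatives.
This makes it possible to deal with the seminorms of order `0` only, as long as one works with a
class of families of Schwartz functions that is closed under partial derivatives. -/
theorem exists_seminorm_succ_le [FiniteDimensional ℝ E] :
    ∃ (m : ℕ) (e : Fin m → E) (C : ℝ), 0 ≤ C ∧ ∀ (k n : ℕ) (Φ : 𝓢(E, ℂ)),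
      SchwartzMap.seminorm ℂ k (n + 1) Φ ≤
        C * ∑ i, SchwartzMap.seminorm ℂ k n (LineDeriv.lineDerivOp (e i) Φ) := by
  let b := Module.finBasis ℝ E
  let L : Fin (Module.finrank ℝ E) → ℂ →L[ℝ] (E →L[ℝ] ℂ) := fun i =>
    ContinuousLinearMap.smulRightL ℝ E ℂ (LinearMap.toContinuousLinearMap (b.coord i))
  refine ⟨_, b, ∑ i, ‖L i‖, by positivity, fun k n Φ => ?_⟩
  refine SchwartzMap.seminorm_le_bound ℂ k (n + 1) Φ
    (mul_nonneg (by positivity) (Finset.sum_nonneg fun i _ => apply_nonneg _ _)) fun x => ?_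
  have hf : fderiv ℝ (Φ : E → ℂ) =
      fun x => ∑ i, (L i) ((LineDeriv.lineDerivOp (b i) Φ : 𝓢(E, ℂ)) x) := by
    funext x
    ext v
    conv_lhs => rw [← b.sum_repr v, map_sum]
    simp [L, SchwartzMap.lineDerivOp_apply_eq_fderiv]
  have hs : ∀ i, ContDiff ℝ n fun x => (L i) ((LineDeriv.lineDerivOp (b i) Φ : 𝓢(E, ℂ)) x) :=
    fun i => (L i).contDiff.comp ((LineDeriv.lineDerivOp (b i) Φ : 𝓢(E, ℂ)).smooth n)
  have hn : ‖iteratedFDeriv ℝ (n + 1) Φ x‖ ≤ ∑ i, ‖L i‖ *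
      ‖iteratedFDeriv ℝ n (LineDeriv.lineDerivOp (b i) Φ : 𝓢(E, ℂ)) x‖ := by
    rw [← norm_iteratedFDeriv_fderiv, hf, iteratedFDeriv_fun_sum_apply fun i _ => (hs i).contDiffAt]
    refine (norm_sum_le _ _).trans (Finset.sum_le_sum fun i _ => ?_)
    exact (L i).norm_iteratedFDeriv_comp_left
      ((LineDeriv.lineDerivOp (b i) Φ : 𝓢(E, ℂ)).smooth n).contDiffAt le_rfl
  calc ‖x‖ ^ k * ‖iteratedFDeriv ℝ (n + 1) Φ x‖
      ≤ ‖x‖ ^ k * ∑ i, ‖L i‖ *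
          ‖iteratedFDeriv ℝ n (LineDeriv.lineDerivOp (b i) Φ : 𝓢(E, ℂ)) x‖ :=
        mul_le_mul_of_nonneg_left hn (by positivity)
    _ = ∑ i, ‖L i‖ *
          (‖x‖ ^ k * ‖iteratedFDeriv ℝ n (LineDeriv.lineDerivOp (b i) Φ : 𝓢(E, ℂ)) x‖) := by
        rw [Finset.mul_sum]
        exact Finset.sum_congr rfl fun i _ => mul_left_comm _ _ _
    _ ≤ ∑ i, ‖L i‖ * ∑ j, SchwartzMap.seminorm ℂ k n (LineDeriv.lineDerivOp (b j) Φ) := by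
        refine Finset.sum_le_sum fun i _ => mul_le_mul_of_nonneg_left ?_ (by positivity)
        refine (SchwartzMap.le_seminorm ℂ k n _ x).trans ?_
        exact Finset.single_le_sum
          (f := fun i => SchwartzMap.seminorm ℂ k n (LineDeriv.lineDerivOp (b i) Φ))
          (fun i _ => apply_nonneg _ _) (Finset.mem_univ i)
    _ = _ := (Finset.sum_mul _ _ _).symm

/-- A criterion for convergence to `0` in Schwartz space that involves no derivatives, for families
taken from a class that is closed under partial derivatives. -/
theorem tendsto_zero_of_closed_lineDeriv [FiniteDimensional ℝ E] {ι : Type*} {l : Filter ι}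
    (P : (ι → 𝓢(E, ℂ)) → Prop)
    (hP : ∀ u, P u → ∀ v : E, P fun i => LineDeriv.lineDerivOp v (u i))
    (h0 : ∀ u, P u → ∀ k : ℕ, Tendsto (fun i => SchwartzMap.seminorm ℂ k 0 (u i)) l (𝓝 0))
    (u : ι → 𝓢(E, ℂ)) (hu : P u) : Tendsto u l (𝓝 0) := by
  obtain ⟨m, e, C, hC, hle⟩ := exists_seminorm_succ_le (E := E)
  have key : ∀ (n k : ℕ) (u : ι → 𝓢(E, ℂ)), P u →
      Tendsto (fun i => SchwartzMap.seminorm ℂ k n (u i)) l (𝓝 0) := by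
    intro n
    induction n with
    | zero => exact fun k u hu => h0 u hu k
    | succ n ih =>
      intro k u hu
      refine squeeze_zero (fun i => apply_nonneg _ _) (fun i => hle k n (u i)) ?_
      have := (tendsto_finsetSum (Finset.univ : Finset (Fin m))
        fun j _ => ih k _ (hP u hu (e j))).const_mul C
      simpa using this
  rw [(schwartz_withSeminorms ℂ E ℂ).tendsto_nhds u 0]
  rintro ⟨k, n⟩ ε hε
  have := (key n k u hu).eventually (gt_mem_nhds hε)
  simpa using this

/-- Pointwise decay of a Schwartz function. -/
theorem exists_decay (f : 𝓢(E, ℂ)) (k : ℕ) :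
    ∃ C, 0 ≤ C ∧ ∀ x, (1 + ‖x‖) ^ k * ‖f x‖ ≤ C := by
  refine ⟨2 ^ k * (Finset.Iic (k, 0)).sup (fun m => SchwartzMap.seminorm ℂ m.1 m.2) f,
    mul_nonneg (by positivity) (apply_nonneg _ _), fun x => ?_⟩
  simpa using SchwartzMap.one_add_le_sup_seminorm_apply (𝕜 := ℂ) (m := (k, 0)) le_rfl le_rfl f x

theorem exists_fderiv_fderiv_decay (f : 𝓢(E, ℂ)) (k : ℕ) :
    ∃ C, 0 ≤ C ∧ ∀ x, (1 + ‖x‖) ^ k * ‖fderiv ℝ (fderiv ℝ f) x‖ ≤ C := by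
  refine ⟨2 ^ k * (Finset.Iic (k, 2)).sup (fun m => SchwartzMap.seminorm ℂ m.1 m.2) f,
    mul_nonneg (by positivity) (apply_nonneg _ _), fun x => ?_⟩
  have h := SchwartzMap.one_add_le_sup_seminorm_apply (𝕜 := ℂ) (m := (k, 2)) (k := k) (n := 2)
      le_rfl le_rfl f x
  rwa [← norm_iteratedFDeriv_fderiv, norm_iteratedFDeriv_one] at h

/-- The second order Taylor estimate, with weights. -/
theorem exists_taylor_bound (g : 𝓢(E, ℂ)) (k : ℕ) : ∃ C, 0 ≤ C ∧ ∀ x v : E, ‖v‖ ≤ 1 →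
    ‖x‖ ^ k * ‖g (x + v) - g x - fderiv ℝ g x v‖ ≤ C * ‖v‖ ^ 2 := by
  obtain ⟨C, hC, h⟩ := exists_fderiv_fderiv_decay g k
  refine ⟨2 ^ k * C, by positivity, fun x v hv => ?_⟩
  have hx : ∀ w ∈ Metric.closedBall x ‖v‖, ‖x‖ ^ k * ‖fderiv ℝ (fderiv ℝ g) w‖ ≤ 2 ^ k * C := by
    intro w hw
    have h1 : ‖x‖ ≤ 2 * (1 + ‖w‖) := by
      have : ‖x‖ ≤ ‖w‖ + ‖w - x‖ := by
        have := norm_sub_le w (w - x); simpa using this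
      rw [mem_closedBall_iff_norm] at hw
      linarith [norm_nonneg w]
    calc ‖x‖ ^ k * ‖fderiv ℝ (fderiv ℝ g) w‖
        ≤ (2 * (1 + ‖w‖)) ^ k * ‖fderiv ℝ (fderiv ℝ g) w‖ := by gcongr
      _ = 2 ^ k * ((1 + ‖w‖) ^ k * ‖fderiv ℝ (fderiv ℝ g) w‖) := by rw [mul_pow, mul_assoc]
      _ ≤ _ := by gcongr; exact h w
  rcases (pow_nonneg (norm_nonneg x) k).eq_or_lt with h0 | hpos
  · rw [← h0, zero_mul]
    positivity
  have hd2 : Differentiable ℝ (fderiv ℝ (g : E → ℂ)) :=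
    ((g.smooth 2).fderiv_right (m := 1) (by norm_num)).differentiable (by simp)
  have hx' : ∀ w ∈ Metric.closedBall x ‖v‖, ‖fderiv ℝ (fderiv ℝ g) w‖ ≤ 2 ^ k * C / ‖x‖ ^ k := by
    intro w hw
    rw [le_div_iff₀ hpos, mul_comm]
    exact hx w hw
  have h1 : ∀ w ∈ Metric.closedBall x ‖v‖,
      ‖fderiv ℝ g w - fderiv ℝ g x‖ ≤ 2 ^ k * C / ‖x‖ ^ k * ‖v‖ := by
    intro w hw
    refine ((convex_closedBall x ‖v‖).norm_image_sub_le_of_norm_fderiv_le (𝕜 := ℝ)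
      (fun y _ => hd2 y) hx' (Metric.mem_closedBall_self (norm_nonneg _)) hw).trans ?_
    gcongr
    exact mem_closedBall_iff_norm.1 hw
  have h2 := (convex_closedBall x ‖v‖).norm_image_sub_le_of_norm_fderiv_le' (𝕜 := ℝ)
    (f := g) (φ := fderiv ℝ g x) (fun y _ => g.differentiable y) h1
    (Metric.mem_closedBall_self (norm_nonneg _)) (y := x + v) (by simp)
  rw [add_sub_cancel_left] at h2
  calc _ ≤ ‖x‖ ^ k * (2 ^ k * C / ‖x‖ ^ k * ‖v‖ * ‖v‖) := by gcongr
    _ = _ := by field_simp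

end Schwartz

/-! ### Smeared distributions -/

@[simp]
theorem reflectAt_apply (g : Test1) (x y : Mink) : reflectAt g x y = g (x - y) := by
  simp [reflectAt, SchwartzMap.compSubConstCLM_apply]

theorem lineDeriv_reflectAt (g : Test1) (x v : Mink) :
    lineDerivOp v (reflectAt g x) = - reflectAt (lineDerivOp v g) x := by
  ext y
  have h : HasFDerivAt (fun y => g (x - y)) ((fderiv ℝ g (x - y)).comp (-ContinuousLinearMap.id ℝ Mink)) y := by
    refine (g.hasFDerivAt (x - y)).comp y ?_
    exact (hasFDerivAt_id y).const_sub x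
  have h2 : (reflectAt g x : Mink → ℂ) = fun y => g (x - y) := funext fun y => reflectAt_apply g x y
  rw [SchwartzMap.lineDerivOp_apply_eq_fderiv, h2, h.fderiv]
  simp [SchwartzMap.lineDerivOp_apply_eq_fderiv]

/-- The translate `z ↦ g (z + v)` minus its first order Taylor polynomial in `v`. -/
def taylorRem (g : Test1) (v : Mink) : Test1 :=
  SchwartzMap.compSubConstCLM ℂ (-v) g - g - lineDerivOp v g

theorem taylorRem_apply (g : Test1) (v z : Mink) :
    taylorRem g v z = g (z + v) - g z - fderiv ℝ g z v := by
  simp [taylorRem, SchwartzMap.compSubConstCLM_apply, SchwartzMap.lineDerivOp_apply_eq_fderiv,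
    sub_neg_eq_add]

theorem lineDerivOp_comm (v w : Mink) (g : Test1) :
    lineDerivOp v (lineDerivOp w g) = lineDerivOp w (lineDerivOp v g) := by
  ext x
  have h : ∀ v w : Mink, (lineDerivOp v (lineDerivOp w g) : Test1) x =
      fderiv ℝ (fderiv ℝ g) x v w := by
    intro v w
    have h1 : ((lineDerivOp w g : Test1) : Mink → ℂ) = fun x => fderiv ℝ g x w :=
      funext fun x => SchwartzMap.lineDerivOp_apply_eq_fderiv w g x
    have h2 : DifferentiableAt ℝ (fderiv ℝ (g : Mink → ℂ)) x :=
      ((g.smooth 2).fderiv_right (m := 1) (by norm_num)).differentiable (by simp) x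
    rw [SchwartzMap.lineDerivOp_apply_eq_fderiv, h1,
      (h2.hasFDerivAt.clm_apply (hasFDerivAt_const w x)).fderiv]
    simp
  rw [h, h]
  exact ((g.smooth 2).contDiffAt.isSymmSndFDerivAt (by simp)) v w

theorem lineDerivOp_taylorRem (g : Test1) (v w : Mink) :
    lineDerivOp w (taylorRem g v) = taylorRem (lineDerivOp w g) v := by
  have h : lineDerivOp w (SchwartzMap.compSubConstCLM ℂ (-v) g) =
      SchwartzMap.compSubConstCLM ℂ (-v) (lineDerivOp w g) := by
    ext z
    have h1 : (SchwartzMap.compSubConstCLM ℂ (-v) g : Mink → ℂ) = fun z => g (z - (-v)) := rfl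
    rw [SchwartzMap.lineDerivOp_apply_eq_fderiv, SchwartzMap.compSubConstCLM_apply,
      SchwartzMap.lineDerivOp_apply_eq_fderiv, h1, fderiv_comp_sub]
  simp only [taylorRem, ← lineDerivOpCLM_apply (R := ℂ)] at h ⊢
  simp only [map_sub, h]
  simp only [lineDerivOpCLM_apply, lineDerivOp_comm v w]

/-- The first order Taylor remainder is of order `o(‖v‖)` in the topology of the Schwartz space. As
the class of the remainders is closed under partial derivatives, it suffices to bound the seminorms
without derivatives. -/
theorem tendsto_taylorRem (g : Test1) :
    Tendsto (fun v : Mink => ((‖v‖⁻¹ : ℝ) : ℂ) • taylorRem g v) (𝓝 0) (𝓝 0) := by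
  refine tendsto_zero_of_closed_lineDeriv
    (fun u => ∃ g, u = fun v => ((‖v‖⁻¹ : ℝ) : ℂ) • taylorRem g v) ?_ ?_ _ ⟨g, rfl⟩
  · rintro _ ⟨g, rfl⟩ w
    refine ⟨lineDerivOp w g, funext fun v => ?_⟩
    rw [← lineDerivOp_taylorRem]
    exact lineDerivOp_smul w _ _
  · rintro _ ⟨g, rfl⟩ k
    obtain ⟨C, hC, h⟩ := exists_taylor_bound g k
    have hlim : Tendsto (fun v : Mink => C * ‖v‖) (𝓝 0) (𝓝 0) := by
      have : Continuous fun v : Mink => C * ‖v‖ := by fun_prop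
      simpa using this.tendsto 0
    refine squeeze_zero' (Eventually.of_forall fun _ => apply_nonneg _ _) ?_ hlim
    filter_upwards [Metric.closedBall_mem_nhds (0 : Mink) one_pos] with v hv
    rw [mem_closedBall_zero_iff] at hv
    refine SchwartzMap.seminorm_le_bound ℂ k 0 _ (by positivity) fun z => ?_
    have h1 := h z v hv
    rw [norm_iteratedFDeriv_zero, smul_apply, taylorRem_apply, norm_smul,
      Complex.norm_real, norm_inv, norm_norm]
    rcases (norm_nonneg v).eq_or_lt with h0 | hpos
    · simp [← h0]
    · calc _ = (‖z‖ ^ k * ‖g (z + v) - g z - fderiv ℝ g z v‖) / ‖v‖ := by ring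
        _ ≤ C * ‖v‖ ^ 2 / ‖v‖ := by gcongr
        _ = _ := by field_simp

theorem reflectAt_add (g h : Test1) (x : Mink) :
    reflectAt (g + h) x = reflectAt g x + reflectAt h x := by
  ext y; simp

theorem reflectAt_smul (c : ℂ) (g : Test1) (x : Mink) :
    reflectAt (c • g) x = c • reflectAt g x := by
  ext y; simp

theorem continuous_reflectAt_left (x : Mink) : Continuous fun g => reflectAt g x :=
  (SchwartzMap.compSubConstCLM ℂ x).continuous.comp
    (SchwartzMap.compCLMOfContinuousLinearEquiv ℂ (ContinuousLinearEquiv.neg ℝ)).continuous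

theorem reflectAt_taylorRem (g : Test1) (x v : Mink) :
    reflectAt (taylorRem g v) x =
      reflectAt g (x + v) - reflectAt g x - reflectAt (lineDerivOp v g) x := by
  ext y
  simp only [reflectAt_apply, taylorRem_apply, sub_apply,
    SchwartzMap.lineDerivOp_apply_eq_fderiv]
  congr 3
  abel_nf

/-- The translates of a Schwartz function have at most polynomial growth. -/
theorem exists_seminorm_reflectAt_le (k n : ℕ) : ∀ g : Test1, ∃ C, 0 ≤ C ∧ ∀ x,
    SchwartzMap.seminorm ℂ k n (reflectAt g x) ≤ C * (1 + ‖x‖) ^ k := by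
  induction n with
  | zero =>
    intro g
    obtain ⟨C, hC, h⟩ := exists_decay g k
    refine ⟨C, hC, fun x => SchwartzMap.seminorm_le_bound ℂ k 0 _ (by positivity) fun y => ?_⟩
    rw [norm_iteratedFDeriv_zero, reflectAt_apply]
    have h1 : ‖y‖ ≤ (1 + ‖x‖) * (1 + ‖x - y‖) := by
      have : ‖y‖ ≤ ‖x‖ + ‖x - y‖ := by
        have := norm_sub_le x (x - y); simpa using this
      nlinarith [norm_nonneg x, norm_nonneg (x - y)]
    calc ‖y‖ ^ k * ‖g (x - y)‖ ≤ ((1 + ‖x‖) * (1 + ‖x - y‖)) ^ k * ‖g (x - y)‖ := by gcongr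
      _ = (1 + ‖x‖) ^ k * ((1 + ‖x - y‖) ^ k * ‖g (x - y)‖) := by rw [mul_pow, mul_assoc]
      _ ≤ (1 + ‖x‖) ^ k * C := by gcongr; exact h _
      _ = _ := mul_comm _ _
  | succ n ih =>
    intro g
    obtain ⟨m, e, A, hA, hle⟩ := exists_seminorm_succ_le (E := Mink)
    choose C hC h using fun i => ih (lineDerivOp (e i) g)
    refine ⟨A * ∑ i, C i, mul_nonneg hA (Finset.sum_nonneg fun i _ => hC i), fun x => ?_⟩
    refine (hle k n _).trans ?_
    rw [mul_assoc, Finset.sum_mul]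
    gcongr with i _
    rw [lineDeriv_reflectAt, map_neg_eq_map]
    exact h i x

theorem exists_reflectAt_le (q : Seminorm ℂ Test1) (hq : Continuous q) (g : Test1) :
    ∃ (K : ℕ) (C : ℝ), 0 ≤ C ∧ ∀ x, q (reflectAt g x) ≤ C * (1 + ‖x‖) ^ K := by
  obtain ⟨s, A, -, h⟩ := Seminorm.bound_of_continuous (schwartz_withSeminorms ℂ Mink ℂ) q hq
  have hs : ∃ (K : ℕ) (C : ℝ), 0 ≤ C ∧ ∀ x,
      s.sup (schwartzSeminormFamily ℂ Mink ℂ) (reflectAt g x) ≤ C * (1 + ‖x‖) ^ K := by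
    clear h
    induction s using Finset.induction_on with
    | empty => exact ⟨0, 0, le_rfl, fun x => by simp⟩
    | insert i s _ ih =>
      obtain ⟨K, C, hC, h⟩ := ih
      obtain ⟨C', hC', h'⟩ := exists_seminorm_reflectAt_le i.1 i.2 g
      refine ⟨max i.1 K, C + C', by positivity, fun x => ?_⟩
      have h1 : 1 ≤ 1 + ‖x‖ := by linarith [norm_nonneg x]
      rw [Finset.sup_insert]
      refine max_le ((h' x).trans ?_) ((h x).trans ?_)
      · exact mul_le_mul (by linarith) (pow_le_pow_right₀ h1 (le_max_left _ _)) (by positivity)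
          (by positivity)
      · exact mul_le_mul (by linarith) (pow_le_pow_right₀ h1 (le_max_right _ _)) (by positivity)
          (by positivity)
  obtain ⟨K, C, hC, hs⟩ := hs
  refine ⟨K, A * C, by positivity, fun x => (h _).trans ?_⟩
  rw [mul_assoc]
  exact mul_le_mul_of_nonneg_left (hs x) A.2

/-- The derivative of `smear D g`. -/
def smearDeriv (D : Dist1) (g : Test1) (x : Mink) : Mink →L[ℝ] ℂ :=
  LinearMap.toContinuousLinearMap
    { toFun := fun v => smear D (lineDerivOp v g) x
      map_add' := fun v w => by
        simp only [smear, lineDerivOp_left_add, reflectAt_add, map_add]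
      map_smul' := fun c v => by
        have : lineDerivOp (c • v) g = (c : ℂ) • lineDerivOp v g := by
          rw [lineDerivOp_left_smul]; rfl
        simp only [smear, this, reflectAt_smul, map_smul]
        rfl }

theorem smearDeriv_apply (D : Dist1) (g : Test1) (x v : Mink) :
    smearDeriv D g x v = smear D (lineDerivOp v g) x := rfl

theorem hasFDerivAt_smear (D : Dist1) (g : Test1) (x : Mink) :
    HasFDerivAt (smear D g) (smearDeriv D g x) x := by
  rw [hasFDerivAt_iff_tendsto]
  have h := (D.continuous.comp (continuous_reflectAt_left x)).tendsto 0
  have h0 : reflectAt 0 x = 0 := by ext y; simp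
  have h1 := (h.comp (tendsto_taylorRem g)).norm
  simp only [Function.comp_def, h0, map_zero, norm_zero, reflectAt_smul, map_smul, norm_smul,
    reflectAt_taylorRem, map_sub, Complex.norm_real, norm_inv, norm_norm] at h1
  have h2 : Tendsto (fun x' : Mink => x' - x) (𝓝 x) (𝓝 0) := by
    have : Continuous fun x' : Mink => x' - x := by fun_prop
    simpa using this.tendsto x
  refine (h1.comp h2).congr fun x' => ?_
  simp [smearDeriv_apply, smear]

theorem exists_smear_le (D : Dist1) (g : Test1) :
    ∃ (K : ℕ) (C : ℝ), 0 ≤ C ∧ ∀ x, ‖smear D g x‖ ≤ C * (1 + ‖x‖) ^ K :=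
  exists_reflectAt_le ((normSeminorm ℂ ℂ).comp D.toLinearMap)
    (continuous_norm.comp D.continuous) g

theorem smear_hasTemperateGrowth (D : Dist1) (g : Test1) :
    (smear D g).HasTemperateGrowth := by
  let b := Module.finBasis ℝ Mink
  let L : Fin (Module.finrank ℝ Mink) → ℂ →L[ℝ] (Mink →L[ℝ] ℂ) := fun i =>
    ContinuousLinearMap.smulRightL ℝ Mink ℂ (LinearMap.toContinuousLinearMap (b.coord i))
  have hf : ∀ g : Test1, fderiv ℝ (smear D g) =
      fun x => ∑ i, (L i) (smear D (lineDerivOp (b i) g) x) := by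
    intro g
    funext x
    rw [(hasFDerivAt_smear D g x).fderiv]
    ext v
    conv_lhs => rw [← b.sum_repr v, map_sum]
    simp [L, smearDeriv_apply]
  have hd : ∀ g, Differentiable ℝ (smear D g) := fun g x =>
    (hasFDerivAt_smear D g x).differentiableAt
  have hc : ∀ (n : ℕ) (g : Test1), ContDiff ℝ n (smear D g) := by
    intro n
    induction n with
    | zero => exact fun g => contDiff_zero.2 (hd g).continuous
    | succ n ih =>
      intro g
      rw [Nat.cast_succ]
      refine contDiff_succ_iff_fderiv.2 ⟨hd g, by simp, ?_⟩
      rw [hf]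
      exact ContDiff.sum fun i _ => (L i).contDiff.comp (ih _)
  refine ⟨contDiff_infty.2 fun n => hc n g, fun n => ?_⟩
  induction n generalizing g with
  | zero =>
    obtain ⟨K, C, -, h⟩ := exists_smear_le D g
    exact ⟨K, C, by simpa using h⟩
  | succ n ih =>
    choose K C h using fun i => ih (lineDerivOp (b i) g)
    refine ⟨∑ i, K i, ∑ i, ‖L i‖ * |C i|, fun x => ?_⟩
    rw [← norm_iteratedFDeriv_fderiv, hf,
      iteratedFDeriv_fun_sum_apply (f := fun i x => L i (smear D (lineDerivOp (b i) g) x))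
        fun i _ => ((L i).contDiff.comp (hc n _)).contDiffAt,
      Finset.sum_mul]
    refine (norm_sum_le _ _).trans (Finset.sum_le_sum fun i _ => ?_)
    refine ((L i).norm_iteratedFDeriv_comp_left (hc n _).contDiffAt le_rfl).trans ?_
    rw [mul_assoc]
    refine mul_le_mul_of_nonneg_left ((h i x).trans ?_) (by positivity)
    have h1 : 1 ≤ 1 + ‖x‖ := by linarith [norm_nonneg x]
    exact mul_le_mul (le_abs_self _) (pow_le_pow_right₀ h1
      (Finset.single_le_sum (fun _ _ => Nat.zero_le _) (Finset.mem_univ i))) (by positivity)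
      (by positivity)

/-! ### Derivatives and integration by parts -/

theorem pderiv_eq (α : Fin 4 → ℕ) : ∃ vs : List Mink, vs.length = order α ∧
    ∀ g, pderiv α g = vs.foldr (fun v h => lineDerivOp v h) g := by
  have hpow : ∀ (v : Mink) (n : ℕ) (g : Test1), ((lineDerivOpCLM ℂ Test1 v) ^ n) g =
      (List.replicate n v).foldr (fun v h => lineDerivOp v h) g := by
    intro v n g
    induction n with
    | zero => rfl
    | succ n ih => rw [pow_succ', List.replicate_succ]; simp [← ih]
  refine ⟨(List.ofFn fun μ : Fin 4 =>
    List.replicate (α μ) (EuclideanSpace.single μ (1 : ℝ) : Mink)).flatten, ?_, fun g => ?_⟩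
  · simp [order, Fin.sum_univ_succ, List.ofFn_succ]
  · simp [pderiv, List.ofFn_succ, hpow, List.foldr_append]

/-- A property of `lineDerivOp v` for all `v`, compatible with composition, holds for `pderiv α`. -/
theorem pderiv_induction {P : ℕ → (Test1 → Test1) → Prop} (h0 : P 0 id)
    (h1 : ∀ (n : ℕ) (T : Test1 → Test1) (v : Mink), P n T → P (n + 1) fun g => lineDerivOp v (T g)) (α : Fin 4 → ℕ) :
    P (order α) (pderiv α) := by
  obtain ⟨vs, hl, h⟩ := pderiv_eq α
  have : (pderiv α : Test1 → Test1) = fun g => vs.foldr (fun v h => lineDerivOp v h) g := funext h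
  rw [this, ← hl]
  clear hl h this
  induction vs with
  | nil => exact h0
  | cons v vs ih => exact h1 _ _ v ih

theorem pderiv_lineDerivOp (α : Fin 4 → ℕ) (v : Mink) (g : Test1) :
    pderiv α (lineDerivOp v g) = lineDerivOp v (pderiv α g) := by
  revert g
  refine pderiv_induction (P := fun _ T => ∀ g, T (lineDerivOp v g) = lineDerivOp v (T g))
    (fun _ => rfl) (fun n T w h g => ?_) α
  change lineDerivOp w (T (lineDerivOp v g)) = _
  rw [h, lineDerivOp_comm]

theorem pderiv_comm (α β : Fin 4 → ℕ) (g : Test1) :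
    pderiv α (pderiv β g) = pderiv β (pderiv α g) := by
  revert g
  refine pderiv_induction (P := fun _ T => ∀ g, pderiv α (T g) = T (pderiv α g))
    (fun _ => rfl) (fun n T w h g => ?_) β
  rw [pderiv_lineDerivOp, h]

theorem pderiv_zero (g : Test1) : pderiv 0 g = g := by
  simp [pderiv, List.ofFn_succ]

theorem order_zero : order 0 = 0 := by simp [order]

theorem pderiv_reflectAt (α : Fin 4 → ℕ) (g : Test1) (x : Mink) :
    pderiv α (reflectAt g x) = (-1 : ℂ) ^ order α • reflectAt (pderiv α g) x := by
  revert g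
  refine pderiv_induction (P := fun n T => ∀ g, T (reflectAt g x) =
    (-1 : ℂ) ^ n • reflectAt (T g) x) (fun _ => by simp) (fun n T w h g => ?_) α
  change lineDerivOp w (T (reflectAt g x)) = _
  rw [h, lineDerivOp_smul, lineDeriv_reflectAt, pow_succ]
  simp

theorem smear_distDeriv (α : Fin 4 → ℕ) (D : Dist1) (g : Test1) (x : Mink) :
    smear (distDeriv α D) g x = smear D (pderiv α g) x := by
  simp only [smear, distDeriv, smul_apply, ContinuousLinearMap.comp_apply,
    pderiv_reflectAt, map_smul, smul_smul, ← mul_pow]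
  simp

theorem integral_lineDerivOp_mul_smear (D : Dist1) (f g : Test1) (v : Mink) :
    ∫ x, lineDerivOp v f x * smear D g x = - ∫ x, f x * smear D (lineDerivOp v g) x := by
  have hg := fun g => smear_hasTemperateGrowth D g
  have hi : ∀ f g : Test1, MeasureTheory.Integrable (fun x => f x * smear D g x) := by
    intro f g
    refine (SchwartzMap.smulLeftCLM ℂ (smear D g) f).integrable.congr
      (Eventually.of_forall fun x => ?_)
    simp [SchwartzMap.smulLeftCLM_apply_apply (hg g), mul_comm]
  have := integral_bilinear_hasLineDerivAt_right_eq_neg_left_of_integrable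
    (μ := MeasureTheory.volume) (v := v) (B := ContinuousLinearMap.mul ℝ ℂ)
    (f := f) (f' := lineDerivOp v f) (g := smear D g) (g' := smear D (lineDerivOp v g))
    (hi _ _) (hi _ _) (hi _ _) (fun x _ => (f.hasFDerivAt x).hasLineDerivAt v)
    (fun x _ => (hasFDerivAt_smear D g x).hasLineDerivAt v)
  simp only [ContinuousLinearMap.mul_apply'] at this
  rw [this, neg_neg]

theorem integral_pderiv_mul_smear (D : Dist1) (f g : Test1) (α : Fin 4 → ℕ) :
    ∫ x, pderiv α f x * smear D g x = (-1 : ℂ) ^ order α * ∫ x, f x * smear D (pderiv α g) x := by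
  -- the commutation with partial derivatives is carried along
  refine (pderiv_induction (P := fun n T => (∀ f g : Test1, ∫ x, T f x * smear D g x =
    (-1 : ℂ) ^ n * ∫ x, f x * smear D (T g) x) ∧ ∀ (v : Mink) g, T (lineDerivOp v g) = lineDerivOp v (T g))
    ⟨fun _ _ => by simp, fun _ _ => rfl⟩ (fun n T (v : Mink) h => ⟨fun f g => ?_, fun w g => ?_⟩) α).1 f g
  · rw [integral_lineDerivOp_mul_smear, h.1, h.2, pow_succ]
    ring
  · change lineDerivOp v (T (lineDerivOp w g)) = _
    rw [h.2, lineDerivOp_comm]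

theorem integrable_mul_of_hasTemperateGrowth {h : Mink → ℂ} (hh : h.HasTemperateGrowth)
    (f : Test1) : MeasureTheory.Integrable (fun x => f x * h x) := by
  refine (SchwartzMap.smulLeftCLM ℂ h f).integrable.congr (Eventually.of_forall fun x => ?_)
  simp [SchwartzMap.smulLeftCLM_apply_apply hh, mul_comm]

/-! ### Complex conjugation -/

@[simp]
theorem conjTest_apply (f : Test1) (x : Mink) : conjTest f x = conj (f x) := by
  simp [conjTest]

theorem lineDerivOp_conjTest (v : Mink) (f : Test1) :
    lineDerivOp v (conjTest f) = conjTest (lineDerivOp v f) := by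
  ext x
  have h : (conjTest f : Mink → ℂ) = fun x => Complex.conjCLE (f x) :=
    funext fun x => conjTest_apply f x
  have h2 : HasFDerivAt (fun x => Complex.conjCLE (f x)) _ x :=
    Complex.conjCLE.hasFDerivAt.comp x (f.hasFDerivAt x)
  rw [SchwartzMap.lineDerivOp_apply_eq_fderiv, h, h2.fderiv]
  simp [SchwartzMap.lineDerivOp_apply_eq_fderiv]

theorem pderiv_conjTest (α : Fin 4 → ℕ) (f : Test1) :
    pderiv α (conjTest f) = conjTest (pderiv α f) := by
  revert f
  refine pderiv_induction (P := fun _ T => ∀ f, T (conjTest f) = conjTest (T f))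
    (fun _ => rfl) (fun n T w h g => ?_) α
  change lineDerivOp w (T (conjTest g)) = _
  rw [h, lineDerivOp_conjTest]

theorem integral_conjTest_mul (f : Test1) (h : Mink → ℂ) :
    ∫ x, conjTest f x * h x = conj (∫ x, f x * conj (h x)) := by
  rw [← integral_conj]
  simp

/-! ### Frequency cut-offs -/

open FourierTransform

/-- The symbol of `freqCut s ε`. -/
def cutSymbol (s ε : ℝ) (ξ : Mink) : ℂ := ((Real.smoothTransition (-(s * ξ 0) / ε) : ℝ) : ℂ)

theorem fourier_freqCut (s ε : ℝ) (g : Test1) :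
    𝓕 (freqCut s ε g) = SchwartzMap.smulLeftCLM ℂ (cutSymbol s ε) (𝓕 g) := by
  show 𝓕 (SchwartzMap.fourierMultiplierCLM ℂ (cutSymbol s ε) g) = _
  rw [SchwartzMap.fourierMultiplierCLM_apply, FourierTransform.fourier_fourierInv_eq]

theorem fourier_injective {f g : Test1} (h : (𝓕 f : Test1) = 𝓕 g) : f = g := by
  rw [← FourierTransform.fourierInv_fourier_eq (F := Test1) f, h,
    FourierTransform.fourierInv_fourier_eq]

theorem cutSymbol_neg (s ε : ℝ) (ξ : Mink) : cutSymbol (-s) ε ξ = cutSymbol s ε (-ξ) := by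
  simp [cutSymbol]

theorem smulLeftCLM_of_not {g : Mink → ℂ} (hg : ¬ g.HasTemperateGrowth) (f : Test1) :
    SchwartzMap.smulLeftCLM ℂ g f = 0 := by
  simp [SchwartzMap.smulLeftCLM, hg]

theorem freqCut_lineDerivOp (s ε : ℝ) (v : Mink) (g : Test1) :
    freqCut s ε (lineDerivOp v g) = lineDerivOp v (freqCut s ε g) := by
  refine fourier_injective ?_
  have hi : (fun x : Mink => inner ℝ x v).HasTemperateGrowth := by fun_prop
  rw [fourier_freqCut, SchwartzMap.fourier_lineDerivOp_eq, SchwartzMap.fourier_lineDerivOp_eq,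
    fourier_freqCut, map_smul]
  congr 1
  by_cases h : (cutSymbol s ε).HasTemperateGrowth
  · ext ξ
    simp [SchwartzMap.smulLeftCLM_apply_apply h, SchwartzMap.smulLeftCLM_apply_apply hi,
      mul_left_comm]
  · simp [smulLeftCLM_of_not h]

theorem freqCut_pderiv (s ε : ℝ) (α : Fin 4 → ℕ) (g : Test1) :
    freqCut s ε (pderiv α g) = pderiv α (freqCut s ε g) := by
  revert g
  refine pderiv_induction (P := fun _ T => ∀ g, freqCut s ε (T g) = T (freqCut s ε g))
    (fun _ => rfl) (fun n T w h g => ?_) α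
  rw [freqCut_lineDerivOp, h]

theorem fourier_reflectAt (g : Test1) (x ξ : Mink) :
    𝓕 (reflectAt g x) ξ = (Real.fourierChar (-(inner ℝ x ξ)) : ℂ) * 𝓕 g (-ξ) := by
  rw [SchwartzMap.fourier_coe, SchwartzMap.fourier_coe, Real.fourier_eq, Real.fourier_eq,
    ← MeasureTheory.integral_sub_left_eq_self _ _ x, ← MeasureTheory.integral_const_mul]
  congr 1
  funext y
  simp only [reflectAt_apply, sub_sub_cancel, inner_sub_left, inner_neg_right, neg_neg,
    neg_sub, Circle.smul_def, smul_eq_mul]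
  rw [sub_eq_neg_add, AddChar.map_add_eq_mul]
  push_cast
  ring

/-- Reflections exchange positive and negative frequencies. -/
theorem freqCut_reflectAt (s ε : ℝ) (g : Test1) (x : Mink) :
    freqCut s ε (reflectAt g x) = reflectAt (freqCut (-s) ε g) x := by
  refine fourier_injective ?_
  ext ξ
  rw [fourier_reflectAt, fourier_freqCut, fourier_freqCut]
  have hs : cutSymbol (-s) ε = cutSymbol s ε ∘ ContinuousLinearEquiv.neg ℝ := by
    funext ξ; exact cutSymbol_neg s ε ξ
  have hs' : cutSymbol s ε = cutSymbol (-s) ε ∘ ContinuousLinearEquiv.neg ℝ := by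
    funext ξ; simp [cutSymbol]
  by_cases h : (cutSymbol s ε).HasTemperateGrowth
  · have h' : (cutSymbol (-s) ε).HasTemperateGrowth := by
      rw [hs]; exact h.comp (ContinuousLinearEquiv.hasTemperateGrowth _)
    rw [SchwartzMap.smulLeftCLM_apply_apply h, SchwartzMap.smulLeftCLM_apply_apply h',
      fourier_reflectAt, cutSymbol_neg, neg_neg, smul_eq_mul, smul_eq_mul, mul_left_comm]
  · have h' : ¬ (cutSymbol (-s) ε).HasTemperateGrowth := fun h' => h (by
      rw [hs']; exact h'.comp (ContinuousLinearEquiv.hasTemperateGrowth _))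
    rw [smulLeftCLM_of_not h, smulLeftCLM_of_not h']
    simp

/-- There is no overlap between positive and negative frequencies. -/
theorem freqCut_freqCut (δ ε : ℝ) (hδ : 0 < δ) (hε : 0 < ε) (g : Test1) :
    freqCut 1 δ (freqCut (-1) ε g) = 0 := by
  refine fourier_injective ?_
  have h0 : (𝓕 (0 : Test1) : Test1) = 0 := (fourierCLM ℂ Test1).map_zero
  rw [fourier_freqCut, fourier_freqCut, h0]
  by_cases h : (cutSymbol 1 δ).HasTemperateGrowth
  · by_cases h' : (cutSymbol (-1) ε).HasTemperateGrowth
    · ext ξ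
      rw [SchwartzMap.smulLeftCLM_apply_apply h, SchwartzMap.smulLeftCLM_apply_apply h',
        smul_smul]
      have : cutSymbol 1 δ ξ * cutSymbol (-1) ε ξ = 0 := by
        rcases le_total (ξ 0) 0 with h0 | h0
        · have : cutSymbol (-1) ε ξ = 0 := by
            simp only [cutSymbol, Complex.ofReal_eq_zero]
            refine Real.smoothTransition.zero_of_nonpos ?_
            exact div_nonpos_of_nonpos_of_nonneg (by linarith) hε.le
          rw [this, mul_zero]
        · have : cutSymbol 1 δ ξ = 0 := by
            simp only [cutSymbol, Complex.ofReal_eq_zero]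
            refine Real.smoothTransition.zero_of_nonpos ?_
            exact div_nonpos_of_nonpos_of_nonneg (by linarith) hδ.le
          rw [this, zero_mul]
      rw [this, zero_smul]
      rfl
    · simp [smulLeftCLM_of_not h']
  · exact smulLeftCLM_of_not h _

/-! ### Functions are determined by their integrals against products of test functions -/

/-- A continuous function with vanishing integrals against all products of test functions is zero:
where it does not vanish, it is tested with a product of bump functions. -/
theorem eq_zero_of_integral_prod_mul {k : ℕ} {K : (Fin k → Mink) → ℂ} (hK : Continuous K)
    (h : ∀ f : Fin k → Test1, ∫ x, (∏ i, f i (x i)) * K x = 0) : K = 0 := by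
  by_contra hne
  obtain ⟨x₀, hx₀⟩ := Function.ne_iff.1 hne
  -- `c * K` has positive real part at `x₀`
  set c := conj (K x₀) with hc
  have hpos : 0 < (c * K x₀).re := by
    rw [hc, mul_comm, Complex.mul_conj, Complex.ofReal_re]
    exact Complex.normSq_pos.2 hx₀
  have hcont : Continuous fun x => (c * K x).re := by fun_prop
  obtain ⟨R, hR, hball⟩ := Metric.eventually_nhds_iff_ball.1
    (hcont.continuousAt.eventually (lt_mem_nhds hpos))
  let φ : ∀ i, ContDiffBump (x₀ i) := fun i => ⟨R / 2, R, by positivity, by linarith⟩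
  have hsm : ∀ i, ContDiff ℝ ((⊤ : ℕ∞) : WithTop ℕ∞) fun y => ((φ i y : ℝ) : ℂ) := fun i =>
    Complex.ofRealCLM.contDiff.comp (φ i).contDiff
  have hcs : ∀ i, HasCompactSupport fun y => ((φ i y : ℝ) : ℂ) := fun i =>
    (φ i).hasCompactSupport.comp_left (g := Complex.ofReal) Complex.ofReal_zero
  let f : Fin k → Test1 := fun i => (hcs i).toSchwartzMap (hsm i)
  have hf : ∀ i y, f i y = ((φ i y : ℝ) : ℂ) := fun i y => rfl
  let w : (Fin k → Mink) → ℝ := fun x => ∏ i, φ i (x i)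
  have hw0 : ∀ x, 0 ≤ w x := fun x => Finset.prod_nonneg fun i _ => (φ i).nonneg
  have hwc : Continuous w := continuous_finsetProd _ fun i _ =>
    (φ i).continuous.comp (continuous_apply i)
  have hwsupp : ∀ x, x ∉ Metric.ball x₀ R → w x = 0 := by
    intro x hx
    by_contra hwx
    refine hx ?_
    rw [Metric.mem_ball, dist_pi_lt_iff hR]
    intro i
    have hi : φ i (x i) ≠ 0 := fun h0 => hwx (Finset.prod_eq_zero (Finset.mem_univ i) h0)
    have := (φ i).support_eq ▸ (Function.mem_support.2 hi)
    simpa using this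
  have hwcs : HasCompactSupport w := by
    refine HasCompactSupport.intro (isCompact_closedBall x₀ R) fun x hx => hwsupp x fun h => hx ?_
    exact Metric.ball_subset_closedBall h
  have hint : 0 < ∫ x, w x * (c * K x).re := by
    refine Continuous.integral_pos_of_hasCompactSupport_nonneg_nonzero (x := x₀)
      (hwc.mul hcont) hwcs.mul_right (fun x => ?_) ?_
    · by_cases hx : x ∈ Metric.ball x₀ R
      · exact mul_nonneg (hw0 x) (hball x hx).le
      · simp [hwsupp x hx]
    · have : w x₀ = 1 := Finset.prod_eq_one fun i _ =>
        (φ i).one_of_mem_closedBall (Metric.mem_closedBall_self (by positivity))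
      simpa [this] using hpos.ne'
  have h2 : (c * ∫ x, (∏ i, f i (x i)) * K x).re = ∫ x, w x * (c * K x).re := by
    rw [← MeasureTheory.integral_const_mul]
    have hint' : MeasureTheory.Integrable fun x => c * ((∏ i, f i (x i)) * K x) := by
      refine Continuous.integrable_of_hasCompactSupport ?_ ?_
      · refine continuous_const.mul (Continuous.mul ?_ hK)
        exact continuous_finsetProd _ fun i _ => (f i).continuous.comp (continuous_apply i)
      · refine HasCompactSupport.mul_left (HasCompactSupport.mul_right ?_)
        have : (fun x : Fin k → Mink => ∏ i, f i (x i)) = fun x => ((w x : ℝ) : ℂ) := by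
          funext x; simp [hf, w]
        rw [this]
        exact hwcs.comp_left (g := Complex.ofReal) Complex.ofReal_zero
    rw [← RCLike.re_eq_complex_re, ← integral_re hint']
    congr 1
    funext x
    have : ∏ i, f i (x i) = ((w x : ℝ) : ℂ) := by simp [hf, w]
    rw [this, RCLike.re_eq_complex_re, mul_left_comm, Complex.re_ofReal_mul]
  rw [h f, mul_zero, Complex.zero_re] at h2
  exact hint.ne h2

theorem eq_zero_of_integral_mul {h : Mink → ℂ} (hh : Continuous h)
    (H : ∀ f : Test1, ∫ x, f x * h x = 0) : h = 0 := by
  have := eq_zero_of_integral_prod_mul (k := 1) (K := fun x => h (x 0)) (by fun_prop) fun f => by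
    have e := MeasureTheory.integral_fintype_prod_volume_eq_prod
      (fun (i : Fin 1) x => f i x * h x)
    simp only [Fin.prod_univ_one, H] at e ⊢
    exact e
  funext x
  exact congrFun this fun _ => x

/-! ### Completeness of Schwartz space and uniform boundedness -/

section Complete

variable {E : Type*} [NormedAddCommGroup E] [NormedSpace ℝ E]

/-- A series of Schwartz functions that converges absolutely in each seminorm converges. -/
theorem tendsto_sum_of_summable_seminorm (u : ℕ → 𝓢(E, ℂ))
    (hu : ∀ k n, Summable fun i => SchwartzMap.seminorm ℂ k n (u i)) :
    ∃ f : 𝓢(E, ℂ), Tendsto (fun N => ∑ i ∈ Finset.range N, u i) atTop (𝓝 f) := by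
  have hsm : ∀ i, ContDiff ℝ ((⊤ : ℕ∞) : WithTop ℕ∞) (u i) := fun i => (u i).smooth ⊤
  have hb : ∀ (n i : ℕ) (x : E), (n : ℕ∞) ≤ ⊤ →
      ‖iteratedFDeriv ℝ n (u i) x‖ ≤ SchwartzMap.seminorm ℂ 0 n (u i) := fun n i x _ =>
    SchwartzMap.norm_iteratedFDeriv_le_seminorm ℂ (u i) n x
  have hder : ∀ n x, iteratedFDeriv ℝ n (fun y => ∑' i, u i y) x =
      ∑' i, iteratedFDeriv ℝ n (u i) x := fun n x => by
    have := iteratedFDeriv_tsum_apply (N := ⊤) hsm (fun k _ => hu 0 k)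
      (fun k i x h => hb k i x (by simp)) (k := n) (by simp) x
    exact this
  have hsumm : ∀ n x, Summable fun i => iteratedFDeriv ℝ n (u i) x := fun n x =>
    Summable.of_norm_bounded (hu 0 n) fun i => hb n i x le_top
  have hle : ∀ (k n : ℕ) x (i : ℕ), ‖x‖ ^ k * ‖iteratedFDeriv ℝ n (u i) x‖ ≤
      SchwartzMap.seminorm ℂ k n (u i) := fun k n x i => SchwartzMap.le_seminorm ℂ k n (u i) x
  let f : 𝓢(E, ℂ) :=
    { toFun := fun x => ∑' i, u i x
      smooth' := contDiff_tsum hsm (fun k _ => hu 0 k) (fun k i x h => hb k i x (by simp))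
      decay' := fun k n => by
        refine ⟨∑' i, SchwartzMap.seminorm ℂ k n (u i), fun x => ?_⟩
        rw [hder]
        have h1 : Summable fun i => ‖x‖ ^ k * ‖iteratedFDeriv ℝ n (u i) x‖ :=
          Summable.of_nonneg_of_le (fun _ => by positivity) (hle k n x) (hu k n)
        calc ‖x‖ ^ k * ‖∑' i, iteratedFDeriv ℝ n (u i) x‖
            ≤ ‖x‖ ^ k * ∑' i, ‖iteratedFDeriv ℝ n (u i) x‖ := by
              gcongr
              refine norm_tsum_le_tsum_norm (Summable.of_nonneg_of_le (fun _ => by positivity)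
                (fun i => hb n i x le_top) (hu 0 n))
          _ = ∑' i, ‖x‖ ^ k * ‖iteratedFDeriv ℝ n (u i) x‖ := tsum_mul_left.symm
          _ ≤ _ := h1.tsum_le_tsum (hle k n x) (hu k n) }
  refine ⟨f, ?_⟩
  rw [(schwartz_withSeminorms ℂ E ℂ).tendsto_nhds _ f]
  rintro ⟨k, n⟩ ε hε
  -- the tails of the series of seminorms tend to `0`
  have htail := (tendsto_sum_nat_add fun i => SchwartzMap.seminorm ℂ k n (u i)).eventually
    (gt_mem_nhds hε)
  filter_upwards [htail] with N hN
  refine lt_of_le_of_lt ?_ hN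
  rw [SchwartzMap.schwartzSeminormFamily_apply]
  refine SchwartzMap.seminorm_le_bound ℂ k n _ (tsum_nonneg fun _ => apply_nonneg _ _) fun x => ?_
  have hs := (summable_nat_add_iff N).2 (hu k n)
  have h2 : iteratedFDeriv ℝ n (∑ i ∈ Finset.range N, u i - f : 𝓢(E, ℂ)) x =
      - ∑' i, iteratedFDeriv ℝ n (u (i + N)) x := by
    have hf : ContDiffAt ℝ n (f : E → ℂ) x := (f.smooth n).contDiffAt
    have hco : ((∑ i ∈ Finset.range N, u i - f : 𝓢(E, ℂ)) : E → ℂ) =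
        (fun x => ∑ i ∈ Finset.range N, u i x) - f := by
      funext x
      simp
    rw [hco, iteratedFDeriv_sub_apply
      (ContDiff.sum fun i _ => (u i).smooth n).contDiffAt hf,
      iteratedFDeriv_fun_sum_apply fun i _ => ((u i).smooth n).contDiffAt]
    have : iteratedFDeriv ℝ n f x = ∑' i, iteratedFDeriv ℝ n (u i) x := hder n x
    rw [this, ← (hsumm n x).sum_add_tsum_nat_add N]
    abel
  have hs1 : Summable fun i => ‖x‖ ^ k * ‖iteratedFDeriv ℝ n (u (i + N)) x‖ :=
    Summable.of_nonneg_of_le (fun _ => by positivity) (fun i => hle k n x _) hs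
  rw [h2, norm_neg]
  calc ‖x‖ ^ k * ‖∑' i, iteratedFDeriv ℝ n (u (i + N)) x‖
      ≤ ‖x‖ ^ k * ∑' i, ‖iteratedFDeriv ℝ n (u (i + N)) x‖ := by
        gcongr
        exact norm_tsum_le_tsum_norm (Summable.of_nonneg_of_le (fun _ => by positivity)
          (fun i => hb n _ x le_top) ((summable_nat_add_iff N).2 (hu 0 n)))
    _ = ∑' i, ‖x‖ ^ k * ‖iteratedFDeriv ℝ n (u (i + N)) x‖ := tsum_mul_left.symm
    _ ≤ _ := hs1.tsum_le_tsum (fun i => hle k n x _) hs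

instance completeSpace_schwartzMap : CompleteSpace 𝓢(E, ℂ) := by
  have : (uniformity 𝓢(E, ℂ)).IsCountablyGenerated :=
    IsUniformAddGroup.uniformity_countably_generated
  let U : ℕ → SetRel 𝓢(E, ℂ) 𝓢(E, ℂ) := fun N => {p | ∀ k ≤ N, ∀ n ≤ N,
    SchwartzMap.seminorm ℂ k n (p.2 - p.1) < (1 / 2 : ℝ) ^ N}
  have hU : ∀ N, U N ∈ uniformity 𝓢(E, ℂ) := by
    intro N
    rw [uniformity_eq_comap_nhds_zero]
    refine ⟨{f | ∀ k ≤ N, ∀ n ≤ N, SchwartzMap.seminorm ℂ k n f < (1 / 2 : ℝ) ^ N}, ?_,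
      fun p hp => hp⟩
    have h1 : ∀ k n, ∀ᶠ f in 𝓝 (0 : 𝓢(E, ℂ)),
        SchwartzMap.seminorm ℂ k n f < (1 / 2 : ℝ) ^ N := by
      intro k n
      have h2 := ((schwartz_withSeminorms ℂ E ℂ).continuous_seminorm (k, n)).tendsto 0
      refine h2.eventually (gt_mem_nhds ?_)
      simp
    have h2 : ∀ᶠ f in 𝓝 (0 : 𝓢(E, ℂ)), ∀ k ∈ Set.Iic N, ∀ n ∈ Set.Iic N,
        SchwartzMap.seminorm ℂ k n f < (1 / 2 : ℝ) ^ N :=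
      (eventually_all_finite (Set.finite_Iic N)).2 fun k _ =>
        (eventually_all_finite (Set.finite_Iic N)).2 fun n _ => h1 k n
    exact h2
  refine UniformSpace.complete_of_convergent_controlled_sequences U hU fun u hu => ?_
  obtain ⟨f, hf⟩ := tendsto_sum_of_summable_seminorm (fun i => u (i + 1) - u i) fun k n => by
    refine Summable.of_norm_bounded_eventually_nat summable_geometric_two ?_
    filter_upwards [eventually_ge_atTop (max k n)] with i hi
    rw [Real.norm_of_nonneg (apply_nonneg _ _)]
    exact (hu i i (i + 1) le_rfl (by omega) k (le_trans (le_max_left _ _) hi) n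
      (le_trans (le_max_right _ _) hi)).le
  refine ⟨f + u 0, ?_⟩
  simpa only [Finset.sum_range_sub, sub_add_cancel] using hf.add_const (u 0)

end Complete

/-- Pointwise bounded sequences of distributions are bounded by a continuous seminorm. -/
theorem exists_continuous_seminorm_bound (D : ℕ → Dist1)
    (h : ∀ g, ∃ C, ∀ m, ‖D m g‖ ≤ C) :
    ∃ q : Seminorm ℂ Test1, Continuous q ∧ ∀ m g, ‖D m g‖ ≤ q g := by
  have : (uniformity Test1).IsCountablyGenerated :=
    IsUniformAddGroup.uniformity_countably_generated
  let p : ℕ → Seminorm ℂ Test1 := fun m => (normSeminorm ℂ ℂ).comp (D m).toLinearMap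
  have hbdd : BddAbove (Set.range p) := by
    rw [Seminorm.bddAbove_range_iff]
    intro g
    obtain ⟨C, hC⟩ := h g
    exact ⟨C, by rintro _ ⟨m, rfl⟩; exact hC m⟩
  have hc := Seminorm.continuous_iSup (𝕜 := ℂ) p
    (fun m => continuous_norm.comp (D m).continuous) hbdd
  refine ⟨⨆ m, p m, by rw [Seminorm.coe_iSup_eq hbdd]; exact hc, fun m g => ?_⟩
  rw [Seminorm.coe_iSup_eq hbdd, iSup_apply]
  obtain ⟨C, hC⟩ := h g
  exact le_ciSup (f := fun m => p m g) ⟨C, by rintro _ ⟨m, rfl⟩; exact hC m⟩ m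

/-! ### Limits of products with smeared distributions -/

theorem tendsto_reflectAt (g : Test1) (x : Mink) :
    Tendsto (fun y => reflectAt g y) (𝓝 x) (𝓝 (reflectAt g x)) := by
  have h1 : Tendsto (fun v : Mink => taylorRem g v) (𝓝 0) (𝓝 0) := by
    have h := (Complex.continuous_ofReal.comp (continuous_norm (E := Mink))).tendsto 0
    have h2 := h.smul (tendsto_taylorRem g)
    simp only [Function.comp_def, norm_zero, Complex.ofReal_zero, zero_smul] at h2
    refine h2.congr fun v => ?_
    rcases eq_or_ne v 0 with rfl | hv
    · have : taylorRem g 0 = 0 := by ext z; simp [taylorRem_apply]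
      simp [this]
    · rw [smul_smul, ← Complex.ofReal_mul, mul_inv_cancel₀ (norm_ne_zero_iff.2 hv),
        Complex.ofReal_one, one_smul]
  let T : Mink →ₗ[ℝ] Test1 :=
    { toFun := fun v => lineDerivOp v g
      map_add' := fun v w => lineDerivOp_left_add v w g
      map_smul' := fun c v => lineDerivOp_left_smul c v g }
  have h2 : Tendsto T (𝓝 0) (𝓝 0) := by
    simpa using (LinearMap.continuous_of_finiteDimensional T).tendsto 0
  have h3 : Tendsto (fun y : Mink => y - x) (𝓝 x) (𝓝 0) := by
    have : Continuous fun y : Mink => y - x := by fun_prop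
    simpa using this.tendsto x
  have hc := (continuous_reflectAt_left x).tendsto 0
  have h0 : reflectAt 0 x = 0 := by ext y; simp
  rw [h0] at hc
  have h4 := (((hc.comp h1).add (hc.comp h2)).comp h3).const_add (reflectAt g x)
  simp only [add_zero, Function.comp_def] at h4
  refine h4.congr fun y => ?_
  rw [reflectAt_taylorRem, add_sub_cancel]
  change reflectAt g x + (reflectAt g y - reflectAt g x - reflectAt (lineDerivOp (y - x) g) x +
    reflectAt (lineDerivOp (y - x) g) x) = _
  abel

/-- If `D m → 0` pointwise, then the smooth functions `smear (D m) g` tend to `0` locally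
uniformly, the `D m` being equicontinuous. -/
theorem eventually_norm_smear_le {D : ℕ → Dist1} (h : ∀ g, Tendsto (fun m => D m g) atTop (𝓝 0))
    {q : Seminorm ℂ Test1} (hq : Continuous q) (hDq : ∀ m g, ‖D m g‖ ≤ q g) (g : Test1)
    (R : ℝ) {ε : ℝ} (hε : 0 < ε) :
    ∀ᶠ m in atTop, ∀ y ∈ Metric.closedBall (0 : Mink) R, ‖smear (D m) g y‖ ≤ ε := by
  have hU : ∀ y : Mink, ∀ᶠ z in 𝓝 y, q (reflectAt g z - reflectAt g y) < ε / 2 := by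
    intro y
    have h2 := (hq.tendsto 0).comp
      (show Tendsto (fun z => reflectAt g z - reflectAt g y) (𝓝 y) (𝓝 0) by
        simpa using (tendsto_reflectAt g y).sub_const (reflectAt g y))
    rw [map_zero] at h2
    exact h2.eventually (gt_mem_nhds (half_pos hε))
  obtain ⟨t, -, ht⟩ := (isCompact_closedBall (0 : Mink) R).elim_nhds_subcover
    (fun y => {z | q (reflectAt g z - reflectAt g y) < ε / 2}) fun y _ => hU y
  have he : ∀ᶠ m in atTop, ∀ y ∈ t, ‖smear (D m) g y‖ < ε / 2 := by
    refine (eventually_all_finset t).2 fun y _ => ?_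
    have := (h (reflectAt g y)).norm
    rw [norm_zero] at this
    exact this.eventually (gt_mem_nhds (half_pos hε))
  filter_upwards [he] with m hm z hz
  obtain ⟨y, hy, hzy⟩ := Set.mem_iUnion₂.1 (ht hz)
  have h1 : smear (D m) g z = D m (reflectAt g z - reflectAt g y) + smear (D m) g y := by
    rw [map_sub]; exact (sub_add_cancel _ _).symm
  rw [h1]
  have h2 := (hDq m (reflectAt g z - reflectAt g y)).trans_lt hzy
  linarith [norm_add_le (D m (reflectAt g z - reflectAt g y)) (smear (D m) g y), hm y hy]

theorem smear_comp_hasTemperateGrowth {n : ℕ} (l : Fin n) (D : Dist1) (g : Test1) :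
    (fun x : Fin n → Mink => smear D g (x l)).HasTemperateGrowth :=
  (smear_hasTemperateGrowth D g).comp
    (ContinuousLinearMap.hasTemperateGrowth
      (ContinuousLinearMap.proj (R := ℝ) (φ := fun _ : Fin n => Mink) l))

theorem lineDerivOp_smulLeftCLM_smear {n : ℕ} (l : Fin n) (D : Dist1) (g : Test1) (f : Test n)
    (v : Fin n → Mink) :
    lineDerivOp v (SchwartzMap.smulLeftCLM ℂ (fun x : Fin n → Mink => smear D g (x l)) f) =
      SchwartzMap.smulLeftCLM ℂ (fun x : Fin n → Mink => smear D g (x l)) (lineDerivOp v f) +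
      SchwartzMap.smulLeftCLM ℂ (fun x : Fin n → Mink => smear D (lineDerivOp (v l) g) (x l)) f := by
  have ht := fun g => smear_comp_hasTemperateGrowth l D g
  ext x
  have hco : (SchwartzMap.smulLeftCLM ℂ (fun x : Fin n → Mink => smear D g (x l)) f :
      (Fin n → Mink) → ℂ) = fun x => smear D g (x l) * f x := by
    funext x; simp [SchwartzMap.smulLeftCLM_apply_apply (ht g)]
  have hp : HasFDerivAt (fun x : Fin n → Mink => x l)
      (ContinuousLinearMap.proj (R := ℝ) (φ := fun _ : Fin n => Mink) l) x := hasFDerivAt_apply l x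
  have hd : HasFDerivAt (fun x : Fin n → Mink => smear D g (x l))
      ((smearDeriv D g (x l)).comp
        (ContinuousLinearMap.proj (R := ℝ) (φ := fun _ : Fin n => Mink) l)) x :=
    HasFDerivAt.comp (f := fun x : Fin n → Mink => x l) x (hasFDerivAt_smear D g (x l)) hp
  rw [SchwartzMap.lineDerivOp_apply_eq_fderiv, hco, (hd.fun_mul (f.hasFDerivAt x)).fderiv]
  simp [SchwartzMap.smulLeftCLM_apply_apply (ht _), SchwartzMap.lineDerivOp_apply_eq_fderiv,
    smearDeriv_apply, mul_comm]

/-- If the distributions `D_m` converge to zero pointwise, then multiplication with the functions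
`D_m * g` converges to zero strongly on test functions. By the principle of uniform boundedness the
`D_m` are equicontinuous, so that the products are dominated by one function of polynomial growth,
and they converge to zero locally uniformly. -/
theorem tendsto_smulLeftCLM_smear_zero {n : ℕ} (l : Fin n) {D : ℕ → Dist1}
    (h : ∀ g, Tendsto (fun m => D m g) atTop (𝓝 0)) (g : Test1) (f : Test n) :
    Tendsto (fun m => SchwartzMap.smulLeftCLM ℂ (fun x : Fin n → Mink => smear (D m) g (x l)) f)
      atTop (𝓝 0) := by
  obtain ⟨q, hq, hDq⟩ := exists_continuous_seminorm_bound D fun g => by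
    obtain ⟨C, hC⟩ := (h g).norm.bddAbove_range
    exact ⟨C, fun m => hC ⟨m, rfl⟩⟩
  let M : Test n → Test1 → ℕ → Test n := fun f g m =>
    SchwartzMap.smulLeftCLM ℂ (fun x : Fin n → Mink => smear (D m) g (x l)) f
  -- the class of all sums of such families is closed under partial derivatives
  refine tendsto_zero_of_closed_lineDeriv
    (fun u => u ∈ AddSubmonoid.closure {u | ∃ f g, u = M f g}) ?_ ?_ _
    (AddSubmonoid.subset_closure ⟨f, g, rfl⟩)
  · intro u hu v
    induction hu using AddSubmonoid.closure_induction with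
    | mem u hu =>
      obtain ⟨f, g, rfl⟩ := hu
      have : (fun m => lineDerivOp v (M f g m)) = M (lineDerivOp v f) g +
          M f (lineDerivOp (v l) g) := by
        funext m
        exact lineDerivOp_smulLeftCLM_smear l (D m) g f v
      rw [this]
      exact add_mem (AddSubmonoid.subset_closure ⟨_, _, rfl⟩)
        (AddSubmonoid.subset_closure ⟨_, _, rfl⟩)
    | zero =>
      have : (fun m : ℕ => lineDerivOp v ((0 : ℕ → Test n) m)) = 0 := by
        funext m
        exact (lineDerivOpCLM ℂ (Test n) v).map_zero
      rw [this]
      exact zero_mem _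
    | add u w _ _ hu hw =>
      have : (fun m => lineDerivOp v ((u + w) m)) =
          (fun m => lineDerivOp v (u m)) + fun m => lineDerivOp v (w m) := by
        funext m
        exact lineDerivOp_add v _ _
      rw [this]
      exact add_mem hu hw
  · intro u hu k
    induction hu using AddSubmonoid.closure_induction with
    | mem u hu =>
      obtain ⟨f, g, rfl⟩ := hu
      obtain ⟨K, C, hC, hgr⟩ := exists_reflectAt_le q hq g
      obtain ⟨A, hA, hdec⟩ := exists_decay f (k + K + 1)
      rw [Metric.tendsto_atTop']
      intro ε hε
      -- outside of the ball of radius `R` the decay of `f` suffices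
      set R := 2 * (C * A) / ε with hR
      have hR0 : 0 ≤ R := by positivity
      obtain ⟨m₀, hm₀⟩ := eventually_atTop.1 (eventually_norm_smear_le h hq hDq g R
        (ε := ε / (2 * (A + 1))) (by positivity))
      refine ⟨m₀, fun m hm => ?_⟩
      rw [dist_zero_right, Real.norm_of_nonneg (apply_nonneg _ _)]
      refine lt_of_le_of_lt ?_ (half_lt_self hε)
      refine SchwartzMap.seminorm_le_bound ℂ k 0 _ (by positivity) fun x => ?_
      have hx1 : 1 ≤ 1 + ‖x‖ := by linarith [norm_nonneg x]
      have hM : M f g m x = smear (D m) g (x l) * f x := by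
        simp [M, SchwartzMap.smulLeftCLM_apply_apply (smear_comp_hasTemperateGrowth l (D m) g)]
      have hxk : ‖x‖ ^ k ≤ (1 + ‖x‖) ^ k := by gcongr; linarith
      rw [norm_iteratedFDeriv_zero, hM, norm_mul]
      by_cases hxR : ‖x‖ ≤ R
      · have h1 := hm₀ m hm.le (x l) (by
          rw [mem_closedBall_zero_iff]; exact (norm_le_pi_norm x l).trans hxR)
        have h2 : ‖x‖ ^ k * ‖f x‖ ≤ A := by
          refine le_trans ?_ (hdec x)
          gcongr
          exact hxk.trans (pow_le_pow_right₀ hx1 (by omega))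
        calc ‖x‖ ^ k * (‖smear (D m) g (x l)‖ * ‖f x‖)
            = ‖smear (D m) g (x l)‖ * (‖x‖ ^ k * ‖f x‖) := by ring
          _ ≤ ε / (2 * (A + 1)) * A := by gcongr
          _ = ε / 2 * (A / (A + 1)) := by field_simp
          _ ≤ ε / 2 * 1 := by
            gcongr
            rw [div_le_one (by positivity)]
            linarith
          _ = ε / 2 := mul_one _
      · have h1 : ‖smear (D m) g (x l)‖ ≤ C * (1 + ‖x‖) ^ K := by
          refine (hDq m _).trans ((hgr _).trans ?_)
          gcongr
          exact norm_le_pi_norm x l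
        have h2 : (1 + ‖x‖) ^ (k + K) * ‖f x‖ ≤ A / (1 + ‖x‖) := by
          rw [le_div_iff₀ (by linarith)]
          have := hdec x
          rw [pow_succ] at this
          linarith
        calc ‖x‖ ^ k * (‖smear (D m) g (x l)‖ * ‖f x‖)
            ≤ (1 + ‖x‖) ^ k * (C * (1 + ‖x‖) ^ K * ‖f x‖) := by gcongr
          _ = C * ((1 + ‖x‖) ^ (k + K) * ‖f x‖) := by rw [pow_add]; ring
          _ ≤ C * (A / (1 + ‖x‖)) := by gcongr
          _ ≤ ε / 2 := by
            rw [← mul_div_assoc, div_le_iff₀ (by linarith)]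
            have h3 : R * ε = 2 * (C * A) := by rw [hR]; field_simp
            nlinarith
    | zero => simp
    | add u w _ _ hu hw =>
      refine squeeze_zero (fun _ => apply_nonneg _ _) (fun m => map_add_le_add _ _ _) ?_
      simpa using hu.add hw

/-- Multiplication of a test function with `smear D g` depends continuously on the distribution
`D`, with respect to sequences that converge pointwise. -/
theorem tendsto_smulLeftCLM_smear {n : ℕ} (l : Fin n) {D : ℕ → Dist1} {D' : Dist1}
    (h : ∀ g, Tendsto (fun m => D m g) atTop (𝓝 (D' g))) (g : Test1) (f : Test n) :
    Tendsto (fun m => SchwartzMap.smulLeftCLM ℂ (fun x : Fin n → Mink => smear (D m) g (x l)) f)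
      atTop (𝓝 (SchwartzMap.smulLeftCLM ℂ (fun x : Fin n → Mink => smear D' g (x l)) f)) := by
  have h0 := tendsto_smulLeftCLM_smear_zero l (D := fun m => D m - D') (fun g => by
    simpa using (h g).sub_const (D' g)) g f
  rw [← tendsto_sub_nhds_zero_iff]
  refine h0.congr fun m => ?_
  ext x
  have ht := fun D : Dist1 => smear_comp_hasTemperateGrowth l D g
  simp only [SchwartzMap.smulLeftCLM_apply_apply (ht _), sub_apply, smul_eq_mul]
  simp [smear, sub_mul]

/-! ### Signs -/

theorem sgn_add (m n : ℤ) : sgn (m + n) = sgn m * sgn n := by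
  simp [sgn, Int.negOnePow_add]

@[simp]
theorem sgn_zero : sgn 0 = 1 := by simp [sgn]

theorem sgn_mul_self (m : ℤ) : sgn m * sgn m = 1 := by
  rw [← sgn_add, sgn, Int.negOnePow_even _ ⟨m, rfl⟩]
  simp

theorem sgn_neg (m : ℤ) : sgn (-m) = sgn m := by
  simp [sgn, Int.negOnePow_neg]

@[simp]
theorem conj_sgn (m : ℤ) : conj (sgn m) = sgn m := by
  simp [sgn]

namespace FreeFields

variable {N r : ℕ} {F : Type*} [NormedAddCommGroup F] [InnerProductSpace ℂ F] [CompleteSpace F]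
  (S : FreeFields N F)

/-! ### Derivatives of the fields -/

/-- The index of the underived field `φ^A`. -/
def zeroIdx (r : ℕ) (A : Fin N) : JetIdx N r :=
  (A, ⟨0, by simp [multiIdx, order_zero]⟩)

@[simp]
theorem jetPlus_zeroIdx (A : Fin N) (f : Test1) : S.jetPlus (zeroIdx r A) f = S.plus A f := by
  simp [jetPlus, zeroIdx, order_zero, pderiv_zero]

@[simp]
theorem jetMinus_zeroIdx (A : Fin N) (f : Test1) : S.jetMinus (zeroIdx r A) f = S.minus A f := by
  simp [jetMinus, zeroIdx, order_zero, pderiv_zero]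

/-- The positive frequency part of the distribution `jetD`. -/
def jetDplus (a b : JetIdx N r) : Dist1 :=
  (-1 : ℂ) ^ order b.2 • distDeriv a.2 (distDeriv b.2 (S.Dplus a.1 b.1))

/-- The negative frequency part of the distribution `jetD`. -/
def jetDminus (a b : JetIdx N r) : Dist1 :=
  (-1 : ℂ) ^ order b.2 • distDeriv a.2 (distDeriv b.2 (S.Dminus a.1 b.1))

theorem smear_smul (c : ℂ) (D : Dist1) (g : Test1) (x : Mink) :
    smear (c • D) g x = c * smear D g x := rfl

theorem smear_add (D D' : Dist1) (g : Test1) (x : Mink) :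
    smear (D + D') g x = smear D g x + smear D' g x := rfl

theorem smear_jetDplus (a b : JetIdx N r) (g : Test1) (x : Mink) :
    smear (S.jetDplus a b) g x =
      (-1) ^ order b.2 * smear (S.Dplus a.1 b.1) (pderiv b.2 (pderiv a.2 g)) x := by
  rw [jetDplus, smear_smul, smear_distDeriv, smear_distDeriv]

theorem smear_jetDminus (a b : JetIdx N r) (g : Test1) (x : Mink) :
    smear (S.jetDminus a b) g x =
      (-1) ^ order b.2 * smear (S.Dminus a.1 b.1) (pderiv b.2 (pderiv a.2 g)) x := by
  rw [jetDminus, smear_smul, smear_distDeriv, smear_distDeriv]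

theorem smear_jetD (a b : JetIdx N r) (g : Test1) (x : Mink) :
    smear (S.jetD a b) g x = smear (S.jetDplus a b) g x + smear (S.jetDminus a b) g x := by
  rw [smear_jetDplus, smear_jetDminus, jetD, smear_smul, smear_distDeriv, smear_distDeriv,
    smear_add, mul_add]

theorem smear_jetDplus_eq_zero {a b : JetIdx N r} (h : S.z a.1 + S.z b.1 ≠ 0) (g : Test1)
    (x : Mink) : smear (S.jetDplus a b) g x = 0 := by
  rw [smear_jetDplus, (S.D_eq_zero _ _ h).1]
  simp [smear]

theorem smear_jetDminus_eq_zero {a b : JetIdx N r} (h : S.z a.1 + S.z b.1 ≠ 0) (g : Test1)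
    (x : Mink) : smear (S.jetDminus a b) g x = 0 := by
  rw [smear_jetDminus, (S.D_eq_zero _ _ h).2]
  simp [smear]

theorem jetPlus_jetPlus (a b : JetIdx N r) (f g : Test1) :
    S.jetPlus a f * S.jetPlus b g =
      sgn (S.z a.1 * S.z b.1) • (S.jetPlus b g * S.jetPlus a f) := by
  simp only [jetPlus, smul_mul_smul_comm, S.plus_plus a.1 b.1, smul_smul]
  congr 1
  ring

theorem jetMinus_jetMinus (a b : JetIdx N r) (f g : Test1) :
    S.jetMinus a f * S.jetMinus b g =
      sgn (S.z a.1 * S.z b.1) • (S.jetMinus b g * S.jetMinus a f) := by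
  simp only [jetMinus, smul_mul_smul_comm, S.minus_minus a.1 b.1, smul_smul]
  congr 1
  ring

theorem neg_one_pow_mul_integral (D : Dist1) (α β : Fin 4 → ℕ) (f g : Test1) :
    ((-1 : ℂ) ^ order α * (-1) ^ order β) * ∫ x, pderiv α f x * smear D (pderiv β g) x =
      ∫ x, f x * ((-1) ^ order β * smear D (pderiv β (pderiv α g)) x) := by
  rw [integral_pderiv_mul_smear, pderiv_comm α β]
  simp_rw [mul_left_comm (f _), MeasureTheory.integral_const_mul]
  have h : ((-1 : ℂ) ^ order α) * (-1) ^ order α = 1 := by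
    rw [← mul_pow]; simp
  linear_combination ((-1) ^ order β * ∫ x, f x * smear D (pderiv β (pderiv α g)) x) * h

theorem jetPlus_jetMinus (a b : JetIdx N r) (f g : Test1) :
    S.jetPlus a f * S.jetMinus b g = sgn (S.z a.1 * S.z b.1) • (S.jetMinus b g * S.jetPlus a f) +
      (∫ x, f x * smear (S.jetDplus a b) g x) • 1 := by
  simp only [smear_jetDplus]
  rw [← neg_one_pow_mul_integral, mul_smul, ← S.plus_minus a.1 b.1]
  simp only [jetPlus, jetMinus, smul_mul_smul_comm]
  module

theorem jetMinus_jetPlus (a b : JetIdx N r) (f g : Test1) :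
    S.jetMinus a f * S.jetPlus b g = sgn (S.z a.1 * S.z b.1) • (S.jetPlus b g * S.jetMinus a f) +
      (∫ x, f x * smear (S.jetDminus a b) g x) • 1 := by
  simp only [smear_jetDminus]
  rw [← neg_one_pow_mul_integral, mul_smul, ← S.minus_plus a.1 b.1]
  simp only [jetPlus, jetMinus, smul_mul_smul_comm]
  module

/-! ### The domain spanned by the fields -/

theorem vac_mem_poly : S.vac ∈ S.poly := Submodule.subset_span ⟨[], rfl⟩

theorem field_mem_poly (A : Fin N) (f : Test1) {χ : S.dom} (hχ : χ ∈ S.poly) :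
    (S.plus A f + S.minus A f) χ ∈ S.poly := by
  induction hχ using Submodule.span_induction with
  | mem χ h =>
    obtain ⟨L, rfl⟩ := h
    exact Submodule.subset_span ⟨(A, f) :: L, by simp⟩
  | zero => simp
  | add χ η _ _ h h' => rw [map_add]; exact add_mem h h'
  | smul c χ _ h => rw [map_smul]; exact Submodule.smul_mem _ _ h

theorem poly_induction {P : S.dom → Prop} (vac : P S.vac)
    (field : ∀ A f, ∀ χ ∈ S.poly, P χ → P ((S.plus A f + S.minus A f) χ)) (zero : P 0)
    (add : ∀ χ η, P χ → P η → P (χ + η)) (smul : ∀ (c : ℂ) χ, P χ → P (c • χ)) {χ : S.dom}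
    (hχ : χ ∈ S.poly) : P χ := by
  induction hχ using Submodule.span_induction with
  | mem χ h =>
    obtain ⟨L, rfl⟩ := h
    induction L with
    | nil => exact vac
    | cons p L ih =>
      rw [List.map_cons, List.prod_cons, Module.End.mul_apply]
      exact field _ _ _ (Submodule.subset_span ⟨L, rfl⟩) ih
  | zero => exact zero
  | add χ η _ _ h h' => exact add χ η h h'
  | smul c χ _ h => exact smul c χ h

theorem minus_field (a b : JetIdx N r) (f g : Test1) (χ : S.dom) :
    S.jetMinus a f ((S.jetPlus b g + S.jetMinus b g) χ) =
      sgn (S.z a.1 * S.z b.1) • (S.jetPlus b g + S.jetMinus b g) (S.jetMinus a f χ) +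
        (∫ x, f x * smear (S.jetDminus a b) g x) • χ := by
  have h1 := congrArg (fun T : Module.End ℂ S.dom => T χ) (S.jetMinus_jetPlus a b f g)
  have h2 := congrArg (fun T : Module.End ℂ S.dom => T χ) (S.jetMinus_jetMinus a b f g)
  simp only [Module.End.mul_apply, LinearMap.add_apply, LinearMap.smul_apply,
    Module.End.one_apply] at h1 h2
  rw [LinearMap.add_apply, map_add, h1, h2, LinearMap.add_apply]
  module

theorem minus_mem_poly (A : Fin N) (f : Test1) {χ : S.dom} (hχ : χ ∈ S.poly) :
    S.minus A f χ ∈ S.poly := by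
  refine S.poly_induction (P := fun χ => S.minus A f χ ∈ S.poly) ?_ ?_ ?_ ?_ ?_ hχ
  · rw [S.minus_vac]; exact zero_mem _
  · intro B g χ hχ h
    have := S.minus_field (zeroIdx 0 A) (zeroIdx 0 B) f g χ
    simp only [jetPlus_zeroIdx, jetMinus_zeroIdx] at this
    rw [this]
    exact add_mem (Submodule.smul_mem _ _ (S.field_mem_poly B g h)) (Submodule.smul_mem _ _ hχ)
  · rw [map_zero]; exact zero_mem _
  · intro χ η h h'; rw [map_add]; exact add_mem h h'
  · intro c χ h; rw [map_smul]; exact Submodule.smul_mem _ _ h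

theorem plus_mem_poly (A : Fin N) (f : Test1) {χ : S.dom} (hχ : χ ∈ S.poly) :
    S.plus A f χ ∈ S.poly := by
  have := sub_mem (S.field_mem_poly A f hχ) (S.minus_mem_poly A f hχ)
  simpa using this

/-- `∂_α φ^A_+` on the domain `S.poly`. -/
def plusP (a : JetIdx N r) (f : Test1) : Module.End ℂ S.poly :=
  (S.jetPlus a f).restrict fun _ hχ => Submodule.smul_mem _ _ (S.plus_mem_poly a.1 _ hχ)

/-- `∂_α φ^A_-` on the domain `S.poly`. -/
def minusP (a : JetIdx N r) (f : Test1) : Module.End ℂ S.poly :=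
  (S.jetMinus a f).restrict fun _ hχ => Submodule.smul_mem _ _ (S.minus_mem_poly a.1 _ hχ)

theorem coe_plusP (a : JetIdx N r) (f : Test1) (χ : S.poly) :
    (S.plusP a f χ : S.dom) = S.jetPlus a f χ := rfl

theorem coe_minusP (a : JetIdx N r) (f : Test1) (χ : S.poly) :
    (S.minusP a f χ : S.dom) = S.jetMinus a f χ := rfl

/-- The vacuum as an element of `S.poly`. -/
def vacP : S.poly := ⟨S.vac, S.vac_mem_poly⟩

/-- The domain `S.poly` is generated from the vacuum by the creation operators alone. -/
theorem poly_induction_plus {P : S.poly → Prop} (vac : P S.vacP)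
    (plus : ∀ A f χ, P χ → P (S.plusP (zeroIdx r A) f χ)) (zero : P 0)
    (add : ∀ χ η, P χ → P η → P (χ + η)) (smul : ∀ (c : ℂ) χ, P χ → P (c • χ)) (χ : S.poly) :
    P χ := by
  let V : Submodule ℂ S.poly :=
    { carrier := {χ | P χ}
      zero_mem' := zero
      add_mem' := fun h h' => add _ _ h h'
      smul_mem' := fun c _ h => smul c _ h }
  -- `U` is the smallest submodule with the closure properties of `V`
  let U : Submodule ℂ S.poly := sInf {V | S.vacP ∈ V ∧ ∀ A f, ∀ χ ∈ V, S.plusP (zeroIdx r A) f χ ∈ V}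
  have hvac : S.vacP ∈ U := by
    rw [Submodule.mem_sInf]
    exact fun V hV => hV.1
  have hplus : ∀ A f, ∀ χ ∈ U, S.plusP (zeroIdx r A) f χ ∈ U := by
    intro A f χ hχ
    rw [Submodule.mem_sInf] at hχ ⊢
    exact fun V hV => hV.2 A f χ (hχ V hV)
  have hUle : ∀ V : Submodule ℂ S.poly, S.vacP ∈ V →
      (∀ A f, ∀ χ ∈ V, S.plusP (zeroIdx r A) f χ ∈ V) → U ≤ V := fun V h h' => sInf_le ⟨h, h'⟩
  have hminus : ∀ A f, ∀ χ ∈ U, S.minusP (zeroIdx r A) f χ ∈ U := by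
    intro A f χ hχ
    let V₂ : Submodule ℂ S.poly :=
      { carrier := {χ | χ ∈ U ∧ ∀ A f, S.minusP (zeroIdx r A) f χ ∈ U}
        zero_mem' := ⟨zero_mem _, fun A f => by rw [map_zero]; exact zero_mem _⟩
        add_mem' := fun h h' => ⟨add_mem h.1 h'.1, fun A f => by
          rw [map_add]; exact add_mem (h.2 A f) (h'.2 A f)⟩
        smul_mem' := fun c _ h => ⟨Submodule.smul_mem _ c h.1, fun A f => by
          rw [map_smul]; exact Submodule.smul_mem _ c (h.2 A f)⟩ }
    refine (hUle V₂ ⟨hvac, fun A f => ?_⟩ (fun A f χ h => ⟨hplus A f χ h.1, fun B g => ?_⟩) hχ).2 A f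
    · have : S.minusP (zeroIdx r A) f S.vacP = 0 := Subtype.ext (by
        rw [coe_minusP, jetMinus_zeroIdx]; exact S.minus_vac A f)
      rw [this]
      exact zero_mem _
    · have h3 : S.minusP (zeroIdx r B) g (S.plusP (zeroIdx r A) f χ) =
          sgn (S.z B * S.z A) • S.plusP (zeroIdx r A) f (S.minusP (zeroIdx r B) g χ) +
          (∫ x, g x * smear (S.jetDminus (zeroIdx r B) (zeroIdx r A)) f x) • χ := by
        apply Subtype.ext
        exact congrArg (fun T : Module.End ℂ S.dom => T χ)
          (S.jetMinus_jetPlus (zeroIdx r B) (zeroIdx r A) g f)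
      rw [h3]
      exact add_mem (Submodule.smul_mem _ _ (hplus A f _ (h.2 B g))) (Submodule.smul_mem _ _ h.1)
  have hall : ∀ χ : S.dom, ∀ h : χ ∈ S.poly, (⟨χ, h⟩ : S.poly) ∈ U := by
    intro χ h
    obtain ⟨h', hU⟩ : ∃ h : χ ∈ S.poly, (⟨χ, h⟩ : S.poly) ∈ U := by
      refine S.poly_induction (P := fun χ => ∃ h : χ ∈ S.poly, (⟨χ, h⟩ : S.poly) ∈ U)
        ⟨S.vac_mem_poly, hvac⟩ ?_ ⟨zero_mem _, zero_mem U⟩ ?_ ?_ h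
      · rintro A f χ - ⟨h1, h2⟩
        refine ⟨S.field_mem_poly A f h1, ?_⟩
        convert add_mem (hplus A f _ h2) (hminus A f _ h2) using 1
        apply Subtype.ext
        simp [coe_plusP, coe_minusP]
      · rintro χ η ⟨h1, h2⟩ ⟨h3, h4⟩
        exact ⟨add_mem h1 h3, add_mem h2 h4⟩
      · rintro c χ ⟨h1, h2⟩
        exact ⟨Submodule.smul_mem _ c h1, Submodule.smul_mem _ c h2⟩
    exact hU
  exact hUle V vac plus (hall χ χ.2)

end FreeFields

/-! ### Finite sums of functions with coefficients in a vector space -/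

section EvalList

variable {V W : Type*} [AddCommGroup V] [Module ℂ V] [AddCommGroup W] [Module ℂ W]

/-- The value at `x` of the vector-valued function `∑ h_j ⊗ v_j`. -/
def evalList (l : List ((Mink → ℂ) × V)) (x : Mink) : V := (l.map fun p => p.1 x • p.2).sum

/-- The integral of the vector-valued function `∑ h_j ⊗ v_j` against a test function. -/
def integralList (l : List ((Mink → ℂ) × V)) (f : Test1) : V :=
  (l.map fun p => (∫ x, f x * p.1 x) • p.2).sum

/-- All the functions `h_j` in `∑ h_j ⊗ v_j` have temperate growth. -/
def TemperateList (l : List ((Mink → ℂ) × V)) : Prop := ∀ p ∈ l, p.1.HasTemperateGrowth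

theorem TemperateList.evalList_smul {l : List ((Mink → ℂ) × V)} (hl : TemperateList l)
    (Λ : V →ₗ[ℂ] ℂ) :
    (fun x => Λ (evalList l x)).HasTemperateGrowth ∧
      ∀ f : Test1, ∫ x, f x * Λ (evalList l x) = Λ (integralList l f) := by
  induction l with
  | nil =>
    simp only [evalList, integralList, List.map_nil, List.sum_nil, map_zero]
    exact ⟨.const 0, fun f => by simp⟩
  | cons p l ih =>
    have hp : p.1.HasTemperateGrowth := hl p (by simp)
    obtain ⟨h1, h2⟩ := ih fun q hq => hl q (by simp [hq])
    have hc : (fun x => p.1 x * Λ p.2).HasTemperateGrowth := hp.mul (.const _)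
    have he : ∀ x, Λ (evalList (p :: l) x) = p.1 x * Λ p.2 + Λ (evalList l x) := fun x => by
      simp [evalList]
    refine ⟨?_, fun f => ?_⟩
    · simp_rw [he]
      exact hc.add h1
    · simp_rw [he, mul_add]
      rw [MeasureTheory.integral_add (integrable_mul_of_hasTemperateGrowth hc f)
        (integrable_mul_of_hasTemperateGrowth h1 f), h2]
      simp only [integralList, List.map_cons, List.sum_cons, map_add, map_smul, smul_eq_mul,
        ← mul_assoc, MeasureTheory.integral_mul_const]

theorem evalList_map (T : V →ₗ[ℂ] W) (l : List ((Mink → ℂ) × V)) (x : Mink) :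
    evalList (l.map fun p => (p.1, T p.2)) x = T (evalList l x) := by
  simp [evalList, map_list_sum, Function.comp_def]

theorem integralList_map (T : V →ₗ[ℂ] W) (l : List ((Mink → ℂ) × V)) (f : Test1) :
    integralList (l.map fun p => (p.1, T p.2)) f = T (integralList l f) := by
  simp [integralList, map_list_sum, Function.comp_def]

theorem evalList_append (l l' : List ((Mink → ℂ) × V)) (x : Mink) :
    evalList (l ++ l') x = evalList l x + evalList l' x := by
  simp [evalList]

theorem integralList_append (l l' : List ((Mink → ℂ) × V)) (f : Test1) :
    integralList (l ++ l') f = integralList l f + integralList l' f := by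
  simp [integralList]

theorem TemperateList.map {l : List ((Mink → ℂ) × V)} (hl : TemperateList l) (T : V →ₗ[ℂ] W) :
    TemperateList (l.map fun p => (p.1, T p.2)) := by
  intro p hp
  obtain ⟨q, hq, rfl⟩ := List.mem_map.1 hp
  exact hl q hq

theorem TemperateList.append {V : Type*} {l l' : List ((Mink → ℂ) × V)} (hl : TemperateList l)
    (hl' : TemperateList l') : TemperateList (l ++ l') := by
  intro p hp
  rcases List.mem_append.1 hp with h | h
  exacts [hl p h, hl' p h]

theorem hasTemperateGrowth_conj {E : Type*} [NormedAddCommGroup E] [NormedSpace ℝ E] {h : E → ℂ}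
    (hh : h.HasTemperateGrowth) : (fun x => conj (h x)).HasTemperateGrowth :=
  (ContinuousLinearEquiv.hasTemperateGrowth Complex.conjCLE).comp hh

theorem TemperateList.evalList_conj {l : List ((Mink → ℂ) × V)} (hl : TemperateList l)
    (Λ : V →ₗ⋆[ℂ] ℂ) :
    (fun x => Λ (evalList l x)).HasTemperateGrowth ∧
      ∀ f : Test1, ∫ x, f x * Λ (evalList l x) = Λ (integralList l (conjTest f)) := by
  let Λ' : V →ₗ[ℂ] ℂ :=
    { toFun := fun v => conj (Λ v)
      map_add' := by simp
      map_smul' := by simp }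
  obtain ⟨h1, h2⟩ := hl.evalList_smul Λ'
  have hΛ : ∀ v, Λ v = conj (Λ' v) := fun v => by simp [Λ']
  refine ⟨?_, fun f => ?_⟩
  · simp_rw [hΛ]
    exact hasTemperateGrowth_conj h1
  · simp_rw [hΛ]
    rw [← h2, integral_conjTest_mul, Complex.conj_conj]

end EvalList

theorem eq_of_integral_mul_eq {h h' : Mink → ℂ} (hh : h.HasTemperateGrowth)
    (hh' : h'.HasTemperateGrowth) (H : ∀ f : Test1, ∫ x, f x * h x = ∫ x, f x * h' x) : h = h' := by
  rw [← sub_eq_zero]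
  refine eq_zero_of_integral_mul (hh.1.continuous.sub hh'.1.continuous) fun f => ?_
  simp only [Pi.sub_apply, mul_sub]
  rw [MeasureTheory.integral_sub (integrable_mul_of_hasTemperateGrowth hh f)
    (integrable_mul_of_hasTemperateGrowth hh' f), H, sub_self]

namespace FreeFields

variable {N r : ℕ} {F : Type*} [NormedAddCommGroup F] [InnerProductSpace ℂ F] [CompleteSpace F]
  (S : FreeFields N F)

/-! ### The annihilation operators at a point -/

/-- Annihilation operators act on `S.poly` by contractions with smooth functions of temperate
growth. -/
theorem exists_evalList_minusP (a : JetIdx N r) (χ : S.poly) :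
    ∃ l : List ((Mink → ℂ) × S.poly), TemperateList l ∧ ∀ f, S.minusP a f χ = integralList l f := by
  obtain ⟨χ, hχ⟩ := χ
  obtain ⟨h, l, hl⟩ : ∃ h : χ ∈ S.poly, ∃ l : List ((Mink → ℂ) × S.poly), TemperateList l ∧
      ∀ f, S.minusP a f ⟨χ, h⟩ = integralList l f := by
    refine S.poly_induction (P := fun χ => ∃ h : χ ∈ S.poly, ∃ l : List ((Mink → ℂ) × S.poly),
      TemperateList l ∧ ∀ f, S.minusP a f ⟨χ, h⟩ = integralList l f) ?_ ?_ ?_ ?_ ?_ hχ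
    · refine ⟨S.vac_mem_poly, [], by simp [TemperateList], fun f => Subtype.ext ?_⟩
      simp [coe_minusP, integralList, jetMinus, S.minus_vac]
    · rintro B g χ - ⟨h, l, hl, hlf⟩
      let T : Module.End ℂ S.poly := S.plusP (zeroIdx r B) g + S.minusP (zeroIdx r B) g
      refine ⟨S.field_mem_poly B g h, l.map (fun p => (p.1, (sgn (S.z a.1 * S.z B) • T) p.2)) ++
        [(smear (S.jetDminus a (zeroIdx r B)) g, ⟨χ, h⟩)], ?_, fun f => ?_⟩
      · refine (hl.map _).append ?_
        simpa [TemperateList] using smear_hasTemperateGrowth _ _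
      · rw [integralList_append, integralList_map, ← hlf]
        apply Subtype.ext
        have := S.minus_field a (zeroIdx r B) f g χ
        rw [jetPlus_zeroIdx, jetMinus_zeroIdx] at this
        refine this.trans ?_
        have hz : (zeroIdx r B).1 = B := rfl
        simp [T, integralList, coe_minusP, coe_plusP, hz]
    · exact ⟨zero_mem _, [], by simp [TemperateList], fun f => Subtype.ext (by
        simp [coe_minusP, integralList])⟩
    · rintro χ η ⟨h, l, hl, hlf⟩ ⟨h', l', hl', hlf'⟩
      refine ⟨add_mem h h', l ++ l', hl.append hl', fun f => ?_⟩
      rw [integralList_append, ← hlf, ← hlf', ← map_add]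
      rfl
    · rintro c χ ⟨h, l, hl, hlf⟩
      refine ⟨Submodule.smul_mem _ c h, l.map (fun p => (p.1, (c • LinearMap.id : S.poly →ₗ[ℂ] S.poly) p.2)), hl.map _,
        fun f => ?_⟩
      rw [integralList_map, ← hlf, LinearMap.smul_apply, LinearMap.id_apply, ← map_smul]
      rfl
  exact ⟨l, hl⟩

/-- The pairing of `S.poly` with a vector. -/
def pairing (η : S.poly) : S.poly →ₗ[ℂ] ℂ := innerₛₗ ℂ η

theorem ext_pairing {χ χ' : S.poly} (h : ∀ η, S.pairing η χ = S.pairing η χ') : χ = χ' :=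
  ext_inner_left ℂ h

theorem evalList_unique {l l' : List ((Mink → ℂ) × S.poly)} (hl : TemperateList l)
    (hl' : TemperateList l') (h : ∀ f, integralList l f = integralList l' f) :
    evalList l = evalList l' := by
  funext x
  refine S.ext_pairing fun η => ?_
  have h1 := hl.evalList_smul (S.pairing η)
  have h2 := hl'.evalList_smul (S.pairing η)
  exact congrFun (eq_of_integral_mul_eq h1.1 h2.1 fun f => by rw [h1.2, h2.2, h]) x

/-- The operator `∂_α φ^A_-(x)` at a point `x`, on the domain `S.poly`: the operators
`∂_α φ^A_-(f)` are its integrals against test functions. -/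
def annih (a : JetIdx N r) (x : Mink) : Module.End ℂ S.poly where
  toFun χ := evalList (S.exists_evalList_minusP a χ).choose x
  map_add' χ η := by
    have h := fun χ => (S.exists_evalList_minusP a χ).choose_spec
    rw [← evalList_append]
    refine congrFun (S.evalList_unique (h _).1 ((h χ).1.append (h η).1) fun f => ?_) x
    rw [integralList_append, ← (h χ).2, ← (h η).2, ← (h (χ + η)).2, map_add]
  map_smul' c χ := by
    have h := fun χ => (S.exists_evalList_minusP a χ).choose_spec
    have e := evalList_map (c • LinearMap.id) (S.exists_evalList_minusP a χ).choose x
    rw [LinearMap.smul_apply, LinearMap.id_apply] at e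
    rw [RingHom.id_apply, ← e]
    refine congrFun (S.evalList_unique (h _).1 ((h χ).1.map _) fun f => ?_) x
    rw [integralList_map, ← (h χ).2, ← (h (c • χ)).2, map_smul]
    rfl

theorem exists_evalList_annih (a : JetIdx N r) (χ : S.poly) :
    ∃ l : List ((Mink → ℂ) × S.poly), TemperateList l ∧ (∀ f, S.minusP a f χ = integralList l f) ∧
      ∀ x, S.annih a x χ = evalList l x :=
  ⟨_, (S.exists_evalList_minusP a χ).choose_spec.1, (S.exists_evalList_minusP a χ).choose_spec.2,
    fun _ => rfl⟩

theorem annih_temperate (a : JetIdx N r) (χ : S.poly) (Λ : S.poly →ₗ[ℂ] ℂ) :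
    (fun x => Λ (S.annih a x χ)).HasTemperateGrowth := by
  obtain ⟨l, hl, -, h⟩ := S.exists_evalList_annih a χ
  simp_rw [h]
  exact (hl.evalList_smul Λ).1

theorem integral_annih (a : JetIdx N r) (χ : S.poly) (Λ : S.poly →ₗ[ℂ] ℂ) (f : Test1) :
    ∫ x, f x * Λ (S.annih a x χ) = Λ (S.minusP a f χ) := by
  obtain ⟨l, hl, hf, h⟩ := S.exists_evalList_annih a χ
  simp_rw [h, hf]
  exact (hl.evalList_smul Λ).2 f

/-- Operators on `S.poly` with the same matrix elements as `annih` after smearing agree with it. -/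
theorem annih_eq_of_integral (a : JetIdx N r) (χ : S.poly) (Φ : Mink → S.poly)
    (h : ∀ η, (fun x => S.pairing η (Φ x)).HasTemperateGrowth)
    (h' : ∀ η (f : Test1), ∫ x, f x * S.pairing η (Φ x) = S.pairing η (S.minusP a f χ)) (x : Mink) :
    S.annih a x χ = Φ x := by
  refine S.ext_pairing fun η => ?_
  exact congrFun (eq_of_integral_mul_eq (S.annih_temperate a χ _) (h η) fun f => by
    rw [S.integral_annih, h']) x

/-! ### The adjoints of the creation operators -/

/-- The adjoint of `∂_α φ^A_+(f)` on the domain `S.poly`. -/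
def plusAdj (a : JetIdx N r) (f : Test1) : Module.End ℂ S.poly :=
  ∑ B, conj (S.plus_adjoint.choose a.1 B) • S.minusP (B, a.2) (conjTest f)

/-- The adjoint of `∂_α φ^A_-(f)` on the domain `S.poly`. -/
def minusAdj (a : JetIdx N r) (f : Test1) : Module.End ℂ S.poly :=
  ∑ B, conj (S.minus_adjoint.choose a.1 B) • S.plusP (B, a.2) (conjTest f)

theorem inner_plusAdj (a : JetIdx N r) (f : Test1) (ψ : S.poly) (χ : S.dom) :
    inner ℂ (S.plusAdj a f ψ : S.dom) χ = inner ℂ (ψ : S.dom) (S.jetPlus a f χ) := by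
  have h := S.plus_adjoint.choose_spec a.1 (pderiv a.2 f) ψ χ
  have h2 : inner ℂ (ψ : S.dom) (S.jetPlus a f χ) =
      (-1 : ℂ) ^ order a.2 * inner ℂ ((ψ : S.dom) : F) (S.plus a.1 (pderiv a.2 f) χ : F) := by
    rw [jetPlus, LinearMap.smul_apply, inner_smul_right]; rfl
  rw [h2, h, plusAdj, LinearMap.sum_apply, Submodule.coe_sum, sum_inner, Finset.mul_sum]
  refine Finset.sum_congr rfl fun B _ => ?_
  rw [LinearMap.smul_apply, Submodule.coe_smul, inner_smul_left, Complex.conj_conj, coe_minusP,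
    jetMinus, LinearMap.smul_apply, inner_smul_left, pderiv_conjTest]
  simp only [map_pow, map_neg, map_one]
  rw [mul_left_comm]
  rfl

theorem inner_minusAdj (a : JetIdx N r) (f : Test1) (ψ : S.poly) (χ : S.dom) :
    inner ℂ (S.minusAdj a f ψ : S.dom) χ = inner ℂ (ψ : S.dom) (S.jetMinus a f χ) := by
  have h := S.minus_adjoint.choose_spec a.1 (pderiv a.2 f) ψ χ
  have h2 : inner ℂ (ψ : S.dom) (S.jetMinus a f χ) =
      (-1 : ℂ) ^ order a.2 * inner ℂ ((ψ : S.dom) : F) (S.minus a.1 (pderiv a.2 f) χ : F) := by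
    rw [jetMinus, LinearMap.smul_apply, inner_smul_right]; rfl
  rw [h2, h, minusAdj, LinearMap.sum_apply, Submodule.coe_sum, sum_inner, Finset.mul_sum]
  refine Finset.sum_congr rfl fun B _ => ?_
  rw [LinearMap.smul_apply, Submodule.coe_smul, inner_smul_left, Complex.conj_conj, coe_plusP,
    jetPlus, LinearMap.smul_apply, inner_smul_left, pderiv_conjTest]
  simp only [map_pow, map_neg, map_one]
  rw [mul_left_comm]
  rfl

/-- The adjoint of the (formal) operator `∂_α φ^A_+(x)` at a point, on the domain `S.poly`. -/
def creaAdj (a : JetIdx N r) (x : Mink) : Module.End ℂ S.poly :=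
  ∑ B, conj (S.plus_adjoint.choose a.1 B) • S.annih (B, a.2) x

theorem exists_evalList_creaAdj (a : JetIdx N r) (ψ : S.poly) :
    ∃ l : List ((Mink → ℂ) × S.poly), TemperateList l ∧
      (∀ f, S.plusAdj a f ψ = integralList l (conjTest f)) ∧
      ∀ x, S.creaAdj a x ψ = evalList l x := by
  have key : ∀ s : Finset (Fin N), ∃ l : List ((Mink → ℂ) × S.poly), TemperateList l ∧
      (∀ f, (∑ B ∈ s, conj (S.plus_adjoint.choose a.1 B) • S.minusP (B, a.2) f) ψ =
        integralList l f) ∧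
      ∀ x, (∑ B ∈ s, conj (S.plus_adjoint.choose a.1 B) • S.annih (B, a.2) x) ψ =
        evalList l x := by
    intro s
    induction s using Finset.induction_on with
    | empty => exact ⟨[], by simp [TemperateList], by simp [integralList], by simp [evalList]⟩
    | insert B s hB ih =>
      obtain ⟨l, hl, h1, h2⟩ := ih
      obtain ⟨l', hl', h1', h2'⟩ := S.exists_evalList_annih (B, a.2) ψ
      refine ⟨l'.map (fun p => (p.1, (conj (S.plus_adjoint.choose a.1 B) • LinearMap.id : S.poly →ₗ[ℂ] S.poly) p.2)) ++ l,
        (hl'.map _).append hl, fun f => ?_, fun x => ?_⟩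
      · rw [Finset.sum_insert hB, LinearMap.add_apply, h1, integralList_append, integralList_map,
          ← h1']
        rfl
      · rw [Finset.sum_insert hB, LinearMap.add_apply, h2, evalList_append, evalList_map, ← h2']
        rfl
  obtain ⟨l, hl, h1, h2⟩ := key Finset.univ
  exact ⟨l, hl, fun f => h1 _, h2⟩

theorem creaAdj_temperate (a : JetIdx N r) (ψ : S.poly) (Λ : S.poly →ₗ⋆[ℂ] ℂ) :
    (fun x => Λ (S.creaAdj a x ψ)).HasTemperateGrowth := by
  obtain ⟨l, hl, -, h⟩ := S.exists_evalList_creaAdj a ψ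
  simp_rw [h]
  exact (hl.evalList_conj Λ).1

theorem integral_creaAdj (a : JetIdx N r) (ψ : S.poly) (Λ : S.poly →ₗ⋆[ℂ] ℂ) (f : Test1) :
    ∫ x, f x * Λ (S.creaAdj a x ψ) = Λ (S.plusAdj a f ψ) := by
  obtain ⟨l, hl, hf, h⟩ := S.exists_evalList_creaAdj a ψ
  simp_rw [h, hf]
  exact (hl.evalList_conj Λ).2 f

/-- The conjugate-linear pairing of `S.poly` with a vector. -/
def copairing (η : S.poly) : S.poly →ₗ⋆[ℂ] ℂ := (innerₛₗ ℂ).flip η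

theorem ext_copairing {χ χ' : S.poly} (h : ∀ η, S.copairing η χ = S.copairing η χ') : χ = χ' :=
  ext_inner_right ℂ h

theorem creaAdj_eq_of_integral (a : JetIdx N r) (ψ : S.poly) (Φ : Mink → S.poly)
    (h : ∀ η, (fun x => S.copairing η (Φ x)).HasTemperateGrowth)
    (h' : ∀ η (f : Test1), ∫ x, f x * S.copairing η (Φ x) = S.copairing η (S.plusAdj a f ψ))
    (x : Mink) : S.creaAdj a x ψ = Φ x := by
  refine S.ext_copairing fun η => ?_
  exact congrFun (eq_of_integral_mul_eq (S.creaAdj_temperate a ψ _) (h η) fun f => by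
    rw [S.integral_creaAdj, h']) x

end FreeFields

namespace FreeFields

variable {N r : ℕ} {F : Type*} [NormedAddCommGroup F] [InnerProductSpace ℂ F] [CompleteSpace F]
  (S : FreeFields N F)

/-! ### Operators with numerical commutators -/

/-- `O` is an operator of degree `z` on `S.poly`, with adjoint `O'`, whose graded commutators with
the frequency components of the fields are the numerical functions `hp` and `hm`. This covers the
smeared fields and each of their frequency components. -/
structure IsFieldLike (r : ℕ) (O O' : Module.End ℂ S.poly) (z : ℤ)
    (hp hm : JetIdx N r → Mink → ℂ) : Prop where
  adj : ∀ ψ χ, S.pairing (O' ψ) χ = S.pairing ψ (O χ)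
  temperate_plus : ∀ a, (hp a).HasTemperateGrowth
  temperate_minus : ∀ a, (hm a).HasTemperateGrowth
  eq_zero : ∀ a, S.z a.1 + z ≠ 0 → hp a = 0 ∧ hm a = 0
  plus : ∀ a f χ, S.plusP a f (O χ) =
    sgn (S.z a.1 * z) • O (S.plusP a f χ) + (∫ x, f x * hp a x) • χ
  minus : ∀ a f χ, S.minusP a f (O χ) =
    sgn (S.z a.1 * z) • O (S.minusP a f χ) + (∫ x, f x * hm a x) • χ

theorem adj_plusP (a : JetIdx N r) (f : Test1) (ψ χ : S.poly) :
    S.pairing (S.plusAdj a f ψ) χ = S.pairing ψ (S.plusP a f χ) := S.inner_plusAdj a f ψ χ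

theorem adj_minusP (a : JetIdx N r) (f : Test1) (ψ χ : S.poly) :
    S.pairing (S.minusAdj a f ψ) χ = S.pairing ψ (S.minusP a f χ) := S.inner_minusAdj a f ψ χ

theorem isFieldLike_plusP (b : JetIdx N r) (g : Test1) :
    S.IsFieldLike r (S.plusP b g) (S.plusAdj b g) (S.z b.1) 0
      (fun a x => smear (S.jetDminus a b) g x) where
  adj := S.adj_plusP b g
  temperate_plus _ := .const 0
  temperate_minus _ := smear_hasTemperateGrowth _ _
  eq_zero a h := ⟨rfl, funext fun x => S.smear_jetDminus_eq_zero h g x⟩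
  plus a f χ := by
    have h := congrArg (fun T : Module.End ℂ S.dom => T χ) (S.jetPlus_jetPlus a b f g)
    simpa using Subtype.ext h
  minus a f χ := Subtype.ext
    (congrArg (fun T : Module.End ℂ S.dom => T χ) (S.jetMinus_jetPlus a b f g))

theorem isFieldLike_minusP (b : JetIdx N r) (g : Test1) :
    S.IsFieldLike r (S.minusP b g) (S.minusAdj b g) (S.z b.1)
      (fun a x => smear (S.jetDplus a b) g x) 0 where
  adj := S.adj_minusP b g
  temperate_plus _ := smear_hasTemperateGrowth _ _
  temperate_minus _ := .const 0
  eq_zero a h := ⟨funext fun x => S.smear_jetDplus_eq_zero h g x, rfl⟩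
  plus a f χ := Subtype.ext
    (congrArg (fun T : Module.End ℂ S.dom => T χ) (S.jetPlus_jetMinus a b f g))
  minus a f χ := by
    have h := congrArg (fun T : Module.End ℂ S.dom => T χ) (S.jetMinus_jetMinus a b f g)
    simpa using Subtype.ext h

variable {S}

theorem IsFieldLike.add {O₁ O₁' O₂ O₂' : Module.End ℂ S.poly} {z : ℤ}
    {p₁ m₁ p₂ m₂ : JetIdx N r → Mink → ℂ} (h₁ : S.IsFieldLike r O₁ O₁' z p₁ m₁)
    (h₂ : S.IsFieldLike r O₂ O₂' z p₂ m₂) :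
    S.IsFieldLike r (O₁ + O₂) (O₁' + O₂') z (p₁ + p₂) (m₁ + m₂) where
  adj ψ χ := by
    rw [LinearMap.add_apply, LinearMap.add_apply, map_add, ← h₁.adj, ← h₂.adj]
    exact inner_add_left _ _ _
  temperate_plus a := (h₁.temperate_plus a).add (h₂.temperate_plus a)
  temperate_minus a := (h₁.temperate_minus a).add (h₂.temperate_minus a)
  eq_zero a h := by
    simp [(h₁.eq_zero a h).1, (h₁.eq_zero a h).2, (h₂.eq_zero a h).1, (h₂.eq_zero a h).2]
  plus a f χ := by
    have e : ∫ x, f x * (p₁ + p₂) a x = (∫ x, f x * p₁ a x) + ∫ x, f x * p₂ a x := by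
      simp only [Pi.add_apply, mul_add]
      exact MeasureTheory.integral_add
        (integrable_mul_of_hasTemperateGrowth (h₁.temperate_plus a) f)
        (integrable_mul_of_hasTemperateGrowth (h₂.temperate_plus a) f)
    rw [e, LinearMap.add_apply, map_add, h₁.plus, h₂.plus, LinearMap.add_apply]
    module
  minus a f χ := by
    have e : ∫ x, f x * (m₁ + m₂) a x = (∫ x, f x * m₁ a x) + ∫ x, f x * m₂ a x := by
      simp only [Pi.add_apply, mul_add]
      exact MeasureTheory.integral_add
        (integrable_mul_of_hasTemperateGrowth (h₁.temperate_minus a) f)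
        (integrable_mul_of_hasTemperateGrowth (h₂.temperate_minus a) f)
    rw [e, LinearMap.add_apply, map_add, h₁.minus, h₂.minus, LinearMap.add_apply]
    module

section

variable {O O' : Module.End ℂ S.poly} {z : ℤ} {hp hm : JetIdx N r → Mink → ℂ}

/-- The commutation relation of `O` with an annihilation operator at a point. -/
theorem IsFieldLike.annih (h : S.IsFieldLike r O O' z hp hm) (a : JetIdx N r) (x : Mink)
    (χ : S.poly) :
    S.annih a x (O χ) = sgn (S.z a.1 * z) • O (S.annih a x χ) + hm a x • χ := by
  have h1 : ∀ η : S.poly, (fun x => sgn (S.z a.1 * z) * S.pairing (O' η) (S.annih a x χ)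
      ).HasTemperateGrowth := fun η =>
    (Function.HasTemperateGrowth.const _).mul (S.annih_temperate a χ (S.pairing (O' η)))
  have h2 : ∀ η : S.poly, (fun x => hm a x * S.pairing η χ).HasTemperateGrowth := fun η =>
    (h.temperate_minus a).mul (.const _)
  have e : ∀ η x, S.pairing η (sgn (S.z a.1 * z) • O (S.annih a x χ) + hm a x • χ) =
      sgn (S.z a.1 * z) * S.pairing (O' η) (S.annih a x χ) + hm a x * S.pairing η χ := by
    intro η x
    rw [map_add, map_smul, map_smul, h.adj, smul_eq_mul, smul_eq_mul]
  refine S.annih_eq_of_integral a (O χ)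
    (fun x => sgn (S.z a.1 * z) • O (S.annih a x χ) + hm a x • χ) (fun η => ?_) (fun η f => ?_) x
  · simp_rw [e]
    exact (h1 η).add (h2 η)
  · simp_rw [e, mul_add]
    rw [MeasureTheory.integral_add (integrable_mul_of_hasTemperateGrowth (h1 η) f)
      (integrable_mul_of_hasTemperateGrowth (h2 η) f), h.minus, map_add, map_smul, map_smul]
    simp_rw [mul_left_comm (f _) (sgn _), ← mul_assoc (f _) (hm _ _)]
    rw [MeasureTheory.integral_const_mul, S.integral_annih, h.adj,
      MeasureTheory.integral_mul_const]
    rfl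

/-- The commutation relation of `O'` with the adjoint of a creation operator at a point. -/
theorem IsFieldLike.creaAdj (h : S.IsFieldLike r O O' z hp hm) (a : JetIdx N r) (x : Mink)
    (ψ : S.poly) :
    O' (S.creaAdj a x ψ) = sgn (S.z a.1 * z) • S.creaAdj a x (O' ψ) + conj (hp a x) • ψ := by
  refine S.ext_copairing fun η => ?_
  have e : ∀ x, S.copairing η (sgn (S.z a.1 * z) • S.creaAdj a x (O' ψ) + conj (hp a x) • ψ) =
      sgn (S.z a.1 * z) * S.copairing η (S.creaAdj a x (O' ψ)) + hp a x * S.copairing η ψ := by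
    intro x
    rw [map_add, map_smulₛₗ, map_smulₛₗ, Complex.conj_conj, conj_sgn, smul_eq_mul, smul_eq_mul]
  have e' : ∀ x, S.copairing η (O' (S.creaAdj a x ψ)) = S.copairing (O η) (S.creaAdj a x ψ) :=
    fun x => h.adj _ _
  rw [e, e']
  have h1 : (fun x => sgn (S.z a.1 * z) * S.copairing η (S.creaAdj a x (O' ψ))
      ).HasTemperateGrowth :=
    (Function.HasTemperateGrowth.const _).mul (S.creaAdj_temperate a _ _)
  have h2 : (fun x => hp a x * S.copairing η ψ).HasTemperateGrowth :=
    (h.temperate_plus a).mul (.const _)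
  refine congrFun (eq_of_integral_mul_eq (S.creaAdj_temperate a ψ _) (h1.add h2) fun f => ?_) x
  simp_rw [Pi.add_apply, mul_add]
  rw [MeasureTheory.integral_add (integrable_mul_of_hasTemperateGrowth h1 f)
      (integrable_mul_of_hasTemperateGrowth h2 f), S.integral_creaAdj]
  simp_rw [mul_left_comm (f _) (sgn _), ← mul_assoc (f _) (hp _ _)]
  rw [MeasureTheory.integral_const_mul, S.integral_creaAdj, MeasureTheory.integral_mul_const]
  have := congrArg (S.pairing ψ) (h.plus a f η)
  rw [map_add, map_smul, map_smul, ← S.adj_plusP, ← h.adj ψ, ← S.adj_plusP] at this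
  exact this

end

variable (S)

theorem annih_annih (a b : JetIdx N r) (x y : Mink) (χ : S.poly) :
    S.annih a x (S.annih b y χ) = sgn (S.z a.1 * S.z b.1) • S.annih b y (S.annih a x χ) := by
  refine S.annih_eq_of_integral a _ (fun x => sgn (S.z a.1 * S.z b.1) • S.annih b y (S.annih a x χ))
    (fun η => ?_) (fun η f => ?_) x
  · simp_rw [map_smul]
    exact (Function.HasTemperateGrowth.const _).mul
      (S.annih_temperate a χ (S.pairing η ∘ₗ S.annih b y))
  · simp_rw [map_smul, smul_eq_mul, mul_left_comm (f _)]
    rw [MeasureTheory.integral_const_mul]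
    erw [S.integral_annih a χ (S.pairing η ∘ₗ S.annih b y)]
    rw [LinearMap.comp_apply, (S.isFieldLike_minusP a f).annih, Pi.zero_apply, Pi.zero_apply,
      zero_smul, add_zero, map_smul, smul_eq_mul, ← mul_assoc, mul_comm (S.z b.1),
      sgn_mul_self, one_mul]

theorem creaAdj_creaAdj (a b : JetIdx N r) (x y : Mink) (ψ : S.poly) :
    S.creaAdj a x (S.creaAdj b y ψ) =
      sgn (S.z a.1 * S.z b.1) • S.creaAdj b y (S.creaAdj a x ψ) := by
  refine S.creaAdj_eq_of_integral a _
    (fun x => sgn (S.z a.1 * S.z b.1) • S.creaAdj b y (S.creaAdj a x ψ))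
    (fun η => ?_) (fun η f => ?_) x
  · simp_rw [map_smulₛₗ]
    exact (Function.HasTemperateGrowth.const _).mul
      (S.creaAdj_temperate a ψ ((S.copairing η).comp (S.creaAdj b y)))
  · simp_rw [map_smulₛₗ, smul_eq_mul, mul_left_comm (f _)]
    rw [MeasureTheory.integral_const_mul]
    erw [S.integral_creaAdj a ψ ((S.copairing η).comp (S.creaAdj b y))]
    rw [LinearMap.comp_apply, (S.isFieldLike_plusP a f).creaAdj, Pi.zero_apply, Pi.zero_apply,
      map_zero, zero_smul, add_zero, map_smulₛₗ, smul_eq_mul, mul_comm (S.z b.1), conj_sgn]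

end FreeFields

/-! ### Functions of several points as sums of products -/

theorem integrable_prod_mul_of_hasTemperateGrowth {k : ℕ} {K : (Fin k → Mink) → ℂ}
    (hK : K.HasTemperateGrowth) (f : Fin k → Test1) :
    MeasureTheory.Integrable fun x => (∏ i, f i (x i)) * K x := by
  obtain ⟨m, C, hC⟩ := hK.2 0
  have hC0 : 0 ≤ C := by
    have := (norm_nonneg _).trans (hC 0)
    simpa using this
  have hi : ∀ i, MeasureTheory.Integrable fun x : Mink => (1 + ‖x‖) ^ m * ‖f i x‖ := by
    intro i
    have h1 := (f i).integrable_pow_mul MeasureTheory.volume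
    have h2 : ∀ j, MeasureTheory.Integrable fun x : Mink => ‖x‖ ^ j * ‖f i x‖ := fun j => h1 j
    simp_rw [add_comm (1 : ℝ), add_pow, one_pow, mul_one, Finset.sum_mul]
    refine MeasureTheory.integrable_finsetSum _ fun j _ => ?_
    refine ((h2 j).mul_const (m.choose j : ℝ)).congr (Filter.Eventually.of_forall fun x => ?_)
    simp only
    ring
  have hprod := (MeasureTheory.Integrable.fintype_prod (f := fun i (x : Mink) =>
    (1 + ‖x‖) ^ m * ‖f i x‖) hi).const_mul C
  refine hprod.mono' ?_ (Filter.Eventually.of_forall fun x => ?_)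
  · refine Continuous.aestronglyMeasurable (Continuous.mul ?_ hK.1.continuous)
    exact continuous_finsetProd _ fun i _ => (f i).continuous.comp (continuous_apply i)
  · have h1 := hC x
    rw [norm_iteratedFDeriv_zero] at h1
    have h2 : 1 + ‖x‖ ≤ ∏ i, (1 + ‖x i‖) := by
      have h3 : ∀ s : Finset (Fin k), 1 ≤ ∏ i ∈ s, (1 + ‖x i‖) := fun s =>
        Finset.prod_induction _ (fun t : ℝ => 1 ≤ t) (fun _ _ => one_le_mul_of_one_le_of_one_le)
          le_rfl fun i _ => by linarith [norm_nonneg (x i)]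
      rw [← le_sub_iff_add_le', pi_norm_le_iff_of_nonneg (by linarith [h3 Finset.univ])]
      intro i
      rw [le_sub_iff_add_le', ← Finset.mul_prod_erase _ _ (Finset.mem_univ i)]
      exact le_mul_of_one_le_right (by positivity) (h3 _)
    rw [norm_mul, norm_prod, Finset.prod_mul_distrib, Finset.prod_pow]
    calc (∏ i, ‖f i (x i)‖) * ‖K x‖ ≤ (∏ i, ‖f i (x i)‖) * (C * (1 + ‖x‖) ^ m) := by
          gcongr
      _ ≤ (∏ i, ‖f i (x i)‖) * (C * (∏ i, (1 + ‖x i‖)) ^ m) := by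
          gcongr
      _ = _ := by ring

/-- Pairs of a function `K(x₁, …, x_k)` and a functional of `k` test functions, which are given by
the same sum of products of functions of one variable. -/
def prodPairs (k : ℕ) : Submodule ℂ (((Fin k → Mink) → ℂ) × ((Fin k → Test1) → ℂ)) :=
  Submodule.span ℂ {q | ∃ h : Fin k → Mink → ℂ, (∀ i, (h i).HasTemperateGrowth) ∧
    q = (fun x => ∏ i, h i (x i), fun f => ∏ i, ∫ y, f i y * h i y)}

theorem hasTemperateGrowth_comp_apply {k : ℕ} {h : Mink → ℂ} (hh : h.HasTemperateGrowth)
    (i : Fin k) : (fun x : Fin k → Mink => h (x i)).HasTemperateGrowth :=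
  hh.comp (ContinuousLinearMap.hasTemperateGrowth
    (ContinuousLinearMap.proj (R := ℝ) (φ := fun _ : Fin k => Mink) i))

theorem hasTemperateGrowth_prod {E ι : Type*} [NormedAddCommGroup E] [NormedSpace ℝ E]
    (s : Finset ι) {h : ι → E → ℂ} (hh : ∀ i, (h i).HasTemperateGrowth) :
    (fun x => ∏ i ∈ s, h i x).HasTemperateGrowth := by
  classical
  induction s using Finset.induction_on with
  | empty => simp
  | insert i s hi ih =>
    simp_rw [Finset.prod_insert hi]
    exact (hh i).mul ih

theorem prodPairs_spec {k : ℕ} {q : ((Fin k → Mink) → ℂ) × ((Fin k → Test1) → ℂ)}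
    (hq : q ∈ prodPairs k) :
    q.1.HasTemperateGrowth ∧ ∀ f : Fin k → Test1, ∫ x, (∏ i, f i (x i)) * q.1 x = q.2 f := by
  induction hq using Submodule.span_induction with
  | mem q h =>
    obtain ⟨h, hh, rfl⟩ := h
    have h1 := hasTemperateGrowth_prod (h := fun i (x : Fin k → Mink) => h i (x i)) Finset.univ
      fun i => hasTemperateGrowth_comp_apply (hh i) i
    refine ⟨h1, fun f => ?_⟩
    simp_rw [← Finset.prod_mul_distrib]
    exact MeasureTheory.integral_fintype_prod_volume_eq_prod (fun i y => f i y * h i y)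
  | zero => exact ⟨.const 0, fun f => by simp⟩
  | add q q' _ _ h h' =>
    refine ⟨h.1.add h'.1, fun f => ?_⟩
    simp only [Prod.fst_add, Pi.add_apply, mul_add]
    rw [MeasureTheory.integral_add (integrable_prod_mul_of_hasTemperateGrowth h.1 f)
      (integrable_prod_mul_of_hasTemperateGrowth h'.1 f), h.2, h'.2]
    rfl
  | smul c q _ h =>
    refine ⟨(Function.HasTemperateGrowth.const c).mul h.1, fun f => ?_⟩
    simp only [Prod.smul_fst, Pi.smul_apply, smul_eq_mul, mul_left_comm _ c]
    rw [MeasureTheory.integral_const_mul, h.2]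
    rfl

theorem prodPairs_cons {k : ℕ} {q : ((Fin k → Mink) → ℂ) × ((Fin k → Test1) → ℂ)}
    (hq : q ∈ prodPairs k) {h : Mink → ℂ} (hh : h.HasTemperateGrowth) :
    ((fun x => h (x 0) * q.1 (fun i => x i.succ), fun f => (∫ y, f 0 y * h y) *
      q.2 (fun i => f i.succ)) : ((Fin (k + 1) → Mink) → ℂ) × ((Fin (k + 1) → Test1) → ℂ)) ∈
      prodPairs (k + 1) := by
  induction hq using Submodule.span_induction with
  | mem q h' =>
    obtain ⟨h', hh', rfl⟩ := h'
    refine Submodule.subset_span ⟨Fin.cons h h', fun i => ?_, ?_⟩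
    · refine Fin.cases ?_ (fun i => ?_) i
      · exact hh
      · exact hh' i
    · simp only [Fin.prod_univ_succ, Fin.cons_zero, Fin.cons_succ]
  | zero =>
    convert zero_mem (prodPairs (k + 1)) using 1
    ext <;> simp
  | add q q' _ _ h h' =>
    convert add_mem h h' using 1
    ext <;> simp [mul_add]
  | smul c q _ h =>
    convert Submodule.smul_mem _ c h using 1
    ext <;> simp [mul_left_comm]

theorem prodPairs_evalList {V : Type*} [AddCommGroup V] [Module ℂ V] {k : ℕ}
    {l : List ((Mink → ℂ) × V)} (hl : TemperateList l) {Λ : (Fin k → Mink) → V →ₗ[ℂ] ℂ}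
    {M : (Fin k → Test1) → V →ₗ[ℂ] ℂ}
    (h : ∀ v, (fun x => Λ x v, fun f => M f v) ∈ prodPairs k) :
    ((fun x => Λ (fun i => x i.succ) (evalList l (x 0)), fun f => M (fun i => f i.succ)
      (integralList l (f 0))) : ((Fin (k + 1) → Mink) → ℂ) × ((Fin (k + 1) → Test1) → ℂ)) ∈
      prodPairs (k + 1) := by
  induction l with
  | nil =>
    convert zero_mem (prodPairs (k + 1)) using 1
    ext <;> simp [evalList, integralList]
  | cons p l ih =>
    have h1 := prodPairs_cons (h p.2) (hl p (by simp))
    convert add_mem h1 (ih fun q hq => hl q (by simp [hq])) using 1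
    ext <;> simp [evalList, integralList]

theorem prodPairs_evalList_conj {V : Type*} [AddCommGroup V] [Module ℂ V] {k : ℕ}
    {l : List ((Mink → ℂ) × V)} (hl : TemperateList l) {Λ : (Fin k → Mink) → V →ₗ⋆[ℂ] ℂ}
    {M : (Fin k → Test1) → V →ₗ⋆[ℂ] ℂ}
    (h : ∀ v, (fun x => Λ x v, fun f => M f v) ∈ prodPairs k) :
    ((fun x => Λ (fun i => x i.succ) (evalList l (x 0)), fun f => M (fun i => f i.succ)
      (integralList l (conjTest (f 0)))) :
        ((Fin (k + 1) → Mink) → ℂ) × ((Fin (k + 1) → Test1) → ℂ)) ∈ prodPairs (k + 1) := by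
  induction l with
  | nil =>
    convert zero_mem (prodPairs (k + 1)) using 1
    ext <;> simp [evalList, integralList]
  | cons p l ih =>
    have h1 := prodPairs_cons (h p.2) (hasTemperateGrowth_conj (hl p (by simp)))
    convert add_mem h1 (ih fun q hq => hl q (by simp [hq])) using 1
    refine Prod.ext (funext fun x => ?_) (funext fun f => ?_)
    · simp [evalList]
    · simp only [integralList, List.map_cons, List.sum_cons, map_add, map_smulₛₗ, smul_eq_mul,
        integral_conjTest_mul, Complex.conj_conj]
      rfl

namespace FreeFields

variable {N r : ℕ} {F : Type*} [NormedAddCommGroup F] [InnerProductSpace ℂ F] [CompleteSpace F]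
  (S : FreeFields N F)

/-! ### The kernels of the normal products -/

/-- The scalar product of `S.poly` as a sesquilinear form. -/
def sesq : S.poly →ₗ⋆[ℂ] S.poly →ₗ[ℂ] ℂ :=
  LinearMap.mk₂'ₛₗ _ _ (fun ψ χ => S.pairing ψ χ) (fun _ _ _ => inner_add_left _ _ _)
    (fun _ _ _ => inner_smul_left _ _ _) (fun _ _ _ => map_add _ _ _) (fun _ _ _ => map_smul _ _ _)

/-- The scalar product of `S.dom` as a sesquilinear form. -/
def domSesq : S.dom →ₗ⋆[ℂ] S.dom →ₗ[ℂ] ℂ :=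
  LinearMap.mk₂'ₛₗ _ _ (fun ψ χ => inner ℂ ψ χ) (fun _ _ _ => inner_add_left _ _ _)
    (fun _ _ _ => inner_smul_left _ _ _) (fun _ _ _ => inner_add_right _ _ _)
    (fun _ _ _ => inner_smul_right _ _ _)

/-- The matrix elements `⟨ψ, :∂_{α₁}φ^{A₁}(x₁) ⋯ ∂_{α_k}φ^{A_k}(x_k): χ⟩`, as sesquilinear forms on
`S.poly`, for the list `(A₁, α₁, x₁), …, (A_k, α_k, x_k)`. -/
def kerL : List (JetIdx N r × Mink) → S.poly →ₗ⋆[ℂ] S.poly →ₗ[ℂ] ℂ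
  | [] => S.sesq
  | p :: L => (kerL L).comp (S.creaAdj p.1 p.2) +
      sgn (S.z p.1.1 * (L.map fun q => S.z q.1.1).sum) • (kerL L).compl₂ (S.annih p.1 p.2)

theorem kerL_nil (ψ χ : S.poly) : S.kerL (r := r) [] ψ χ = S.pairing ψ χ := rfl

theorem kerL_cons (p : JetIdx N r × Mink) (L : List (JetIdx N r × Mink)) (ψ χ : S.poly) :
    S.kerL (p :: L) ψ χ = S.kerL L (S.creaAdj p.1 p.2 ψ) χ +
      sgn (S.z p.1.1 * (L.map fun q => S.z q.1.1).sum) * S.kerL L ψ (S.annih p.1 p.2 χ) := rfl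

theorem kerL_mem_prodPairs {k : ℕ} (a : Fin k → JetIdx N r) (ψ χ : S.poly) :
    (fun x => S.kerL (List.ofFn fun i => (a i, x i)) ψ χ,
      fun f => inner ℂ (ψ : S.dom) (S.normal (List.ofFn fun i => (a i, f i)) χ)) ∈
      prodPairs k := by
  induction k generalizing ψ χ with
  | zero =>
    have h := Submodule.smul_mem (prodPairs 0) (S.pairing ψ χ) (Submodule.subset_span
      ⟨fun i => i.elim0, fun i => i.elim0, rfl⟩)
    convert h using 1
    ext x
    · simp [kerL_nil]
    · simp only [List.ofFn_zero, normal, Finset.univ_eq_empty, Finset.prod_empty, Prod.smul_snd,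
        Pi.smul_apply, smul_eq_mul, mul_one]
      rfl
  | succ k ih =>
    obtain ⟨l, hl, hf, hx⟩ := S.exists_evalList_creaAdj (a 0) ψ
    obtain ⟨l', hl', hf', hx'⟩ := S.exists_evalList_annih (a 0) χ
    have h1 := prodPairs_evalList_conj hl
      (Λ := fun x => (S.kerL (List.ofFn fun i => (a i.succ, x i))).flip χ)
      (M := fun f => (S.domSesq.flip (S.normal (List.ofFn fun i => (a i.succ, f i)) χ)).comp
        S.poly.subtype) (fun v => ih _ v χ)
    have h2 := prodPairs_evalList hl'
      (Λ := fun x => S.kerL (List.ofFn fun i => (a i.succ, x i)) ψ)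
      (M := fun f => S.domSesq ψ ∘ₗ S.normal (List.ofFn fun i => (a i.succ, f i)) ∘ₗ
        S.poly.subtype) (fun v => ih _ ψ v)
    convert add_mem h1 (Submodule.smul_mem _
      (sgn (S.z (a 0).1 * ((List.ofFn fun i : Fin k => S.z (a i.succ).1)).sum)) h2) using 1
    refine Prod.ext ?_ ?_
    · funext x
      simp only [List.ofFn_succ, kerL_cons, hx, hx', List.map_ofFn, Function.comp_def]
      rfl
    · funext f
      simp only [List.ofFn_succ, normal, List.map_ofFn, Function.comp_def]
      rw [LinearMap.add_apply, inner_add_right, LinearMap.smul_apply, inner_smul_right,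
        Module.End.mul_apply, Module.End.mul_apply, ← S.inner_plusAdj, hf, ← S.coe_minusP, hf']
      rfl

theorem isKernel_kerL {k : ℕ} (a : Fin k → JetIdx N r) (ψ χ : S.poly) :
    S.IsKernel ψ χ a fun x => S.kerL (List.ofFn fun i => (a i, x i)) ψ χ :=
  prodPairs_spec (S.kerL_mem_prodPairs a ψ χ)

/-- The kernel of a normal product is unique, since it is determined by its integrals against
products of test functions. -/
theorem kernel_eq {k : ℕ} (a : Fin k → JetIdx N r) (ψ χ : S.poly) :
    S.kernel ψ χ a = fun x => S.kerL (List.ofFn fun i => (a i, x i)) ψ χ := by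
  have h : ∃ K, S.IsKernel (ψ : S.dom) χ a K := ⟨_, S.isKernel_kerL a ψ χ⟩
  have h1 := h.choose_spec
  have h2 := S.isKernel_kerL a ψ χ
  rw [kernel, dif_pos h, ← sub_eq_zero]
  refine eq_zero_of_integral_prod_mul (h1.1.1.continuous.sub h2.1.1.continuous) fun f => ?_
  simp only [Pi.sub_apply, mul_sub]
  rw [MeasureTheory.integral_sub (integrable_prod_mul_of_hasTemperateGrowth h1.1 f)
    (integrable_prod_mul_of_hasTemperateGrowth h2.1 f), h1.2, h2.2, sub_self]

theorem kerL_hasTemperateGrowth {k : ℕ} (a : Fin k → JetIdx N r) (ψ χ : S.poly) :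
    (fun x : Fin k → Mink => S.kerL (List.ofFn fun i => (a i, x i)) ψ χ).HasTemperateGrowth :=
  (S.isKernel_kerL a ψ χ).1

/-- The graded symmetry of the kernels. -/
theorem kerL_swap (pre L : List (JetIdx N r × Mink)) (p q : JetIdx N r × Mink) (ψ χ : S.poly) :
    S.kerL (pre ++ p :: q :: L) ψ χ =
      sgn (S.z p.1.1 * S.z q.1.1) * S.kerL (pre ++ q :: p :: L) ψ χ := by
  induction pre generalizing ψ χ with
  | nil =>
    simp only [List.nil_append, kerL_cons, List.map_cons, List.sum_cons]
    rw [S.creaAdj_creaAdj q.1 p.1, S.annih_annih q.1 p.1, map_smulₛₗ, LinearMap.smul_apply,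
      map_smul, smul_eq_mul, smul_eq_mul, conj_sgn]
    simp only [mul_add, sgn_add, mul_comm (S.z q.1.1) (S.z p.1.1)]
    have h := sgn_mul_self (S.z p.1.1 * S.z q.1.1)
    linear_combination (-1) * sgn (S.z q.1.1 * (L.map fun q => S.z q.1.1).sum) *
      S.kerL L (S.creaAdj p.1 p.2 ψ) (S.annih q.1 q.2 χ) * h
  | cons p' pre ih =>
    simp only [List.cons_append, kerL_cons]
    rw [ih, ih]
    have : (List.map (fun q => S.z q.1.1) (pre ++ p :: q :: L)).sum =
        (List.map (fun q => S.z q.1.1) (pre ++ q :: p :: L)).sum := by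
      simp; ring
    rw [this]
    ring

end FreeFields

namespace FreeFields

variable {N r : ℕ} {F : Type*} [NormedAddCommGroup F] [InnerProductSpace ℂ F] [CompleteSpace F]
  (S : FreeFields N F)

/-! ### Commutators with the normal products -/

/-- The degree of a product of basic fields. -/
def deg {X : Type*} (L : List (JetIdx N r × X)) : ℤ := (L.map fun q => S.z q.1.1).sum

@[simp]
theorem deg_nil {X : Type*} : S.deg ([] : List (JetIdx N r × X)) = 0 := rfl

@[simp]
theorem deg_cons {X : Type*} (p : JetIdx N r × X) (L : List (JetIdx N r × X)) :
    S.deg (p :: L) = S.z p.1.1 + S.deg L := by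
  simp [deg]

/-- The signed sum over all contractions of a factor of the normal product `L` with an operator
that has degree `z` and the commutator functions `h`. -/
def contr (z : ℤ) (h : JetIdx N r → Mink → ℂ) :
    (List (JetIdx N r × Mink) → ℂ) → List (JetIdx N r × Mink) → ℂ
  | _, [] => 0
  | K, p :: L => sgn (z * S.deg L) * h p.1 p.2 * K L + contr z h (fun L' => K (p :: L')) L

theorem contr_add (z : ℤ) (h : JetIdx N r → Mink → ℂ) (K K' : List (JetIdx N r × Mink) → ℂ)
    (L : List (JetIdx N r × Mink)) :
    S.contr z h (fun L => K L + K' L) L = S.contr z h K L + S.contr z h K' L := by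
  induction L generalizing K K' with
  | nil => simp [contr]
  | cons p L ih =>
    simp only [contr]
    rw [ih]
    ring

theorem contr_mul (z : ℤ) (h : JetIdx N r → Mink → ℂ) (c : ℂ)
    (K : List (JetIdx N r × Mink) → ℂ) (L : List (JetIdx N r × Mink)) :
    S.contr z h (fun L => c * K L) L = c * S.contr z h K L := by
  induction L generalizing K with
  | nil => simp [contr]
  | cons p L ih =>
    simp only [contr]
    rw [ih]
    ring

theorem contr_sgn {z : ℤ} {h : JetIdx N r → Mink → ℂ}
    (hz : ∀ a, S.z a.1 + z ≠ 0 → h a = 0) (m : ℤ)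
    (K : List (JetIdx N r × Mink) → ℂ) (L : List (JetIdx N r × Mink)) :
    S.contr z h (fun L => sgn (m * S.deg L) * K L) L =
      sgn (m * (S.deg L + z)) * S.contr z h K L := by
  induction L generalizing K with
  | nil => simp [contr]
  | cons p L ih =>
    simp only [contr, deg_cons]
    have e : (fun L' => sgn (m * (S.z p.1.1 + S.deg L')) * K (p :: L')) =
        fun L' => sgn (m * S.z p.1.1) * (sgn (m * S.deg L') * K (p :: L')) := by
      funext L'
      rw [mul_add, sgn_add]
      ring
    rw [e, contr_mul, ih]
    by_cases hp : S.z p.1.1 + z = 0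
    · have e1 : S.z p.1.1 + S.deg L + z = S.deg L := by linarith
      have e2 : sgn (m * S.z p.1.1) * sgn (m * (S.deg L + z)) = sgn (m * S.deg L) := by
        rw [← sgn_add, ← mul_add, ← add_assoc, add_right_comm, hp, zero_add]
      rw [e1]
      linear_combination S.contr z h (fun L' => K (p :: L')) L * e2
    · rw [hz _ hp, Pi.zero_apply]
      have e2 : sgn (m * S.z p.1.1) * sgn (m * (S.deg L + z)) =
          sgn (m * (S.z p.1.1 + S.deg L + z)) := by
        rw [← sgn_add, ← mul_add, ← add_assoc]
      linear_combination S.contr z h (fun L' => K (p :: L')) L * e2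

variable {S} in
/-- The commutator of a normal product with an operator that has numerical commutators with the
fields is the sum over all contractions. -/
theorem IsFieldLike.kerL {O O' : Module.End ℂ S.poly} {z : ℤ} {hp hm : JetIdx N r → Mink → ℂ}
    (h : S.IsFieldLike r O O' z hp hm) (L : List (JetIdx N r × Mink)) (ψ χ : S.poly) :
    S.kerL L ψ (O χ) = sgn (z * S.deg L) * S.kerL L (O' ψ) χ +
      S.contr z (hp + hm) (fun L => S.kerL L ψ χ) L := by
  have hz : ∀ a, S.z a.1 + z ≠ 0 → (hp + hm) a = 0 := fun a ha => by
    rw [Pi.add_apply, (h.eq_zero a ha).1, (h.eq_zero a ha).2, add_zero]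
  induction L generalizing ψ χ with
  | nil => simpa [contr, kerL_nil] using (h.adj ψ χ).symm
  | cons p L ih =>
    simp only [kerL_cons, contr]
    change _ + sgn (S.z p.1.1 * S.deg L) * _ = _
    rw [ih, h.creaAdj, h.annih, map_add, map_smulₛₗ, map_smulₛₗ, Complex.conj_conj, conj_sgn,
      map_add, map_smul, map_smul, ih]
    have e1 : S.contr z (hp + hm) (fun L' => S.kerL L' (S.creaAdj p.1 p.2 ψ) χ +
        sgn (S.z p.1.1 * S.deg L') * S.kerL L' ψ (S.annih p.1 p.2 χ)) L = _ :=
      (S.contr_add ..).trans (congrArg _ (S.contr_sgn hz ..))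
    change _ = sgn (z * S.deg (p :: L)) * (_ + sgn (S.z p.1.1 * S.deg L) * _) + (_ +
      S.contr z (hp + hm) (fun L' => S.kerL L' (S.creaAdj p.1 p.2 ψ) χ +
        sgn (S.z p.1.1 * S.deg L') * S.kerL L' ψ (S.annih p.1 p.2 χ)) L)
    rw [e1]
    have e2 : sgn (z * S.deg (p :: L)) = sgn (S.z p.1.1 * z) * sgn (z * S.deg L) := by
      rw [deg_cons, ← sgn_add]; congr 1; ring
    have e3 : sgn (S.z p.1.1 * (S.deg L + z)) = sgn (S.z p.1.1 * S.deg L) * sgn (S.z p.1.1 * z) := by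
      rw [← sgn_add]; congr 1; ring
    have e4 : sgn (S.z p.1.1 * S.deg L) * hm p.1 p.2 = sgn (z * S.deg L) * hm p.1 p.2 := by
      by_cases hp' : S.z p.1.1 + z = 0
      · rw [eq_neg_of_add_eq_zero_left hp', neg_mul, sgn_neg]
      · simp [(h.eq_zero _ hp').2]
    rw [e2, e3]
    simp only [LinearMap.add_apply, LinearMap.smul_apply, smul_eq_mul, Pi.add_apply]
    linear_combination S.kerL L ψ χ * e4

section Grassmann

variable {G : Type*} [Ring G]

/-! ### Sums over the components of classical fields -/

/-- The sum over all the components of the classical fields in a list: `Φ` is evaluated on the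
list of the component indices and on the product of the components. -/
def csum {n : ℕ} {X : Type*} [AddCommMonoid X] : List (Fin n × (JetIdx N r → G)) →
    (List (JetIdx N r × Fin n) → G → X) → X
  | [], Φ => Φ [] 1
  | p :: L, Φ => ∑ a, csum L fun bs g => Φ ((a, p.1) :: bs) (p.2 a * g)

theorem csum_add {n : ℕ} {X : Type*} [AddCommMonoid X] (L : List (Fin n × (JetIdx N r → G)))
    (Φ Ψ : List (JetIdx N r × Fin n) → G → X) :
    csum L (fun bs g => Φ bs g + Ψ bs g) = csum L Φ + csum L Ψ := by
  induction L generalizing Φ Ψ with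
  | nil => rfl
  | cons p L ih => simp only [csum, ih, Finset.sum_add_distrib]

theorem csum_map {n : ℕ} {X Y : Type*} [AddCommMonoid X] [AddCommMonoid Y] (T : X →+ Y)
    (L : List (Fin n × (JetIdx N r → G))) (Φ : List (JetIdx N r × Fin n) → G → X) :
    T (csum L Φ) = csum L fun bs g => T (Φ bs g) := by
  induction L generalizing Φ with
  | nil => rfl
  | cons p L ih => simp only [csum, ih, map_sum]

theorem csum_mul {n : ℕ} (L : List (Fin n × (JetIdx N r → G)))
    (Φ : List (JetIdx N r × Fin n) → G → G) (c : G) :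
    csum L Φ * c = csum L fun bs g => Φ bs g * c :=
  csum_map (AddMonoidHom.mulRight c) L Φ

theorem mul_csum {n : ℕ} (L : List (Fin n × (JetIdx N r → G)))
    (Φ : List (JetIdx N r × Fin n) → G → G) (c : G) :
    c * csum L Φ = csum L fun bs g => c * Φ bs g :=
  csum_map (AddMonoidHom.mulLeft c) L Φ

theorem csum_zero {n : ℕ} {X : Type*} [AddCommMonoid X] (L : List (Fin n × (JetIdx N r → G))) :
    csum L (fun _ _ => (0 : X)) = 0 := by
  induction L with
  | nil => rfl
  | cons p L ih => simp [csum, ih]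

theorem csum_finsetSum {n : ℕ} {X ι : Type*} [AddCommMonoid X] (s : Finset ι)
    (L : List (Fin n × (JetIdx N r → G))) (Φ : ι → List (JetIdx N r × Fin n) → G → X) :
    csum L (fun bs g => ∑ i ∈ s, Φ i bs g) = ∑ i ∈ s, csum L (Φ i) := by
  classical
  induction s using Finset.induction_on with
  | empty => simp [csum_zero]
  | insert i s hi ih => simp only [Finset.sum_insert hi, csum_add, ih]

theorem sum_ofFn_eq_csum {n : ℕ} {X : Type*} [AddCommMonoid X]
    (L : List (Fin n × (JetIdx N r → G))) (Φ : List (JetIdx N r × Fin n) → G → X) :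
    ∑ a : Fin L.length → JetIdx N r, Φ (List.ofFn fun i => (a i, (L.get i).1))
      (List.ofFn fun i => (L.get i).2 (a i)).prod = csum L Φ := by
  induction L generalizing Φ with
  | nil => simp [csum]
  | cons p L ih =>
    refine ((Fin.consEquiv fun _ : Fin (L.length + 1) => JetIdx N r).sum_comp _).symm.trans ?_
    rw [Fintype.sum_prod_type]
    refine Finset.sum_congr rfl fun a _ => ?_
    rw [← ih]
    refine Finset.sum_congr rfl fun b _ => ?_
    simp [List.ofFn_succ, Fin.consEquiv]

theorem csum_congr_of_forall_commute {n : ℕ} {X : Type*} [AddCommMonoid X]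
    {L : List (Fin n × (JetIdx N r → G))} (hL : ∀ p ∈ L, ∀ a c, Commute (p.2 a) c)
    {Φ Ψ : List (JetIdx N r × Fin n) → G → X}
    (h : ∀ bs g, (∀ c, Commute g c) → Φ bs g = Ψ bs g) : csum L Φ = csum L Ψ := by
  induction L generalizing Φ Ψ with
  | nil => exact h [] 1 Commute.one_left
  | cons p L ih =>
    exact Finset.sum_congr rfl fun a _ => ih (fun q hq => hL q (by simp [hq])) fun bs g hg =>
      h _ _ fun c => (hL p (by simp) a c).mul_left (hg c)

variable [Algebra ℂ G] (gr : ℤ → Submodule ℂ G)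

/-- The components of `p.2` have the degrees of the fields. -/
def IsGraded {n : ℕ} (L : List (Fin n × (JetIdx N r → G))) : Prop :=
  ∀ p ∈ L, ∀ a, p.2 a ∈ gr (S.z a.1)

variable {gr} [GradedAlgebra gr]

variable {S} in
theorem csum_congr {n : ℕ} {X : Type*} [AddCommMonoid X] {L : List (Fin n × (JetIdx N r → G))}
    (hL : S.IsGraded gr L) {Φ Ψ : List (JetIdx N r × Fin n) → G → X}
    (h : ∀ bs, ∀ g ∈ gr (S.deg bs), Φ bs g = Ψ bs g) : csum L Φ = csum L Ψ := by
  induction L generalizing Φ Ψ with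
  | nil => exact h [] 1 SetLike.GradedOne.one_mem
  | cons p L ih =>
    refine Finset.sum_congr rfl fun a _ => ih (fun q hq => hL q (by simp [hq])) fun bs g hg => ?_
    refine h _ _ ?_
    rw [deg_cons]
    exact SetLike.mul_mem_graded (hL p (by simp) a) hg

/-- Sums over components with graded-symmetric summands do not depend on the order of the
letters. -/
theorem csum_perm (hG : S.IsGrassmann gr) {n : ℕ} {X : Type*} [AddCommGroup X] [Module ℂ X]
    {L L' : List (Fin n × (JetIdx N r → G))} (hL : S.IsGraded gr L) (hp : L.Perm L')
    {Φ : List (JetIdx N r × Fin n) → G → X} (hsmul : ∀ bs (c : ℂ) g, Φ bs (c • g) = c • Φ bs g)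
    (hswap : ∀ pre a b post g, Φ (pre ++ a :: b :: post) g =
      sgn (S.z a.1.1 * S.z b.1.1) • Φ (pre ++ b :: a :: post) g) :
    csum L Φ = csum L' Φ := by
  induction hp generalizing Φ with
  | nil => rfl
  | cons p _ ih =>
    refine Finset.sum_congr rfl fun a _ => ih (fun q hq => hL q (by simp [hq])) (fun bs c g => ?_)
      fun pre b c post g => hswap ((a, p.1) :: pre) b c post _
    rw [mul_smul_comm, hsmul]
  | swap p q L =>
    simp only [csum]
    rw [Finset.sum_comm]
    refine Finset.sum_congr rfl fun a _ => Finset.sum_congr rfl fun b _ => ?_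
    congr 1
    funext bs g
    have h := hswap [] (b, q.1) (a, p.1) bs (q.2 b * (p.2 a * g))
    rw [List.nil_append, List.nil_append] at h
    rw [h, ← hsmul, ← mul_assoc, ← mul_assoc,
      hG.graded_comm _ _ _ (hL q (by simp) b) _ (hL p (by simp) a), smul_mul_assoc, smul_smul,
      sgn_mul_self, one_smul]
  | trans h1 _ ih1 ih2 =>
    rw [ih1 hL hsmul hswap]
    exact ih2 (fun p hp => hL p (h1.mem_iff.2 hp)) hsmul hswap

end Grassmann

end FreeFields

/-! ### Removing one letter -/

/-- All the ways to take one entry out of a list. -/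
def removals {α : Type*} : List α → List (α × List α)
  | [] => []
  | p :: L => (p, L) :: (removals L).map fun q => (q.1, p :: q.2)

theorem removals_map {α β : Type*} (e : α → β) (L : List α) :
    removals (L.map e) = (removals L).map fun q => (e q.1, q.2.map e) := by
  induction L with
  | nil => rfl
  | cons p L ih => simp [removals, ih, Function.comp_def]

theorem sum_removals {α X : Type*} [DecidableEq α] [AddCommMonoid X] (L : List α)
    (Φ : α → Multiset α → X) :
    ((removals L).map fun q => Φ q.1 q.2).sum =
      ((L : Multiset α).map fun p => Φ p ((L : Multiset α).erase p)).sum := by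
  induction L generalizing Φ with
  | nil => rfl
  | cons p L ih =>
    have h := ih fun q W => Φ q (p ::ₘ W)
    simp only [removals, List.map_cons, List.sum_cons, List.map_map]
    rw [← Multiset.cons_coe, Multiset.map_cons, Multiset.sum_cons, Multiset.erase_cons_head]
    congr 1
    refine h.trans (congrArg _ (Multiset.map_congr rfl fun q hq => ?_))
    by_cases hqp : q = p
    · subst hqp
      rw [Multiset.erase_cons_head, Multiset.cons_erase hq]
    · rw [Multiset.erase_cons_tail _ (Ne.symm hqp)]

theorem sum_list_sum_comm {ι α X : Type*} [AddCommMonoid X] (s : Finset ι) (l : List α)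
    (F : ι → α → X) : ∑ i ∈ s, (l.map (F i)).sum = (l.map fun q => ∑ i ∈ s, F i q).sum := by
  induction l with
  | nil => simp
  | cons q l ih => simp [Finset.sum_add_distrib, ih]

namespace FreeFields

variable {N r : ℕ} {F : Type*} [NormedAddCommGroup F] [InnerProductSpace ℂ F] [CompleteSpace F]
  (S : FreeFields N F)

/-! ### Kernels at the arguments of a configuration -/

/-- The list of the fields with their arguments, for the arguments `x₁, …, xₙ`. -/
def atPts {n : ℕ} (x : Fin n → Mink) (bs : List (JetIdx N r × Fin n)) : List (JetIdx N r × Mink) :=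
  bs.map fun b => (b.1, x b.2)

theorem deg_atPts {n : ℕ} (x : Fin n → Mink) (bs : List (JetIdx N r × Fin n)) :
    S.deg (atPts x bs) = S.deg bs := by
  simp [deg, atPts, Function.comp_def]

/-- The kernel of a normal product with collapsed arguments. -/
def kerAt {n : ℕ} (bs : List (JetIdx N r × Fin n)) (ψ χ : S.poly) (x : Fin n → Mink) : ℂ :=
  S.kerL (atPts x bs) ψ χ

theorem kerAt_swap {n : ℕ} (pre : List (JetIdx N r × Fin n)) (a b : JetIdx N r × Fin n)
    (post : List (JetIdx N r × Fin n)) (ψ χ : S.poly) :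
    S.kerAt (pre ++ a :: b :: post) ψ χ =
      sgn (S.z a.1.1 * S.z b.1.1) • S.kerAt (pre ++ b :: a :: post) ψ χ := by
  funext x
  simp only [kerAt, atPts, List.map_append, List.map_cons, Pi.smul_apply, smul_eq_mul]
  exact S.kerL_swap _ _ _ _ ψ χ

theorem kernel_comp_eq_kerAt {n k : ℕ} (a : Fin k → JetIdx N r) (l : Fin k → Fin n) (ψ χ : S.poly) :
    (fun x : Fin n → Mink => S.kernel ψ χ a fun i => x (l i)) =
      S.kerAt (List.ofFn fun i => (a i, l i)) ψ χ := by
  funext x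
  rw [kernel_eq, kerAt, atPts, List.map_ofFn]
  rfl

theorem kerAt_hasTemperateGrowth {n : ℕ} (bs : List (JetIdx N r × Fin n)) (ψ χ : S.poly) :
    (S.kerAt bs ψ χ).HasTemperateGrowth := by
  have h := (S.kerL_hasTemperateGrowth (fun i => (bs.get i).1) ψ χ).comp
    (ContinuousLinearMap.hasTemperateGrowth (ContinuousLinearMap.pi (R := ℝ)
      (φ := fun _ : Fin bs.length => Mink)
      fun i => ContinuousLinearMap.proj (φ := fun _ : Fin n => Mink) (bs.get i).2))
  convert h using 1
  funext x
  have := congrFun (S.kernel_comp_eq_kerAt (fun i => (bs.get i).1) (fun i => (bs.get i).2) ψ χ) x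
  rw [kernel_eq] at this
  refine Eq.trans ?_ this.symm
  congr 1
  exact (List.ofFn_get bs).symm

section Grassmann

variable {G : Type*} [Ring G] [Algebra ℂ G] {gr : ℤ → Submodule ℂ G}

theorem mulNormal_eq_csum {n : ℕ} (d : Test n →ₗ[ℂ] G) (L : List (Fin n × (JetIdx N r → G)))
    (ψ χ : S.poly) (f : Test n) :
    S.mulNormal d L ψ χ f =
      csum L fun bs g => d (SchwartzMap.smulLeftCLM ℂ (S.kerAt bs ψ χ) f) * g := by
  rw [← sum_ofFn_eq_csum]
  simp only [mulNormal, kernel_comp_eq_kerAt]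

theorem contr_hasTemperateGrowth {n : ℕ} (z : ℤ) {h : JetIdx N r → Mink → ℂ}
    (hh : ∀ a, (h a).HasTemperateGrowth) (bs : List (JetIdx N r × Fin n))
    {K : (Fin n → Mink) → List (JetIdx N r × Mink) → ℂ}
    (hK : ∀ bs, (fun x => K x (atPts x bs)).HasTemperateGrowth) :
    (fun x => S.contr z h (K x) (atPts x bs)).HasTemperateGrowth := by
  induction bs generalizing K with
  | nil => exact .const 0
  | cons b bs ih =>
    have h1 := ih (K := fun x L => K x ((b.1, x b.2) :: L)) fun bs => hK (b :: bs)
    have h2 := ((Function.HasTemperateGrowth.const (sgn (z * S.deg bs))).mul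
      (hasTemperateGrowth_comp_apply (hh b.1) b.2)).mul (hK bs)
    have e : (fun x => S.contr z h (K x) (atPts x (b :: bs))) = fun x =>
        sgn (z * S.deg bs) * h b.1 (x b.2) * K x (atPts x bs) +
          S.contr z h (fun L => K x ((b.1, x b.2) :: L)) (atPts x bs) := by
      funext x
      rw [← S.deg_atPts x bs]
      rfl
    rw [e]
    exact h2.add h1

variable {S} in
theorem isGraded_map {n : ℕ} (L : List (Fin n × S.Jet gr r)) :
    S.IsGraded gr (L.map fun p => (p.1, p.2.1)) := by
  intro p hp a
  obtain ⟨q, -, rfl⟩ := List.mem_map.1 hp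
  exact q.2.2 a

variable [GradedAlgebra gr] {S}

/-- The sum over the components of the classical fields of all the signed contractions of the
fields, as a sum over the letters. The sign is absorbed by moving the component of the contracted
letter to the right. -/
theorem csum_contr (hG : S.IsGrassmann gr) {n : ℕ} (d : Test n →ₗ[ℂ] G) (f : Test n) {z : ℤ}
    {h : JetIdx N r → Mink → ℂ} (hh : ∀ a, (h a).HasTemperateGrowth)
    (hz : ∀ a, S.z a.1 + z ≠ 0 → h a = 0) (c : G) {L : List (Fin n × (JetIdx N r → G))}
    (hL : S.IsGraded gr L) {K : (Fin n → Mink) → List (JetIdx N r × Mink) → ℂ}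
    (hK : ∀ bs, (fun x => K x (atPts x bs)).HasTemperateGrowth) (g₀ : G) :
    (csum L fun bs g => d (SchwartzMap.smulLeftCLM ℂ
        (fun x => S.contr z h (K x) (atPts x bs)) f) * (g₀ * g) * c) =
      ((removals L).map fun q => ∑ a, csum q.2 fun bs g => d (SchwartzMap.smulLeftCLM ℂ
        (fun x => h a (x q.1.1) * K x (atPts x bs)) f) * (g₀ * g) * (q.1.2 a * c)).sum := by
  induction L generalizing K g₀ with
  | nil =>
    simp only [csum, removals, List.map_nil, List.sum_nil]
    have : (fun x : Fin n → Mink => S.contr z h (K x) (atPts x [])) = fun _ => 0 := rfl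
    rw [this, SchwartzMap.smulLeftCLM_const]
    simp
  | cons p L ih =>
    have hL' : S.IsGraded gr L := fun q hq => hL q (by simp [hq])
    simp only [removals, List.map_cons, List.sum_cons, List.map_map, Function.comp_def]
    rw [csum]
    have key : ∀ a, (csum L fun bs g => d (SchwartzMap.smulLeftCLM ℂ
        (fun x => S.contr z h (K x) (atPts x ((a, p.1) :: bs))) f) * (g₀ * (p.2 a * g)) * c) =
        (csum L fun bs g => d (SchwartzMap.smulLeftCLM ℂ
          (fun x => h a (x p.1) * K x (atPts x bs)) f) * (g₀ * g) * (p.2 a * c)) +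
        csum L fun bs g => d (SchwartzMap.smulLeftCLM ℂ (fun x => S.contr z h
          (fun L' => K x ((a, x p.1) :: L')) (atPts x bs)) f) * (g₀ * p.2 a * g) * c := by
      intro a
      rw [← csum_add]
      refine csum_congr hL' fun bs g hg => ?_
      have t1 : (fun x => h a (x p.1) * K x (atPts x bs)).HasTemperateGrowth := (hasTemperateGrowth_comp_apply (hh a) p.1).mul (hK bs)
      have t2 := S.contr_hasTemperateGrowth z hh bs (K := fun x L' => K x ((a, x p.1) :: L'))
        fun bs => hK ((a, p.1) :: bs)
      have t3 : (sgn (z * S.deg bs) • fun x => h a (x p.1) * K x (atPts x bs)).HasTemperateGrowth :=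
        (Function.HasTemperateGrowth.const _).mul t1
      have e : (fun x => S.contr z h (K x) (atPts x ((a, p.1) :: bs))) =
          (sgn (z * S.deg bs) • fun x => h a (x p.1) * K x (atPts x bs)) +
          fun x => S.contr z h (fun L' => K x ((a, x p.1) :: L')) (atPts x bs) := by
        funext x
        simp only [Pi.add_apply, Pi.smul_apply, smul_eq_mul, ← mul_assoc, ← S.deg_atPts x bs]
        rfl
      rw [e, SchwartzMap.smulLeftCLM_add t3 t2,
        SchwartzMap.smulLeftCLM_smul t1, add_apply, smul_apply, map_add, map_smul, add_mul, add_mul,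
        mul_assoc g₀]
      congr 1
      by_cases ha : S.z a.1 + z = 0
      · rw [hG.graded_comm _ _ _ (hL p (by simp) a) _ hg, eq_neg_of_add_eq_zero_left ha, neg_mul,
          sgn_neg, mul_smul_comm, mul_smul_comm, smul_mul_assoc, smul_mul_assoc, smul_mul_assoc,
          smul_smul, sgn_mul_self, one_smul]
        simp only [mul_assoc]
      · have : (fun x : Fin n → Mink => h a (x p.1) * K x (atPts x bs)) = fun _ => 0 := by
          funext x
          rw [hz a ha, Pi.zero_apply, zero_mul]
        rw [this, SchwartzMap.smulLeftCLM_const]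
        simp
    rw [Finset.sum_congr rfl fun a _ => key a, Finset.sum_add_distrib]
    congr 1
    rw [Finset.sum_congr rfl fun a _ => ih hL' (K := fun x L' => K x ((a, x p.1) :: L'))
      (fun bs => hK ((a, p.1) :: bs)) (g₀ * p.2 a),
      sum_list_sum_comm]
    refine congrArg List.sum (List.map_congr_left fun q _ => ?_)
    simp only [csum]
    rw [Finset.sum_comm]
    simp only [mul_assoc]
    rfl

/-- The commutator of a product of a bosonic distribution with a normal product, and of a free
field. -/
theorem mulNormal_comm_list (hG : S.IsGrassmann gr) {n : ℕ} {d : Test n →ₗ[ℂ] G}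
    (hd : ∀ f, S.Bosonic gr (d f)) {A : Fin N} {O O' : Module.End ℂ S.poly}
    {hp hm : JetIdx N r → Mink → ℂ} (hO : S.IsFieldLike r O O' (S.z A) hp hm) {c : G}
    (hc : c ∈ gr (S.z A)) {L : List (Fin n × (JetIdx N r → G))} (hL : S.IsGraded gr L)
    (ψ χ : S.poly) (f : Test n) :
    S.mulNormal d L ψ (O χ : S.poly) f * c = c * S.mulNormal d L (O' ψ : S.poly) χ f +
      ((removals L).map fun q => ∑ a, S.mulNormal d q.2 ψ χ (SchwartzMap.smulLeftCLM ℂ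
        (fun x => (hp + hm) a (x q.1.1)) f) * (q.1.2 a * c)).sum := by
  have hh : ∀ a, ((hp + hm) a).HasTemperateGrowth := fun a =>
    (hO.temperate_plus a).add (hO.temperate_minus a)
  have hz : ∀ a, S.z a.1 + S.z A ≠ 0 → (hp + hm) a = 0 := fun a ha => by
    rw [Pi.add_apply, (hO.eq_zero a ha).1, (hO.eq_zero a ha).2, add_zero]
  have hc1 := csum_contr hG d f hh hz c hL (K := fun x L => S.kerL L ψ χ)
    (fun bs => S.kerAt_hasTemperateGrowth bs ψ χ) 1
  simp only [mulNormal_eq_csum]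
  simp only [csum_mul, mul_csum]
  have e : ∀ (bs : List (JetIdx N r × Fin n)) (q : (Fin n × (JetIdx N r → G)) × List (Fin n × (JetIdx N r → G))) a,
      SchwartzMap.smulLeftCLM ℂ (S.kerAt bs ψ χ)
        (SchwartzMap.smulLeftCLM ℂ (fun x => (hp + hm) a (x q.1.1)) f) =
      SchwartzMap.smulLeftCLM ℂ (fun x => (hp + hm) a (x q.1.1) * S.kerL (atPts x bs) ψ χ) f := by
    intro bs q a
    rw [SchwartzMap.smulLeftCLM_smulLeftCLM_apply (S.kerAt_hasTemperateGrowth _ _ _)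
      (hasTemperateGrowth_comp_apply (hh a) _), mul_comm]
    rfl
  simp only [e]
  simp only [one_mul] at hc1
  rw [← hc1, ← csum_add]
  refine csum_congr hL fun bs g hg => ?_
  have e2 : S.kerAt bs ψ (O χ) = (sgn (S.z A * S.deg bs) • S.kerAt bs (O' ψ) χ) + fun x =>
      S.contr (S.z A) (hp + hm) (fun L => S.kerL L ψ χ) (atPts x bs) := by
    funext x
    simp only [kerAt, hO.kerL, S.deg_atPts]
    rfl
  have t1 := S.kerAt_hasTemperateGrowth bs (O' ψ) χ
  have t3 : (sgn (S.z A * S.deg bs) • S.kerAt bs (O' ψ) χ).HasTemperateGrowth :=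
    (Function.HasTemperateGrowth.const _).mul t1
  rw [e2, SchwartzMap.smulLeftCLM_add t3 (S.contr_hasTemperateGrowth _ hh bs
    fun bs => S.kerAt_hasTemperateGrowth bs ψ χ), SchwartzMap.smulLeftCLM_smul t1, add_apply,
    smul_apply, map_add, map_smul, add_mul, add_mul]
  congr 1
  rw [← mul_assoc, ← (hd _ A c hc).eq, mul_assoc, mul_assoc, hG.graded_comm _ _ _ hc _ hg,
    smul_mul_assoc, mul_smul_comm]

/-- Products with normal products do not depend on the order of the letters. -/
theorem mulNormal_perm (hG : S.IsGrassmann gr) {n : ℕ} (d : Test n →ₗ[ℂ] G)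
    {L L' : List (Fin n × (JetIdx N r → G))} (hL : S.IsGraded gr L) (hp : L.Perm L')
    (ψ χ : S.poly) (f : Test n) : S.mulNormal d L ψ χ f = S.mulNormal d L' ψ χ f := by
  rw [mulNormal_eq_csum, mulNormal_eq_csum]
  refine csum_perm S hG hL hp (fun bs c g => mul_smul_comm _ _ _) fun pre a b post g => ?_
  rw [S.kerAt_swap, SchwartzMap.smulLeftCLM_smul (S.kerAt_hasTemperateGrowth _ _ _), smul_apply,
    map_smul, smul_mul_assoc]

theorem mulNormal_letters (hG : S.IsGrassmann gr) {n : ℕ} (d : Test n →ₗ[ℂ] G)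
    (L : List (Fin n × S.Jet gr r)) (ψ χ : S.poly) (f : Test n) :
    S.mulNormal d (S.letters (L : S.Config gr n r)) ψ χ f =
      S.mulNormal d (L.map fun p => (p.1, p.2.1)) ψ χ f := by
  refine mulNormal_perm hG d (isGraded_map _) (List.Perm.map _ ?_) ψ χ f
  exact Multiset.coe_eq_coe.1 (Multiset.coe_toList _)

open scoped Classical in
theorem mulNormal_comm (hG : S.IsGrassmann gr) {n : ℕ} {d : Test n →ₗ[ℂ] G}
    (hd : ∀ f, S.Bosonic gr (d f)) {A : Fin N} {O O' : Module.End ℂ S.poly}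
    {hp hm : JetIdx N r → Mink → ℂ} (hO : S.IsFieldLike r O O' (S.z A) hp hm) {c : G}
    (hc : c ∈ gr (S.z A)) (W : S.Config gr n r) (ψ χ : S.poly) (f : Test n) :
    S.mulNormal d (S.letters W) ψ (O χ : S.poly) f * c =
      c * S.mulNormal d (S.letters W) (O' ψ : S.poly) χ f +
      (W.map fun p => ∑ a, S.mulNormal d (S.letters (W.erase p)) ψ χ (SchwartzMap.smulLeftCLM ℂ
        (fun x => (hp + hm) a (x p.1)) f) * (p.2.1 a * c)).sum := by
  have h := mulNormal_comm_list hG hd hO hc (isGraded_map W.toList) ψ χ f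
  have h2 := sum_removals W.toList fun p W' => ∑ a, S.mulNormal d (S.letters W') ψ χ
    (SchwartzMap.smulLeftCLM ℂ (fun x => (hp + hm) a (x p.1)) f) * (p.2.1 a * c)
  rw [Multiset.coe_toList] at h2
  rw [← h2]
  refine h.trans (congrArg _ (congrArg List.sum ?_))
  rw [removals_map, List.map_map]
  refine List.map_congr_left fun q _ => ?_
  simp only [Function.comp_apply, mulNormal_letters hG]

end Grassmann

end FreeFields

/-! ### Sums over sub-multisets -/

theorem erase_cons_of_mem {α : Type*} [DecidableEq α] {a u : α} {s : Multiset α} (hu : u ∈ s) :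
    (a ::ₘ s).erase u = a ::ₘ s.erase u := by
  by_cases h : a = u
  · subst h
    rw [Multiset.erase_cons_head, Multiset.cons_erase hu]
  · rw [Multiset.erase_cons_tail _ h]

/-- Marking a letter of a sub-multiset is the same as choosing a sub-multiset of the remaining
letters after marking one. -/
theorem sum_antidiagonal_fst {α X : Type*} [DecidableEq α] [AddCommMonoid X] (W : Multiset α)
    (Φ : α → Multiset α → Multiset α → X) :
    (W.antidiagonal.map fun p => (p.1.map fun u => Φ u (p.1.erase u) p.2).sum).sum =
      (W.map fun u => ((W.erase u).antidiagonal.map fun q => Φ u q.1 q.2).sum).sum := by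
  induction W using Multiset.induction_on generalizing Φ with
  | empty => simp
  | cons a s ih =>
    have h1 := ih fun u p q => Φ u p (a ::ₘ q)
    have h2 := ih fun u p q => Φ u (a ::ₘ p) q
    have e1 : ∀ p : Multiset α, (p.map fun u => Φ u ((a ::ₘ p).erase u)) =
        p.map fun u => Φ u (a ::ₘ p.erase u) := fun p =>
      Multiset.map_congr rfl fun u hu => by rw [erase_cons_of_mem hu]
    have e2 : ∀ p q : Multiset α, (p.map fun u => Φ u ((a ::ₘ p).erase u) q) =
        p.map fun u => Φ u (a ::ₘ p.erase u) q := fun p q =>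
      Multiset.map_congr rfl fun u hu => by rw [erase_cons_of_mem hu]
    have e3 : (s.map fun u => (((a ::ₘ s).erase u).antidiagonal.map fun q => Φ u q.1 q.2).sum) =
        s.map fun u => ((s.erase u).antidiagonal.map fun q => Φ u q.1 (a ::ₘ q.2)).sum +
          ((s.erase u).antidiagonal.map fun q => Φ u (a ::ₘ q.1) q.2).sum :=
      Multiset.map_congr rfl fun u hu => by
        rw [erase_cons_of_mem hu]
        simp [Multiset.antidiagonal_cons]
    simp only [Multiset.antidiagonal_cons, Multiset.map_add, Multiset.sum_add, Multiset.map_map,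
      Function.comp_def, Prod.map_fst, Prod.map_snd, id, Multiset.map_cons, Multiset.sum_cons,
      Multiset.erase_cons_head, e2, Multiset.sum_map_add, e3, h1, h2]
    abel

theorem sum_antidiagonal_eq {α X : Type*} [AddCommMonoid X] (W : Multiset α)
    (Φ : Multiset α × Multiset α → X) (h : ∀ p, p.1 ≠ 0 → Φ p = 0) :
    (W.antidiagonal.map Φ).sum = Φ (0, W) := by
  induction W using Multiset.induction_on generalizing Φ with
  | empty => simp
  | cons a s ih =>
    have h1 := ih (fun p => Φ (p.1, a ::ₘ p.2)) fun p hp => h _ hp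
    have h2 : ((s.antidiagonal.map fun p => Φ (a ::ₘ p.1, p.2)).sum) = 0 :=
      Multiset.sum_eq_zero fun x hx => by
        obtain ⟨p, -, rfl⟩ := Multiset.mem_map.1 hx
        exact h _ (Multiset.cons_ne_zero)
    simp only [Multiset.antidiagonal_cons, Multiset.map_add, Multiset.sum_add, Multiset.map_map,
      Function.comp_def, Prod.map, id]
    rw [h1, h2, add_zero]

namespace FreeFields

variable {N r : ℕ} {F : Type*} [NormedAddCommGroup F] [InnerProductSpace ℂ F] [CompleteSpace F]
  (S : FreeFields N F)

/-! ### Vacuum matrix elements and frequency cut-offs -/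

theorem annih_vacP (a : JetIdx N r) (x : Mink) : S.annih a x S.vacP = 0 := by
  refine S.annih_eq_of_integral a _ (fun _ => 0) (fun η => ?_) (fun η f => ?_) x
  · simp
  · have : S.minusP a f S.vacP = 0 := Subtype.ext (by
      rw [coe_minusP, jetMinus, LinearMap.smul_apply]
      exact (congrArg _ (S.minus_vac _ _)).trans (smul_zero _))
    simp [this]

theorem creaAdj_vacP (a : JetIdx N r) (x : Mink) : S.creaAdj a x S.vacP = 0 := by
  simp [creaAdj, annih_vacP]

theorem kerL_vacP {L : List (JetIdx N r × Mink)} (hL : L ≠ []) : S.kerL L S.vacP S.vacP = 0 := by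
  cases L with
  | nil => exact absurd rfl hL
  | cons p L => simp [kerL_cons, annih_vacP, creaAdj_vacP]

theorem pairing_vacP : S.pairing S.vacP S.vacP = 1 := by
  have h : S.pairing S.vacP S.vacP = inner ℂ (S.vac : F) (S.vac : F) := rfl
  rw [h, inner_self_eq_norm_sq_to_K, S.norm_vac]
  simp

/-- The positive frequency part of a field vanishes on test functions with negative frequencies. -/
theorem plus_freqCut (A : Fin N) {ε : ℝ} (hε : 0 < ε) (g : Test1) :
    S.plus A (freqCut (-1) ε g) = 0 := by
  refine LinearMap.ext fun χ => ?_
  refine ext_inner_left ℂ fun ψ => ?_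
  have h := S.plus_freq A ψ χ (freqCut (-1) ε g)
  have h0 : Tendsto (fun δ : ℝ => inner ℂ (ψ : F) ((S.plus A (freqCut 1 δ (freqCut (-1) ε g)) +
      S.minus A (freqCut 1 δ (freqCut (-1) ε g))) χ : F)) (𝓝[>] 0) (𝓝 0) := by
    refine tendsto_const_nhds.congr' ?_
    filter_upwards [self_mem_nhdsWithin] with δ hδ
    rw [freqCut_freqCut δ ε hδ hε]
    simp
  exact (tendsto_nhds_unique h h0).trans (by simp)

/-- The positive frequency creation operators are adjoints of the annihilation operators. -/
theorem plusP_eq_sum_minusAdj (A : Fin N) (f : Test1) (ψ : S.poly) :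
    S.plusP (zeroIdx r A) f ψ = ∑ B, S.plus_adjoint.choose A B •
      S.minusAdj (zeroIdx r B) (conjTest f) ψ := by
  refine S.ext_copairing fun η => ?_
  have h1 : S.copairing η (S.plusP (zeroIdx r A) f ψ) =
      inner ℂ (S.plus A f ψ : F) ((η : S.dom) : F) := by
    rw [← S.jetPlus_zeroIdx (r := r)]; rfl
  have h2 : ∀ B, S.copairing η (S.minusAdj (zeroIdx r B) (conjTest f) ψ) =
      inner ℂ ((ψ : S.dom) : F) (S.minus B (conjTest f) η : F) := fun B => by
    rw [← S.jetMinus_zeroIdx (r := r)]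
    exact S.inner_minusAdj (zeroIdx r B) (conjTest f) ψ η
  rw [h1, map_sum]
  simp only [map_smulₛₗ, h2, smul_eq_mul]
  rw [← inner_conj_symm, S.plus_adjoint.choose_spec A f, map_sum]
  refine Finset.sum_congr rfl fun B _ => ?_
  rw [map_mul, inner_conj_symm]

/-- The function `smear (jetD a b) g` for the part of `g` with negative frequencies converges to
the one of the positive frequency part of the commutator function. -/
theorem tendsto_smulLeftCLM_freqCut {n : ℕ} (a b : JetIdx N r) (l : Fin n) (g : Test1)
    (f : Test n) :
    Tendsto (fun m : ℕ => SchwartzMap.smulLeftCLM ℂ (fun x : Fin n → Mink =>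
        smear (S.jetD a b) (freqCut (-1) (1 / ((m : ℝ) + 1)) g) (x l)) f) atTop
      (𝓝 (SchwartzMap.smulLeftCLM ℂ (fun x : Fin n → Mink => smear (S.jetDplus a b) g (x l)) f)) := by
  have hε : Tendsto (fun m : ℕ => 1 / ((m : ℝ) + 1)) atTop (𝓝[>] 0) :=
    tendsto_nhdsWithin_iff.2 ⟨tendsto_one_div_add_atTop_nhds_zero_nat,
      Eventually.of_forall fun m => by simp only [Set.mem_Ioi]; positivity⟩
  have h := tendsto_smulLeftCLM_smear l (D := fun m : ℕ => (-1 : ℂ) ^ order b.2 •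
      distDeriv a.2 (distDeriv b.2 ((S.Dplus a.1 b.1 + S.Dminus a.1 b.1).comp
        (freqCut 1 (1 / ((m : ℝ) + 1)))))) (D' := S.jetDplus a b) (fun g => ?_) g f
  · refine h.congr fun m => ?_
    congr 2
    funext x
    rw [smear_smul, smear_distDeriv, smear_distDeriv, jetD, smear_smul, smear_distDeriv,
      smear_distDeriv]
    congr 1
    simp only [smear]
    rw [← freqCut_pderiv, ← freqCut_pderiv, ← neg_neg (1 : ℝ), ← freqCut_reflectAt]
    simp
  · have h1 := (S.Dplus_freq a.1 b.1 (pderiv b.2 (pderiv a.2 g))).comp hε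
    exact ((h1.const_mul ((-1 : ℂ) ^ order b.2)).const_mul ((-1 : ℂ) ^ order a.2)).const_mul
      ((-1 : ℂ) ^ order b.2)

section Grassmann

variable {G : Type*} [Ring G] [Algebra ℂ G] {gr : ℤ → Submodule ℂ G}

/-! ### Cancellation of Grassmann numbers -/

variable {S} in
theorem eq_of_mul_right_eq [GradedAlgebra gr] (hG : S.IsGrassmann gr) (A : Fin N) {x y : G}
    (h : ∀ c ∈ gr (S.z A), x * c = y * c) : x = y := by
  rw [← sub_eq_zero]
  have h0 : ∀ c ∈ gr (S.z A), (x - y) * c = 0 := fun c hc => by rw [sub_mul, h c hc, sub_self]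
  generalize x - y = x at h0
  have hk : ∀ k, (GradedRing.proj gr k) x = 0 := by
    intro k
    refine hG.enough A _ fun c hc => ?_
    have hx : GradedRing.proj gr k x ∈ gr k := by
      rw [GradedRing.proj_apply]; exact SetLike.coe_mem _
    rw [hG.graded_comm _ _ _ hc _ hx]
    have e : GradedRing.proj gr (k + S.z A) (x * c) = GradedRing.proj gr k x * c := by
      rw [GradedRing.proj_apply, GradedRing.proj_apply]
      exact DirectSum.coe_decompose_mul_add_of_right_mem gr hc
    rw [← e, h0 c hc, map_zero, smul_zero]
  classical
  rw [← DirectSum.sum_support_decompose gr x]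
  exact Finset.sum_eq_zero fun k _ => hk k

variable {S} in
theorem eq_of_mul_left_eq [GradedAlgebra gr] (hG : S.IsGrassmann gr) (A : Fin N) {x y : G}
    (h : ∀ c ∈ gr (S.z A), c * x = c * y) : x = y := by
  rw [← sub_eq_zero]
  exact hG.enough A _ fun c hc => by rw [mul_sub, h c hc, sub_self]

/-! ### Matrix elements -/

theorem mel_tmul (ψ χ : S.dom) (x : G) (T : Module.End ℂ S.dom) :
    S.mel ψ χ (x ⊗ₜ[ℂ] T) = (inner ℂ (ψ : F) (T χ : F) : ℂ) • x := by
  simp [mel]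

theorem mel_mul_tmul (ψ χ : S.dom) (X : S.Op G) (c : G) (O : Module.End ℂ S.dom) :
    S.mel ψ χ (X * c ⊗ₜ[ℂ] O) = S.mel ψ (O χ) X * c := by
  induction X using TensorProduct.induction_on with
  | zero => simp
  | tmul x T =>
    rw [Algebra.TensorProduct.tmul_mul_tmul, mel_tmul, mel_tmul, smul_mul_assoc]
    rfl
  | add X Y hX hY => rw [add_mul, map_add, hX, hY, map_add, add_mul]

theorem mel_tmul_mul {ψ ψ' : S.dom} {O : Module.End ℂ S.dom}
    (h : ∀ χ : S.dom, inner ℂ ψ' χ = inner ℂ ψ (O χ)) (χ : S.dom) (X : S.Op G) (c : G) :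
    S.mel ψ χ (c ⊗ₜ[ℂ] O * X) = c * S.mel ψ' χ X := by
  induction X using TensorProduct.induction_on with
  | zero => simp
  | tmul x T =>
    rw [Algebra.TensorProduct.tmul_mul_tmul, mel_tmul, mel_tmul, mul_smul_comm]
    congr 1
    exact (h (T χ)).symm
  | add X Y hX hY => rw [mul_add, map_add, hX, hY, map_add, mul_add]

theorem mel_tmul_one (ψ χ : S.dom) (X : S.Op G) (c : G) :
    S.mel ψ χ (X * c ⊗ₜ[ℂ] 1) = S.mel ψ χ X * c := S.mel_mul_tmul ψ χ X c 1

/-- The classical field with a single non-vanishing coordinate `u_A = c`. -/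
def singleJet (r : ℕ) (A : Fin N) (c : G) (hc : c ∈ gr (S.z A)) : S.Jet gr r :=
  ⟨fun a => if a = zeroIdx r A then c else 0, fun a => by
    dsimp only
    split_ifs with h
    · rw [h]; exact hc
    · exact zero_mem _⟩

theorem superField_singleJet (A : Fin N) (c : G) (hc : c ∈ gr (S.z A)) (g : Test1) :
    S.superField (S.singleJet r A c hc).1 g = c ⊗ₜ[ℂ] (S.plus A g + S.minus A g) := by
  rw [superField, Finset.sum_eq_single (zeroIdx r A)]
  · simp [singleJet]
  · intro b _ hb
    simp [singleJet, hb]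
  · simp

theorem mel_mulDelta {n : ℕ} (T : Test n →ₗ[ℂ] S.Op G) (l : Fin n) (u w : JetIdx N r → G)
    (g : Test1) (f : Test n) (ψ χ : S.dom) :
    S.mel ψ χ (S.mulDelta T l u w g f) = ∑ a, ∑ b, S.mel ψ χ (T (SchwartzMap.smulLeftCLM ℂ
      (fun x : Fin n → Mink => smear (S.jetD a b) g (x l)) f)) * (u a * w b) := by
  simp only [mulDelta, map_sum, mel_tmul_one]

theorem mel_mulDelta_singleJet {n : ℕ} (T : Test n →ₗ[ℂ] S.Op G) (l : Fin n)
    (u : JetIdx N r → G) (A : Fin N) (c : G) (hc : c ∈ gr (S.z A)) (g : Test1) (f : Test n)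
    (ψ χ : S.dom) :
    S.mel ψ χ (S.mulDelta T l u (S.singleJet r A c hc).1 g f) =
      ∑ a, S.mel ψ χ (T (SchwartzMap.smulLeftCLM ℂ
        (fun x : Fin n → Mink => smear (S.jetD a (zeroIdx r A)) g (x l)) f)) * (u a * c) := by
  rw [mel_mulDelta]
  refine Finset.sum_congr rfl fun a _ => ?_
  rw [Finset.sum_eq_single (zeroIdx r A)]
  · simp [singleJet]
  · intro b _ hb
    simp [singleJet, hb]
  · simp

theorem mulNormal_vac {n : ℕ} (d : Test n →ₗ[ℂ] G) {L : List (Fin n × (JetIdx N r → G))}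
    (hL : L ≠ []) (f : Test n) : S.mulNormal d L S.vac S.vac f = 0 := by
  have h := S.mulNormal_eq_csum d L S.vacP S.vacP f
  refine h.trans ?_
  cases L with
  | nil => exact absurd rfl hL
  | cons p L =>
    rw [csum]
    refine Finset.sum_eq_zero fun a _ => ?_
    have : ∀ bs, S.kerAt ((a, p.1) :: bs) S.vacP S.vacP = fun _ : Fin n → Mink => 0 := fun bs =>
      funext fun x => S.kerL_vacP (by simp [atPts])
    simp only [this, SchwartzMap.smulLeftCLM_const]
    simpa using csum_zero (X := G) L

theorem mulNormal_nil_vac {n : ℕ} (d : Test n →ₗ[ℂ] G) (f : Test n) :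
    S.mulNormal (r := r) d [] S.vac S.vac f = d f := by
  have h := S.mulNormal_eq_csum (r := r) d [] S.vacP S.vacP f
  refine h.trans ?_
  have : S.kerAt (r := r) [] S.vacP S.vacP = fun _ : Fin n → Mink => 1 := funext fun x =>
    S.pairing_vacP
  simp [csum, this, SchwartzMap.smulLeftCLM_const]

end Grassmann

end FreeFields

namespace FreeFields

variable {N r : ℕ} {F : Type*} [NormedAddCommGroup F] [InnerProductSpace ℂ F] [CompleteSpace F]
  {S : FreeFields N F} {G : Type*} [Ring G] [Algebra ℂ G] {gr : ℤ → Submodule ℂ G}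

/-! ### The Wick expansion -/

/-- The right-hand side of the Wick expansion. -/
def wickSum {n : ℕ} (E : S.Ensemble gr n r) (W : S.Config gr n r) (ψ χ : S.dom) (f : Test n) : G :=
  (W.antidiagonal.map fun p => S.mulNormal (S.vev (E p.2)) (S.letters p.1) ψ χ f).sum

theorem mel_add_left (ψ ψ' χ : S.dom) (X : S.Op G) :
    S.mel (ψ + ψ') χ X = S.mel ψ χ X + S.mel ψ' χ X := by
  induction X using TensorProduct.induction_on with
  | zero => simp
  | tmul x T => simp [mel_tmul, add_smul]
  | add X Y hX hY => rw [map_add, hX, hY, map_add, map_add]; abel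

theorem mel_smul_left (c : ℂ) (ψ χ : S.dom) (X : S.Op G) :
    S.mel (c • ψ) χ X = conj c • S.mel ψ χ X := by
  induction X using TensorProduct.induction_on with
  | zero => simp
  | tmul x T => simp [mel_tmul, smul_smul, mul_comm]
  | add X Y hX hY => rw [map_add, hX, hY, map_add, smul_add]

theorem mel_add_right (ψ χ χ' : S.dom) (X : S.Op G) :
    S.mel ψ (χ + χ') X = S.mel ψ χ X + S.mel ψ χ' X := by
  induction X using TensorProduct.induction_on with
  | zero => simp
  | tmul x T => simp [mel_tmul, add_smul]
  | add X Y hX hY => rw [map_add, hX, hY, map_add, map_add]; abel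

theorem mel_smul_right (c : ℂ) (ψ χ : S.dom) (X : S.Op G) :
    S.mel ψ (c • χ) X = c • S.mel ψ χ X := by
  induction X using TensorProduct.induction_on with
  | zero => simp
  | tmul x T => simp [mel_tmul, mul_smul]
  | add X Y hX hY => rw [map_add, hX, hY, map_add, smul_add]

theorem mulNormal_add_right {n : ℕ} (d : Test n →ₗ[ℂ] G) (L : List (Fin n × (JetIdx N r → G)))
    (ψ χ χ' : S.poly) (f : Test n) : S.mulNormal d L ψ (χ + χ' : S.poly) f =
      S.mulNormal d L ψ χ f + S.mulNormal d L ψ χ' f := by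
  simp only [mulNormal_eq_csum, ← csum_add]
  congr 1
  funext bs g
  have : S.kerAt bs ψ (χ + χ') = S.kerAt (n := n) bs ψ χ + S.kerAt bs ψ χ' := by
    funext x; simp [kerAt]
  rw [this, SchwartzMap.smulLeftCLM_add (S.kerAt_hasTemperateGrowth _ _ _)
    (S.kerAt_hasTemperateGrowth _ _ _), add_apply, map_add, add_mul]

theorem mulNormal_add_left {n : ℕ} (d : Test n →ₗ[ℂ] G) (L : List (Fin n × (JetIdx N r → G)))
    (ψ ψ' χ : S.poly) (f : Test n) : S.mulNormal d L (ψ + ψ' : S.poly) χ f =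
      S.mulNormal d L ψ χ f + S.mulNormal d L ψ' χ f := by
  simp only [mulNormal_eq_csum, ← csum_add]
  congr 1
  funext bs g
  have : S.kerAt bs (ψ + ψ') χ = S.kerAt (n := n) bs ψ χ + S.kerAt bs ψ' χ := by
    funext x; simp [kerAt]
  rw [this, SchwartzMap.smulLeftCLM_add (S.kerAt_hasTemperateGrowth _ _ _)
    (S.kerAt_hasTemperateGrowth _ _ _), add_apply, map_add, add_mul]

theorem csum_smul {n : ℕ} (c : ℂ) (L : List (Fin n × (JetIdx N r → G)))
    (Φ : List (JetIdx N r × Fin n) → G → G) :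
    c • csum L Φ = csum L fun bs g => c • Φ bs g :=
  csum_map (DistribSMul.toAddMonoidHom G c) L Φ

theorem mulNormal_smul_right {n : ℕ} (d : Test n →ₗ[ℂ] G) (L : List (Fin n × (JetIdx N r → G)))
    (c : ℂ) (ψ χ : S.poly) (f : Test n) : S.mulNormal d L ψ (c • χ : S.poly) f =
      c • S.mulNormal d L ψ χ f := by
  simp only [mulNormal_eq_csum, csum_smul]
  congr 1
  funext bs g
  have : S.kerAt bs ψ (c • χ) = c • S.kerAt (n := n) bs ψ χ := by
    funext x; simp [kerAt]
  rw [this, SchwartzMap.smulLeftCLM_smul (S.kerAt_hasTemperateGrowth _ _ _),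
    smul_apply, map_smul, smul_mul_assoc]

theorem mulNormal_smul_left {n : ℕ} (d : Test n →ₗ[ℂ] G) (L : List (Fin n × (JetIdx N r → G)))
    (c : ℂ) (ψ χ : S.poly) (f : Test n) : S.mulNormal d L (c • ψ : S.poly) χ f =
      conj c • S.mulNormal d L ψ χ f := by
  simp only [mulNormal_eq_csum, csum_smul]
  congr 1
  funext bs g
  have : S.kerAt bs (c • ψ) χ = conj c • S.kerAt (n := n) bs ψ χ := by
    funext x; simp [kerAt]
  rw [this, SchwartzMap.smulLeftCLM_smul (S.kerAt_hasTemperateGrowth _ _ _),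
    smul_apply, map_smul, smul_mul_assoc]

theorem wickSum_add_right {n : ℕ} (E : S.Ensemble gr n r) (W : S.Config gr n r) (ψ χ χ' : S.poly)
    (f : Test n) : wickSum E W ψ (χ + χ' : S.poly) f = wickSum E W ψ χ f + wickSum E W ψ χ' f := by
  simp only [wickSum, ← Multiset.sum_map_add, mulNormal_add_right]

theorem wickSum_add_left {n : ℕ} (E : S.Ensemble gr n r) (W : S.Config gr n r) (ψ ψ' χ : S.poly)
    (f : Test n) : wickSum E W (ψ + ψ' : S.poly) χ f = wickSum E W ψ χ f + wickSum E W ψ' χ f := by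
  simp only [wickSum, ← Multiset.sum_map_add, mulNormal_add_left]

theorem wickSum_smul_right {n : ℕ} (E : S.Ensemble gr n r) (W : S.Config gr n r) (c : ℂ)
    (ψ χ : S.poly) (f : Test n) : wickSum E W ψ (c • χ : S.poly) f = c • wickSum E W ψ χ f := by
  simp only [wickSum, mulNormal_smul_right, Multiset.smul_sum, Multiset.map_map,
    Function.comp_def]

theorem wickSum_smul_left {n : ℕ} (E : S.Ensemble gr n r) (W : S.Config gr n r) (c : ℂ)
    (ψ χ : S.poly) (f : Test n) :
    wickSum E W (c • ψ : S.poly) χ f = conj c • wickSum E W ψ χ f := by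
  simp only [wickSum, mulNormal_smul_left, Multiset.smul_sum, Multiset.map_map,
    Function.comp_def]

open scoped Classical in
/-- The commutator with an annihilation operator, between a vector and the vacuum. It arises from
the commutator with the field smeared with test functions that have negative frequencies only. -/
theorem mel_minus_mul_vac {n : ℕ} {E : S.Ensemble gr n r}
    (hE : S.IsWickType E) (A : Fin N) (g : Test1) (c : G) (hc : c ∈ gr (S.z A))
    (W : S.Config gr n r) (ψ : S.dom) (f : Test n) :
    S.mel ψ S.vac (c ⊗ₜ[ℂ] S.minus A g * E W f) + (W.map fun p => ∑ a, S.mel ψ S.vac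
      (E (W.erase p) (SchwartzMap.smulLeftCLM ℂ (fun x : Fin n → Mink =>
        smear (S.jetDplus a (zeroIdx r A)) g (x p.1)) f)) * (p.2.1 a * c)).sum = 0 := by
  have hε : Tendsto (fun m : ℕ => 1 / ((m : ℝ) + 1)) atTop (𝓝[>] 0) :=
    tendsto_nhdsWithin_iff.2 ⟨tendsto_one_div_add_atTop_nhds_zero_nat,
      Eventually.of_forall fun m => by simp only [Set.mem_Ioi]; positivity⟩
  refine (Module.forall_dual_apply_eq_zero_iff ℂ _).1 fun l => ?_
  let gm : ℕ → Test1 := fun m => freqCut (-1) (1 / ((m : ℝ) + 1)) g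
  have h0 : ∀ m, S.mel ψ S.vac (c ⊗ₜ[ℂ] (S.plus A (gm m) + S.minus A (gm m)) * E W f) +
      (W.map fun p => ∑ a, S.mel ψ S.vac (E (W.erase p) (SchwartzMap.smulLeftCLM ℂ
        (fun x : Fin n → Mink => smear (S.jetD a (zeroIdx r A)) (gm m) (x p.1)) f)) *
          (p.2.1 a * c)).sum = 0 := by
    intro m
    have h := congrArg (S.mel ψ S.vac) (hE.comm W (S.singleJet r A c hc) f (gm m))
    rw [superField_singleJet, map_sub, mel_mul_tmul, plus_freqCut S A (by positivity), zero_add,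
      S.minus_vac, map_multiset_sum, Multiset.map_map] at h
    simp only [Function.comp_def, mel_mulDelta_singleJet] at h
    rw [← h, plus_freqCut S A (by positivity), zero_add]
    have : S.mel ψ (0 : S.dom) (E W f) = 0 := by
      have := mel_smul_right (S := S) 0 ψ 0 (E W f)
      simpa using this
    rw [this]
    simp
  have h1 : ∀ X : S.Op G, Tendsto (fun m => l (S.mel ψ S.vac
      (c ⊗ₜ[ℂ] (S.plus A (gm m) + S.minus A (gm m)) * X))) atTop
      (𝓝 (l (S.mel ψ S.vac (c ⊗ₜ[ℂ] S.minus A g * X)))) := by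
    intro X
    induction X using TensorProduct.induction_on with
    | zero => simp
    | tmul x T =>
      simp only [Algebra.TensorProduct.tmul_mul_tmul, mel_tmul, map_smul, smul_eq_mul]
      exact ((S.minus_freq A ψ (T S.vac) g).comp hε).mul_const _
    | add X Y hX hY =>
      simp only [mul_add, map_add]
      exact hX.add hY
  have h2 : Tendsto (fun m => l (W.map fun p => ∑ a, S.mel ψ S.vac (E (W.erase p)
      (SchwartzMap.smulLeftCLM ℂ (fun x : Fin n → Mink =>
        smear (S.jetD a (zeroIdx r A)) (gm m) (x p.1)) f)) * (p.2.1 a * c)).sum) atTop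
      (𝓝 (l (W.map fun p => ∑ a, S.mel ψ S.vac (E (W.erase p)
      (SchwartzMap.smulLeftCLM ℂ (fun x : Fin n → Mink =>
        smear (S.jetDplus a (zeroIdx r A)) g (x p.1)) f)) * (p.2.1 a * c)).sum)) := by
    simp only [map_multiset_sum, Multiset.map_map, Function.comp_def, map_sum]
    refine tendsto_multiset_sum _ fun p _ => tendsto_finsetSum _ fun a _ => ?_
    have := (hE.tempered (W.erase p) ψ S.vac (l ∘ₗ LinearMap.mulRight ℂ (p.2.1 a * c))).tendsto
      (SchwartzMap.smulLeftCLM ℂ (fun x : Fin n → Mink =>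
        smear (S.jetDplus a (zeroIdx r A)) g (x p.1)) f)
    exact this.comp (S.tendsto_smulLeftCLM_freqCut a (zeroIdx r A) p.1 g f)
  have h3 := (h1 (E W f)).add h2
  simp only [← map_add, h0] at h3
  exact (tendsto_nhds_unique h3 tendsto_const_nhds).trans (map_zero l)

variable [GradedAlgebra gr]

open scoped Classical in
/-- The Wick sum fulfils the same commutation relations as the expressions of Wick type. -/
theorem wickSum_comm (hG : S.IsGrassmann gr) {n : ℕ} {E : S.Ensemble gr n r}
    (hE : S.IsWickType E) {A : Fin N} {O O' : Module.End ℂ S.poly}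
    {hp hm : JetIdx N r → Mink → ℂ} (hO : S.IsFieldLike r O O' (S.z A) hp hm) {c : G}
    (hc : c ∈ gr (S.z A)) (W : S.Config gr n r) (ψ χ : S.poly) (f : Test n) :
    wickSum E W ψ (O χ : S.poly) f * c = c * wickSum E W (O' ψ : S.poly) χ f +
      (W.map fun p => ∑ a, wickSum E (W.erase p) ψ χ (SchwartzMap.smulLeftCLM ℂ
        (fun x => (hp + hm) a (x p.1)) f) * (p.2.1 a * c)).sum := by
  have h := sum_antidiagonal_fst W fun p W₁ W₂ => ∑ a, S.mulNormal (S.vev (E W₂)) (S.letters W₁)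
    ψ χ (SchwartzMap.smulLeftCLM ℂ (fun x => (hp + hm) a (x p.1)) f) * (p.2.1 a * c)
  simp only [wickSum, ← Multiset.sum_map_mul_right, ← Multiset.sum_map_mul_left]
  rw [Multiset.map_congr rfl fun p _ => mulNormal_comm hG (hE.bosonic p.2) hO hc p.1 ψ χ f,
    Multiset.sum_map_add, h]
  congr 2
  refine Multiset.map_congr rfl fun p _ => ?_
  exact Multiset.sum_map_sum

open scoped Classical in
theorem mel_eq_wickSum_of_erase (hG : S.IsGrassmann gr) {n : ℕ} {E : S.Ensemble gr n r}
    (hE : S.IsWickType E) (W : S.Config gr n r) (ih : ∀ p ∈ W, ∀ (ψ χ : S.poly) (f : Test n),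
      S.mel ψ χ (E (W.erase p) f) = wickSum E (W.erase p) ψ χ f) (ψ χ : S.poly) (f : Test n) :
    S.mel ψ χ (E W f) = wickSum E W ψ χ f := by
  -- the case that `χ` is the vacuum, by induction on `ψ`
  have hvac : ∀ ψ : S.poly, S.mel ψ S.vacP (E W f) = wickSum E W ψ S.vacP f := by
    refine S.poly_induction_plus (r := r) ?_ ?_ ?_ ?_ ?_
    · have h := sum_antidiagonal_eq W
        (fun p => S.mulNormal (S.vev (E p.2)) (S.letters p.1) S.vac S.vac f)
        fun p hp => S.mulNormal_vac _ (by simpa [letters]) f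
      refine Eq.trans ?_ h.symm
      have h0 : S.letters (0 : S.Config gr n r) = [] := by simp [letters]
      simp only [h0]
      exact (S.mulNormal_nil_vac (r := r) (S.vev (E W)) f).symm
    · intro A g ψ hψ
      have hadj : ∀ B g, S.mel (S.minusAdj (zeroIdx r B) g ψ : S.poly) S.vacP (E W f) =
          wickSum E W (S.minusAdj (zeroIdx r B) g ψ : S.poly) S.vacP f := by
        intro B g
        refine eq_of_mul_left_eq hG B fun c hc => ?_
        have hO := S.isFieldLike_minusP (zeroIdx r B) g
        have h1 := wickSum_comm hG hE hO hc W ψ S.vacP f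
        have h2 := mel_minus_mul_vac hE B g c hc W ψ f
        have h3 : S.minusP (zeroIdx r B) g S.vacP = 0 := Subtype.ext (by
          rw [coe_minusP, jetMinus_zeroIdx]; exact S.minus_vac B g)
        have h4 : wickSum E W ψ (0 : S.poly) f = 0 := by
          simpa using wickSum_smul_right E W 0 ψ 0 f
        rw [h3, h4, zero_mul] at h1
        rw [mel_tmul_mul S (ψ' := (S.minusAdj (zeroIdx r B) g ψ : S.poly)) (fun χ => by
          rw [S.inner_minusAdj, jetMinus_zeroIdx])] at h2
        have h5 : (W.map fun p => ∑ a, S.mel ψ S.vac (E (W.erase p) (SchwartzMap.smulLeftCLM ℂ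
            (fun x : Fin n → Mink => smear (S.jetDplus a (zeroIdx r B)) g (x p.1)) f)) *
              (p.2.1 a * c)) = W.map fun p => ∑ a, wickSum E (W.erase p) ψ S.vacP
            (SchwartzMap.smulLeftCLM ℂ (fun x : Fin n → Mink =>
              smear (S.jetDplus a (zeroIdx r B)) g (x p.1)) f) * (p.2.1 a * c) :=
          Multiset.map_congr rfl fun p hp => Finset.sum_congr rfl fun a _ => by
            rw [← ih p hp ψ S.vacP]; rfl
        rw [h5] at h2
        rw [add_zero] at h1
        exact add_right_cancel (h2.trans h1)
      rw [plusP_eq_sum_minusAdj]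
      generalize S.plus_adjoint.choose A = k
      induction (Finset.univ : Finset (Fin N)) using Finset.induction_on with
      | empty =>
        have h1 := mel_smul_left (S := S) (G := G) 0 0 S.vacP (E W f)
        have h2 := wickSum_smul_left E W 0 0 S.vacP f
        simp only [map_zero, zero_smul] at h1 h2
        simpa using h1.trans h2.symm
      | insert B s hB ihs =>
        rw [Finset.sum_insert hB, wickSum_add_left, wickSum_smul_left, Submodule.coe_add,
          mel_add_left, ihs, Submodule.coe_smul, mel_smul_left, hadj]
    · have h1 := mel_smul_left (S := S) (G := G) 0 0 S.vacP (E W f)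
      have h2 := wickSum_smul_left E W 0 0 S.vacP f
      simp only [map_zero, zero_smul] at h1 h2
      simpa using h1.trans h2.symm
    · intro ψ ψ' h h'
      rw [Submodule.coe_add, mel_add_left, h, h', ← wickSum_add_left]
      rfl
    · intro c ψ h
      rw [Submodule.coe_smul, mel_smul_left, h, ← wickSum_smul_left]
      rfl
  -- the general case, by induction on `χ`
  obtain ⟨χ, hχ⟩ := χ
  obtain ⟨h, H⟩ : ∃ h : χ ∈ S.poly, ∀ ψ : S.poly,
      S.mel ψ χ (E W f) = wickSum E W ψ (⟨χ, h⟩ : S.poly) f := by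
    refine S.poly_induction (P := fun χ => ∃ h : χ ∈ S.poly, ∀ ψ : S.poly,
      S.mel ψ χ (E W f) = wickSum E W ψ (⟨χ, h⟩ : S.poly) f) ⟨S.vac_mem_poly, hvac⟩ ?_ ?_ ?_ ?_ hχ
    · rintro A g χ hχ ⟨h, H⟩
      refine ⟨S.field_mem_poly A g h, fun ψ => ?_⟩
      refine eq_of_mul_right_eq hG A fun c hc => ?_
      have hO := (S.isFieldLike_plusP (zeroIdx r A) g).add (S.isFieldLike_minusP (zeroIdx r A) g)
      have h1 := wickSum_comm hG hE hO hc W ψ ⟨χ, h⟩ f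
      have h2 := congrArg (S.mel ψ χ) (hE.comm W (S.singleJet r A c hc) f g)
      rw [superField_singleJet, map_sub, mel_mul_tmul, map_multiset_sum, Multiset.map_map,
        mel_tmul_mul S (ψ' := ((S.plusAdj (zeroIdx r A) g + S.minusAdj (zeroIdx r A) g) ψ : S.poly))
        (fun χ => by
          rw [LinearMap.add_apply, Submodule.coe_add, inner_add_left, S.inner_minusAdj,
            S.inner_plusAdj, jetMinus_zeroIdx, jetPlus_zeroIdx, LinearMap.add_apply,
            inner_add_right]), sub_eq_iff_eq_add'] at h2
      simp only [Function.comp_def, mel_mulDelta_singleJet] at h2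
      have e : ((S.plusP (zeroIdx r A) g + S.minusP (zeroIdx r A) g) ⟨χ, h⟩ : S.poly) =
          (⟨(S.plus A g + S.minus A g) χ, S.field_mem_poly A g h⟩ : S.poly) := by
        apply Subtype.ext
        simp [coe_plusP, coe_minusP]
      rw [e] at h1
      rw [h1, h2, H]
      congr 2
      refine Multiset.map_congr rfl fun p hp => Finset.sum_congr rfl fun a _ => ?_
      rw [← ih p hp ψ ⟨χ, h⟩]
      congr 6
      funext x
      rw [smear_jetD]
      simp [add_comm]
    · refine ⟨zero_mem _, fun ψ => ?_⟩
      have h1 := mel_smul_right (S := S) (G := G) 0 ψ 0 (E W f)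
      have h2 := wickSum_smul_right E W 0 ψ 0 f
      simp only [zero_smul] at h1 h2
      exact h1.trans h2.symm
    · rintro χ χ' ⟨h, H⟩ ⟨h', H'⟩
      refine ⟨add_mem h h', fun ψ => ?_⟩
      rw [mel_add_right, H, H', ← wickSum_add_right]
      rfl
    · rintro c χ ⟨h, H⟩
      refine ⟨Submodule.smul_mem _ c h, fun ψ => ?_⟩
      rw [mel_smul_right, H, ← wickSum_smul_right]
      rfl
  exact H ψ

/-- The Wick expansion: an expression of Wick type is the sum over all sub-multisets of letters of
its vacuum expectation values times normal products. -/
theorem mel_eq_wickSum (hG : S.IsGrassmann gr) {n : ℕ} {E : S.Ensemble gr n r}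
    (hE : S.IsWickType E) (W : S.Config gr n r) (ψ χ : S.poly) (f : Test n) :
    S.mel ψ χ (E W f) = wickSum E W ψ χ f := by
  classical
  induction hk : W.card generalizing W ψ χ f with
  | zero =>
    refine mel_eq_wickSum_of_erase hG hE W (fun p hp => ?_) ψ χ f
    rw [Multiset.card_eq_zero.1 hk] at hp
    exact absurd hp (Multiset.notMem_zero p)
  | succ k ih =>
    refine mel_eq_wickSum_of_erase hG hE W (fun p hp ψ χ f => ih _ ψ χ f ?_) ψ χ f
    rw [Multiset.card_erase_of_mem hp, hk, Nat.pred_succ]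

end FreeFields

namespace FreeFields

variable {N r : ℕ} {F : Type*} [NormedAddCommGroup F] [InnerProductSpace ℂ F] [CompleteSpace F]
  (S : FreeFields N F)

/-! ### The polar of the mass-shell -/

variable {S} in
theorem sum_smul_minusP_eq_zero {u : JetIdx N r → ℂ} (hu : u ∈ S.massShell r) (k : ℤ) (f : Test1) :
    ∑ a with S.z a.1 = k, u a • S.minusP a f = 0 := by
  refine LinearMap.ext fun χ => ?_
  refine S.ext_pairing fun ψ => ?_
  rw [LinearMap.zero_apply, map_zero, LinearMap.sum_apply, map_sum]
  simp only [LinearMap.smul_apply, map_smul, smul_eq_mul]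
  -- the frequency cut-off selects the negative frequency part of the field equation
  have h1 : Tendsto (fun ε : ℝ => ∑ a with S.z a.1 = k, u a * inner ℂ ((ψ : S.dom) : F)
      ((S.jetPlus a (freqCut (-1) ε f) + S.jetMinus a (freqCut (-1) ε f)) χ : F)) (𝓝[>] 0)
      (𝓝 (∑ a with S.z a.1 = k, u a * S.pairing ψ (S.minusP a f χ))) := by
    refine tendsto_finsetSum _ fun a _ => Tendsto.const_mul _ ?_
    have h := (S.minus_freq a.1 ψ χ (pderiv a.2 f)).const_mul ((-1 : ℂ) ^ order a.2)
    have e : S.pairing ψ (S.minusP a f χ) = (-1 : ℂ) ^ order a.2 *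
        inner ℂ ((ψ : S.dom) : F) (S.minus a.1 (pderiv a.2 f) χ : F) := by
      have : S.pairing ψ (S.minusP a f χ) = inner ℂ ((ψ : S.dom) : F) (S.jetMinus a f χ : F) := rfl
      rw [this, jetMinus, LinearMap.smul_apply, Submodule.coe_smul, inner_smul_right]
    rw [e]
    refine h.congr fun ε => ?_
    rw [freqCut_pderiv, jetPlus, jetMinus, ← smul_add, LinearMap.smul_apply, Submodule.coe_smul,
      inner_smul_right]
  have h2 : ∀ ε : ℝ, ∑ a with S.z a.1 = k, u a * inner ℂ ((ψ : S.dom) : F)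
      ((S.jetPlus a (freqCut (-1) ε f) + S.jetMinus a (freqCut (-1) ε f)) χ : F) = 0 := by
    intro ε
    have h := congrArg (fun T : Module.End ℂ S.dom => inner ℂ ((ψ : S.dom) : F) (T χ : F))
      (hu k (freqCut (-1) ε f))
    simp only [LinearMap.zero_apply, Submodule.coe_zero, inner_zero_right, LinearMap.sum_apply,
      LinearMap.smul_apply, Submodule.coe_sum, Submodule.coe_smul, inner_sum, inner_smul_right] at h
    exact h
  simp only [h2] at h1
  exact tendsto_nhds_unique h1 tendsto_const_nhds

variable {S} in
theorem sum_smul_plusP_eq_zero {u : JetIdx N r → ℂ} (hu : u ∈ S.massShell r) (k : ℤ) (f : Test1) :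
    ∑ a with S.z a.1 = k, u a • S.plusP a f = 0 := by
  have h1 := sum_smul_minusP_eq_zero hu k f
  have h2 : ∑ a with S.z a.1 = k, u a • (S.plusP a f + S.minusP a f) = 0 := by
    refine LinearMap.ext fun χ => Subtype.ext ?_
    have h := congrArg (fun T : Module.End ℂ S.dom => T χ) (hu k f)
    simp only [LinearMap.zero_apply, LinearMap.sum_apply, LinearMap.smul_apply] at h
    rw [LinearMap.sum_apply, Submodule.coe_sum]
    exact h
  simpa only [smul_add, Finset.sum_add_distrib, h1, add_zero] using h2

variable {S} in
theorem sum_smul_annih_eq_zero {u : JetIdx N r → ℂ} (hu : u ∈ S.massShell r) (k : ℤ) (x : Mink)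
    (χ : S.poly) : ∑ a with S.z a.1 = k, u a • S.annih a x χ = 0 := by
  refine S.ext_pairing fun ψ => ?_
  rw [map_zero, map_sum]
  simp only [map_smul, smul_eq_mul]
  have ht : ∀ a, (fun x => u a * S.pairing ψ (S.annih a x χ)).HasTemperateGrowth := fun a =>
    (Function.HasTemperateGrowth.const _).mul (S.annih_temperate a χ _)
  refine congrFun (eq_of_integral_mul_eq (h := fun x => ∑ a with S.z a.1 = k,
    u a * S.pairing ψ (S.annih a x χ)) (h' := fun _ => 0)
    (Function.HasTemperateGrowth.sum fun a _ => ht a) (.const 0) fun f => ?_) x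
  simp_rw [Finset.mul_sum]
  rw [MeasureTheory.integral_finsetSum _ fun a _ =>
    integrable_mul_of_hasTemperateGrowth (ht a) f]
  simp_rw [mul_left_comm (f _), MeasureTheory.integral_const_mul, integral_annih]
  have h := congrArg (fun T : Module.End ℂ S.poly => S.pairing ψ (T χ))
    (sum_smul_minusP_eq_zero hu k f)
  simpa [LinearMap.sum_apply, map_sum] using h

variable {S} in
theorem sum_smul_creaAdj_eq_zero {u : JetIdx N r → ℂ} (hu : u ∈ S.massShell r) (k : ℤ) (x : Mink)
    (ψ : S.poly) : ∑ a with S.z a.1 = k, conj (u a) • S.creaAdj a x ψ = 0 := by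
  refine S.ext_copairing fun χ => ?_
  rw [map_zero, map_sum]
  simp only [map_smulₛₗ, smul_eq_mul, Complex.conj_conj]
  have ht : ∀ a, (fun x => u a * S.copairing χ (S.creaAdj a x ψ)).HasTemperateGrowth := fun a =>
    (Function.HasTemperateGrowth.const _).mul (S.creaAdj_temperate a ψ _)
  refine congrFun (eq_of_integral_mul_eq (h := fun x => ∑ a with S.z a.1 = k,
    u a * S.copairing χ (S.creaAdj a x ψ)) (h' := fun _ => 0)
    (Function.HasTemperateGrowth.sum fun a _ => ht a) (.const 0) fun f => ?_) x
  simp_rw [Finset.mul_sum]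
  rw [MeasureTheory.integral_finsetSum _ fun a _ =>
    integrable_mul_of_hasTemperateGrowth (ht a) f]
  simp_rw [mul_left_comm (f _), MeasureTheory.integral_const_mul, integral_creaAdj]
  have h := congrArg (fun T : Module.End ℂ S.poly => S.pairing ψ (T χ))
    (sum_smul_plusP_eq_zero hu k f)
  have e : ∀ a : JetIdx N r, S.copairing χ (S.plusAdj a f ψ) = S.pairing ψ (S.plusP a f χ) := fun a =>
    S.adj_plusP a f ψ χ
  simp_rw [e]
  simpa [LinearMap.sum_apply, map_sum] using h

variable {S} in
theorem mem_polar_of_homogeneous {t : JetIdx N r → ℂ}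
    (h : ∀ u ∈ S.massShell r, ∀ k, ∑ a with S.z a.1 = k, u a * t a = 0) : t ∈ S.polar r := by
  intro u hu
  have := Finset.sum_fiberwise_of_maps_to (s := Finset.univ) (t := Finset.univ.image
    fun a : JetIdx N r => S.z a.1) (g := fun a => S.z a.1) (fun a _ => Finset.mem_image_of_mem _
      (Finset.mem_univ a)) fun a => u a * t a
  simp only [h u hu, Finset.sum_const_zero] at this
  simp only [pair, smul_eq_mul, mul_comm (t _), ← this]

/-- The kernels of the normal products, as functions of the index of any factor, belong to the
polar of the mass-shell: the normal products are compatible with the field equations. -/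
theorem kerL_mem_polar (pre L : List (JetIdx N r × Mink)) (x : Mink) (ψ χ : S.poly) :
    (fun a => S.kerL (pre ++ (a, x) :: L) ψ χ) ∈ S.polar r := by
  refine mem_polar_of_homogeneous fun u hu k => ?_
  induction pre generalizing ψ χ with
  | nil =>
    have h1 := congrArg (fun η => S.kerL L η χ) (sum_smul_creaAdj_eq_zero hu k x ψ)
    have h2 := congrArg (fun η => S.kerL L ψ η) (sum_smul_annih_eq_zero hu k x χ)
    simp only [map_sum, map_zero, LinearMap.sum_apply, map_smulₛₗ, LinearMap.smul_apply,
      smul_eq_mul, Complex.conj_conj, LinearMap.zero_apply, RingHom.id_apply] at h1 h2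
    simp only [List.nil_append, kerL_cons, mul_add, Finset.sum_add_distrib, h1, zero_add]
    rw [← mul_zero (sgn (k * S.deg L)), ← h2, Finset.mul_sum]
    refine Finset.sum_congr rfl fun a ha => ?_
    rw [(Finset.mem_filter.1 ha).2, deg]
    ring
  | cons p pre ih =>
    simp only [List.cons_append, kerL_cons, mul_add, Finset.sum_add_distrib, ih, zero_add]
    rw [← mul_zero (sgn (S.z p.1.1 * (S.deg pre + k + S.deg L))), ← ih ψ (S.annih p.1 p.2 χ),
      Finset.mul_sum]
    refine Finset.sum_congr rfl fun a ha => ?_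
    have : (List.map (fun q => S.z q.1.1) (pre ++ (a, x) :: L)).sum =
        S.deg pre + k + S.deg L := by
      rw [← (Finset.mem_filter.1 ha).2]
      simp [deg, add_assoc]
    rw [this]
    ring

/-- The commutator functions, as functions of the first index, belong to the polar of the
mass-shell. -/
theorem smear_jetD_mem_polar (b : JetIdx N r) (g : Test1) (x : Mink) :
    (fun a => smear (S.jetD a b) g x) ∈ S.polar r := by
  refine mem_polar_of_homogeneous fun u hu k => ?_
  have hv : S.vacP ≠ 0 := fun h => by simpa [h] using S.pairing_vacP
  have h1 : ∑ a with S.z a.1 = k, u a * smear (S.jetDminus a b) g x = 0 := by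
    have h := sum_smul_annih_eq_zero hu k x (S.plusP b g S.vacP)
    simp only [(S.isFieldLike_plusP b g).annih, S.annih_vacP, map_zero, smul_zero, zero_add,
      smul_smul, ← Finset.sum_smul] at h
    exact (smul_eq_zero.1 h).resolve_right hv
  have h2 : ∑ a with S.z a.1 = k, u a * smear (S.jetDplus a b) g x = 0 := by
    have h := congrArg (S.minusAdj b g) (sum_smul_creaAdj_eq_zero hu k x S.vacP)
    have h' : ∀ a, S.minusAdj b g (S.creaAdj a x S.vacP) = sgn (S.z a.1 * S.z b.1) •
        S.creaAdj a x (S.minusAdj b g S.vacP) + conj (smear (S.jetDplus a b) g x) • S.vacP :=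
      fun a => (S.isFieldLike_minusP b g).creaAdj a x S.vacP
    have h'' : ∑ a with S.z a.1 = k, conj (u a) • sgn (S.z a.1 * S.z b.1) •
        S.creaAdj a x (S.minusAdj b g S.vacP) = 0 := by
      rw [← smul_zero (sgn (k * S.z b.1)), ← sum_smul_creaAdj_eq_zero hu k x
        (S.minusAdj b g S.vacP), Finset.smul_sum]
      refine Finset.sum_congr rfl fun a ha => ?_
      rw [(Finset.mem_filter.1 ha).2, smul_comm]
    simp only [map_sum, map_smul, map_zero, h', smul_add, Finset.sum_add_distrib, h'', zero_add] at h
    simp only [smul_smul, ← Finset.sum_smul] at h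
    have h3 := (smul_eq_zero.1 h).resolve_right hv
    have h4 := congrArg conj h3
    simpa using h4
  simp only [smear_jetD, mul_add, Finset.sum_add_distrib, h1, h2, add_zero]

variable {S} in
/-- The expansion of an element of the polar of the mass-shell in a basis. -/
theorem apply_eq_sum_of_mem_polar {d : ℕ} (v : Module.Basis (Fin d) ℂ (S.polar r))
    {vs : Fin d → JetIdx N r → ℂ} (hv : ∀ i j, pair (v i).1 (vs j) = if i = j then (1 : ℂ) else 0)
    {t : JetIdx N r → ℂ} (ht : t ∈ S.polar r) (a : JetIdx N r) :
    t a = ∑ j, ∑ b, ((v j).1 a * vs j b) * t b := by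
  have h0 : t = ∑ j, v.repr ⟨t, ht⟩ j • (v j).1 := by
    have h := congrArg (S.polar r).subtype (v.sum_repr ⟨t, ht⟩)
    rw [map_sum] at h
    exact h.symm
  have h1 : ∀ j, ∑ b, vs j b * t b = v.repr ⟨t, ht⟩ j := by
    intro j
    have e : ∑ b, vs j b * t b = ∑ i, v.repr ⟨t, ht⟩ i * pair (v i).1 (vs j) := by
      conv_lhs => rw [h0]
      simp only [Finset.sum_apply, Pi.smul_apply, smul_eq_mul, Finset.mul_sum, pair]
      rw [Finset.sum_comm]
      exact Finset.sum_congr rfl fun i _ => Finset.sum_congr rfl fun b _ => by ring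
    rw [e]
    simp [hv]
  simp only [mul_assoc, ← Finset.mul_sum, h1]
  conv_lhs => rw [h0]
  simp [mul_comm]

end FreeFields

theorem sum_piFinset_succ {m : ℕ} {α X : Type*} [AddCommMonoid X] [DecidableEq α]
    (s : Fin (m + 1) → Finset α) (Θ : (Fin (m + 1) → α) → X) :
    ∑ U ∈ Fintype.piFinset s, Θ U =
      ∑ a ∈ s 0, ∑ U ∈ Fintype.piFinset fun l => s l.succ, Θ (Fin.cons a U) := by
  rw [← Finset.sum_product']
  refine Finset.sum_nbij' (fun U => (U 0, Fin.tail U)) (fun q => Fin.cons q.1 q.2) ?_ ?_ ?_ ?_ ?_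
  · intro U hU
    rw [Fintype.mem_piFinset] at hU
    simp only [Finset.mem_product, Fintype.mem_piFinset]
    exact ⟨hU 0, fun l => hU l.succ⟩
  · intro q hq
    simp only [Finset.mem_product, Fintype.mem_piFinset] at hq
    rw [Fintype.mem_piFinset]
    exact Fin.cases hq.1 hq.2
  · intro U _
    exact Fin.cons_self_tail U
  · intro q _
    rfl
  · intro U _
    rw [Fin.cons_self_tail]

namespace FreeFields

variable {N r : ℕ} {F : Type*} [NormedAddCommGroup F] [InnerProductSpace ℂ F] [CompleteSpace F]
  {S : FreeFields N F} {G : Type*} [Ring G] [Algebra ℂ G] {gr : ℤ → Submodule ℂ G}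

/-! ### Wick polynomials -/

/-- The extension of a function `Θ` of Wick monomials (and of a coefficient) to Wick polynomials. -/
def polySum {m : ℕ} {X : Type*} [AddCommMonoid X] (P : Fin m → S.WickPoly gr r)
    (Θ : (Fin m → Multiset (S.Jet gr r)) → G → X) : X :=
  ∑ U ∈ Fintype.piFinset fun l => (P l).support, Θ U (List.ofFn fun l => P l (U l)).prod

theorem extend_apply {n : ℕ} (E : S.Ensemble gr n r) (P : Fin n → S.WickPoly gr r) (f : Test n) :
    S.extend E P f = polySum P fun U c => E (S.config U) f * c ⊗ₜ[ℂ] (1 : Module.End ℂ S.dom) := by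
  simp [extend, polySum, LinearMap.sum_apply]

theorem polySum_succ {m : ℕ} {X : Type*} [AddCommMonoid X] (P : Fin (m + 1) → S.WickPoly gr r)
    (Θ : (Fin (m + 1) → Multiset (S.Jet gr r)) → G → X) :
    polySum P Θ = (P 0).sum fun U c => polySum (fun l => P l.succ)
      fun U' c' => Θ (Fin.cons U U') (c * c') := by
  classical
  rw [polySum, sum_piFinset_succ]
  simp [Finsupp.sum, polySum, List.ofFn_succ]

theorem polySum_zero {X : Type*} [AddCommMonoid X] (P : Fin 0 → S.WickPoly gr r)
    (Θ : (Fin 0 → Multiset (S.Jet gr r)) → G → X) : polySum P Θ = Θ default 1 := by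
  simp only [polySum, List.ofFn_zero, List.prod_nil]
  rw [Finset.sum_eq_single default]
  · intro b _ hb
    exact absurd (Subsingleton.elim _ _) hb
  · intro h
    exact absurd (Fintype.mem_piFinset.2 fun l => l.elim0) h

theorem polySum_finsetSum {m : ℕ} {X ι : Type*} [AddCommMonoid X] (s : Finset ι)
    (P : Fin m → S.WickPoly gr r) (Θ : ι → (Fin m → Multiset (S.Jet gr r)) → G → X) :
    polySum P (fun U c => ∑ i ∈ s, Θ i U c) = ∑ i ∈ s, polySum P (Θ i) := Finset.sum_comm

theorem polySum_multisetSum {m : ℕ} {X ι : Type*} [AddCommMonoid X] (s : Multiset ι)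
    (P : Fin m → S.WickPoly gr r) (Θ : ι → (Fin m → Multiset (S.Jet gr r)) → G → X) :
    polySum P (fun U c => (s.map fun i => Θ i U c).sum) = (s.map fun i => polySum P (Θ i)).sum :=
  Multiset.sum_map_sum.symm

theorem polySum_map {m : ℕ} {X Y : Type*} [AddCommMonoid X] [AddCommMonoid Y] (T : X →+ Y)
    (P : Fin m → S.WickPoly gr r) (Θ : (Fin m → Multiset (S.Jet gr r)) → G → X) :
    T (polySum P Θ) = polySum P fun U c => T (Θ U c) := map_sum T _ _

theorem polySum_mul {m : ℕ} {X : Type*} [Ring X] (P : Fin m → S.WickPoly gr r)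
    (Θ : (Fin m → Multiset (S.Jet gr r)) → G → X) (x : X) :
    polySum P Θ * x = polySum P fun U c => Θ U c * x := Finset.sum_mul _ _ _

theorem Bosonic.mul {x y : G} (hx : S.Bosonic gr x) (hy : S.Bosonic gr y) :
    S.Bosonic gr (x * y) := fun A c hc => (hx A c hc).mul_left (hy A c hc)

theorem Bosonic.one : S.Bosonic gr (1 : G) := fun _ c _ => Commute.one_left c

theorem Bosonic.list_prod {l : List G} (hl : ∀ x ∈ l, S.Bosonic gr x) : S.Bosonic gr l.prod := by
  induction l with
  | nil => exact Bosonic.one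
  | cons x l ih =>
    rw [List.prod_cons]
    exact (hl x (by simp)).mul (ih fun y hy => hl y (by simp [hy]))

theorem Bosonic.commute_pair {x : G} (hx : S.Bosonic gr x) (v : JetIdx N r → ℂ)
    (u : S.Jet gr r) : Commute x (pair v u.1) :=
  Commute.sum_right _ _ _ fun a _ => (hx a.1 _ (u.2 a)).smul_right (v a)

theorem polySum_congr {m : ℕ} {X : Type*} [AddCommMonoid X] {P : Fin m → S.WickPoly gr r}
    (hP : ∀ l U, S.Bosonic gr (P l U)) {Θ Θ' : (Fin m → Multiset (S.Jet gr r)) → G → X}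
    (h : ∀ U c, S.Bosonic gr c → Θ U c = Θ' U c) : polySum P Θ = polySum P Θ' :=
  Finset.sum_congr rfl fun U _ => h U _ (Bosonic.list_prod fun x hx => by
    obtain ⟨l, rfl⟩ := (List.mem_ofFn' _ _).1 hx
    exact hP l _)

open scoped Classical in
theorem rho_sum {X : Type*} [AddCommMonoid X] (v : JetIdx N r → ℂ) (P : S.WickPoly gr r)
    (Φ : Multiset (S.Jet gr r) → G →+ X) :
    ((S.rho v P).sum fun U c => Φ U c) =
      P.sum fun U c => (U.map fun u => Φ (U.erase u) (pair v u.1 * c)).sum := by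
  have h : ∀ Q : S.WickPoly gr r, (Q.sum fun U c => Φ U c) = Finsupp.liftAddHom Φ Q := fun Q => rfl
  rw [h, rho, map_finsuppSum]
  refine Finsupp.sum_congr fun U _ => ?_
  rw [map_multiset_sum, Multiset.map_map]
  exact congrArg _ (Multiset.map_congr rfl fun u _ => Finsupp.liftAddHom_apply_single Φ _ _)

open scoped Classical in
/-- `ρ(v)` is a derivation: in one argument of a function of bosonic Wick polynomials, it removes a
letter `u` and produces a factor `⟨v, u⟩`. -/
theorem polySum_update_rho {m : ℕ} {X : Type*} [AddCommMonoid X] (v : JetIdx N r → ℂ)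
    {P : Fin m → S.WickPoly gr r} (hP : ∀ l U, S.Bosonic gr (P l U)) (l : Fin m)
    (Θ : (Fin m → Multiset (S.Jet gr r)) → G →+ X) :
    polySum (Function.update P l (S.rho v (P l))) (fun U c => Θ U c) =
      polySum P fun U c => ((U l).map fun u =>
        Θ (Function.update U l ((U l).erase u)) (pair v u.1 * c)).sum := by
  induction m with
  | zero => exact l.elim0
  | succ m ih =>
    rw [polySum_succ, polySum_succ]
    refine Fin.cases ?_ (fun l => ?_) l
    · have e : ∀ i : Fin m, Function.update P 0 (S.rho v (P 0)) i.succ = P i.succ := fun i =>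
        Function.update_of_ne (Fin.succ_ne_zero i) _ _
      simp only [Function.update_self, e, Fin.cons_zero, Fin.update_cons_zero]
      have h := rho_sum v (P 0) fun U =>
        { toFun := fun c => polySum (fun l => P l.succ) fun U' c' => Θ (Fin.cons U U') (c * c')
          map_zero' := by simp [polySum]
          map_add' := fun c c' => by simp [polySum, add_mul, Finset.sum_add_distrib] }
      refine h.trans (Finsupp.sum_congr fun U _ => ?_)
      rw [polySum_multisetSum]
      simp only [AddMonoidHom.coe_mk, ZeroHom.coe_mk, mul_assoc]
    · have e : (fun i : Fin m => Function.update P l.succ (S.rho v (P l.succ)) i.succ) =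
          Function.update (fun i => P i.succ) l (S.rho v (P l.succ)) := by
        funext i
        by_cases h : i = l
        · subst h; simp
        · rw [Function.update_of_ne h, Function.update_of_ne fun h' => h (Fin.succ_injective _ h')]
      rw [e, Function.update_of_ne (Fin.succ_ne_zero l).symm]
      refine Finsupp.sum_congr fun U _ => ?_
      have h := ih (P := fun i => P i.succ) (fun i => hP i.succ) l fun U' =>
        (Θ (Fin.cons U U')).comp (AddMonoidHom.mulLeft (P 0 U))
      refine h.trans ?_
      simp only [Fin.cons_succ, AddMonoidHom.comp_apply, AddMonoidHom.coe_mulLeft,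
        ← mul_assoc, ((hP 0 U).commute_pair v _).eq, Fin.cons_update]

/-! ### Commutators through derivative operators -/

theorem sum_comm_four {ι κ X : Type*} [Fintype ι] [Fintype κ] [AddCommMonoid X]
    (Q : κ → ι → ι → ι → X) :
    ∑ j, ∑ a, ∑ b, ∑ a', Q j a b a' = ∑ a', ∑ b, ∑ j, ∑ a, Q j a b a' := by
  have h : ∀ j, ∑ a, ∑ b, ∑ a', Q j a b a' = ∑ a', ∑ b, ∑ a, Q j a b a' := fun j => by
    rw [Finset.sum_comm, Finset.sum_congr rfl fun b _ => Finset.sum_comm, Finset.sum_comm]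
  rw [Finset.sum_congr rfl fun j _ => h j, Finset.sum_comm]
  exact Finset.sum_congr rfl fun a' _ => Finset.sum_comm

theorem map_config {n : ℕ} {X : Type*} [AddCommMonoid X] (U : Fin n → Multiset (S.Jet gr r))
    (Ψ : Fin n × S.Jet gr r → X) :
    ((S.config U).map Ψ).sum = ∑ l, ((U l).map fun u => Ψ (l, u)).sum := by
  have h := map_sum ((Multiset.sumAddMonoidHom (M := X)).comp (Multiset.mapAddMonoidHom Ψ))
    (fun l => (U l).map fun u => (l, u)) Finset.univ
  refine h.trans (Finset.sum_congr rfl fun l _ => ?_)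
  simp

open scoped Classical in
theorem config_update_erase {n : ℕ} (U : Fin n → Multiset (S.Jet gr r)) (l : Fin n)
    {u : S.Jet gr r} (hu : u ∈ U l) :
    S.config (Function.update U l ((U l).erase u)) = (S.config U).erase (l, u) := by
  have h : (l, u) ::ₘ S.config (Function.update U l ((U l).erase u)) = S.config U := by
    rw [config, config, ← Finset.add_sum_erase _ _ (Finset.mem_univ l),
      ← Finset.add_sum_erase _ _ (Finset.mem_univ l), Function.update_self, ← Multiset.cons_add,
      ← Multiset.map_cons (fun u => (l, u)), Multiset.cons_erase hu]
    congr 1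
    refine Finset.sum_congr rfl fun i hi => ?_
    rw [Function.update_of_ne (Finset.ne_of_mem_erase hi)]
  rw [← h, Multiset.erase_cons_head]

theorem tmul_one_mul_superField {c : G} (hc : S.Bosonic gr c) (w : S.Jet gr r) (g : Test1) :
    c ⊗ₜ[ℂ] (1 : Module.End ℂ S.dom) * S.superField w.1 g =
      S.superField w.1 g * c ⊗ₜ[ℂ] (1 : Module.End ℂ S.dom) := by
  simp only [superField, Finset.mul_sum, Finset.sum_mul, Algebra.TensorProduct.tmul_mul_tmul,
    one_mul, mul_one]
  exact Finset.sum_congr rfl fun a _ => by rw [(hc a.1 _ (w.2 a)).eq]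

theorem extend_comm {n : ℕ} (E : S.Ensemble gr n r) {P : Fin n → S.WickPoly gr r}
    (hP : ∀ l U, S.Bosonic gr (P l U)) (w : S.Jet gr r) (f : Test n) (g : Test1) :
    S.extend E P f * S.superField w.1 g - S.superField w.1 g * S.extend E P f =
      polySum P fun U c => (E (S.config U) f * S.superField w.1 g -
        S.superField w.1 g * E (S.config U) f) * c ⊗ₜ[ℂ] (1 : Module.End ℂ S.dom) := by
  have h1 := polySum_mul P (fun U c => E (S.config U) f * c ⊗ₜ[ℂ] (1 : Module.End ℂ S.dom))
    (S.superField w.1 g)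
  have h2 := polySum_map (AddMonoidHom.mulLeft (S.superField w.1 g)) P
    (fun U c => E (S.config U) f * c ⊗ₜ[ℂ] (1 : Module.End ℂ S.dom))
  rw [AddMonoidHom.coe_mulLeft] at h2
  rw [extend_apply, h1, h2, polySum, polySum, ← Finset.sum_sub_distrib]
  refine polySum_congr hP (Θ := fun U c => E (S.config U) f * c ⊗ₜ[ℂ] 1 * S.superField w.1 g -
    S.superField w.1 g * (E (S.config U) f * c ⊗ₜ[ℂ] 1)) fun U c hc => ?_
  rw [mul_assoc, tmul_one_mul_superField hc, sub_mul, mul_assoc, mul_assoc]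

open scoped Classical in
theorem sum_mulDelta_rho {n : ℕ} (E : S.Ensemble gr n r) {d : ℕ}
    (v : Module.Basis (Fin d) ℂ (S.polar r)) {vs : Fin d → JetIdx N r → ℂ}
    (hv : ∀ i j, pair (v i).1 (vs j) = if i = j then (1 : ℂ) else 0) {P : Fin n → S.WickPoly gr r}
    (hP : ∀ l U, S.Bosonic gr (P l U)) (w : S.Jet gr r) (f : Test n) (g : Test1) :
    ∑ l, ∑ j, S.mulDelta (S.extend E (Function.update P l (S.rho (v j).1 (P l)))) l
        (toG G (vs j)) w.1 g f =
      polySum P fun U c => ((S.config U).map fun p =>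
        S.mulDelta (E ((S.config U).erase p)) p.1 p.2.1 w.1 g f).sum *
          c ⊗ₜ[ℂ] (1 : Module.End ℂ S.dom) := by
  have hext : ∀ l j f, S.extend E (Function.update P l (S.rho (v j).1 (P l))) f =
      polySum P fun U c => ((U l).map fun u => E ((S.config U).erase (l, u)) f *
        (pair (v j).1 u.1 * c) ⊗ₜ[ℂ] (1 : Module.End ℂ S.dom)).sum := by
    intro l j f
    rw [extend_apply]
    have h := polySum_update_rho (v j).1 hP l fun U =>
      (AddMonoidHom.mulLeft (E (S.config U) f)).comp
        (((TensorProduct.mk ℂ G (Module.End ℂ S.dom)).flip 1).toAddMonoidHom)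
    refine h.trans ?_
    congr 1
    funext U c
    refine congrArg _ (Multiset.map_congr rfl fun u hu => ?_)
    rw [config_update_erase U l hu]
    rfl
  simp only [mulDelta, hext, polySum_mul, ← polySum_finsetSum]
  refine polySum_congr hP fun U c hc => ?_
  rw [map_config, Finset.sum_mul]
  refine Finset.sum_congr rfl fun l _ => ?_
  simp only [← Multiset.sum_map_mul_right, ← Multiset.sum_map_sum]
  refine congrArg _ (Multiset.map_congr rfl fun u hu => ?_)
  set T := E ((S.config U).erase (l, u))
  have key : ∀ a b, T (SchwartzMap.smulLeftCLM ℂ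
      (fun x : Fin n → Mink => smear (S.jetD a b) g (x l)) f) =
      ∑ j, ∑ a', ((v j).1 a * vs j a') • T (SchwartzMap.smulLeftCLM ℂ
        (fun x : Fin n → Mink => smear (S.jetD a' b) g (x l)) f) := by
    intro a b
    simp only [← map_smul, ← map_sum]
    congr 1
    ext x
    have ht := fun a => smear_comp_hasTemperateGrowth l (S.jetD a b) g
    simp only [SchwartzMap.smulLeftCLM_apply_apply (ht _), sum_apply, smul_apply, smul_eq_mul]
    rw [apply_eq_sum_of_mem_polar v hv (S.smear_jetD_mem_polar b g (x l)) a]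
    simp only [Finset.sum_mul]
    exact Finset.sum_congr rfl fun j _ => Finset.sum_congr rfl fun a' _ => by ring
  have hY : ∀ j a b, (pair (v j).1 u.1 * c) ⊗ₜ[ℂ] (1 : Module.End ℂ S.dom) *
      (toG G (vs j) a * w.1 b) ⊗ₜ[ℂ] (1 : Module.End ℂ S.dom) =
      ∑ a', ((v j).1 a' * vs j a) • ((u.1 a' * w.1 b * c) ⊗ₜ[ℂ] (1 : Module.End ℂ S.dom)) := by
    intro j a b
    simp only [Algebra.TensorProduct.tmul_mul_tmul, mul_one, pair, Finset.sum_mul,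
      TensorProduct.sum_tmul, TensorProduct.smul_tmul']
    refine Finset.sum_congr rfl fun a' _ => ?_
    rw [toG, ← Algebra.smul_def, mul_smul_comm, smul_mul_assoc, smul_mul_assoc, smul_smul,
      mul_comm (vs j a), mul_assoc (u.1 a'), (hc b.1 _ (w.2 b)).eq, mul_assoc]
  have hZ : ∀ a b, (u.1 a * w.1 b) ⊗ₜ[ℂ] (1 : Module.End ℂ S.dom) *
      c ⊗ₜ[ℂ] (1 : Module.End ℂ S.dom) = (u.1 a * w.1 b * c) ⊗ₜ[ℂ] (1 : Module.End ℂ S.dom) := by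
    intro a b
    rw [Algebra.TensorProduct.tmul_mul_tmul, mul_one]
  simp only [mul_assoc _ ((pair _ _ * c) ⊗ₜ[ℂ] _), hY, Finset.sum_mul,
    mul_assoc _ ((u.1 _ * w.1 _) ⊗ₜ[ℂ] _), hZ]
  simp only [Finset.mul_sum, mul_smul_comm]
  trans ∑ a, ∑ b, ∑ j, ∑ a', ((v j).1 a * vs j a') • (T (SchwartzMap.smulLeftCLM ℂ
      (fun x : Fin n → Mink => smear (S.jetD a' b) g (x l)) f) *
        (u.1 a * w.1 b * c) ⊗ₜ[ℂ] (1 : Module.End ℂ S.dom))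
  · exact sum_comm_four _
  · refine Finset.sum_congr rfl fun a _ => Finset.sum_congr rfl fun b _ => ?_
    rw [key a b]
    simp only [Finset.sum_mul, smul_mul_assoc]

/-- The commutator of an expression of Wick type with a free field, through derivative operators. -/
theorem IsWickType.extend_comm_eq {n : ℕ} {E : S.Ensemble gr n r} (hE : S.IsWickType E) {d : ℕ}
    (v : Module.Basis (Fin d) ℂ (S.polar r)) {vs : Fin d → JetIdx N r → ℂ}
    (hv : ∀ i j, pair (v i).1 (vs j) = if i = j then (1 : ℂ) else 0) {P : Fin n → S.WickPoly gr r}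
    (hP : ∀ l U, S.Bosonic gr (P l U)) (w : S.Jet gr r) (f : Test n) (g : Test1) :
    S.extend E P f * S.superField w.1 g - S.superField w.1 g * S.extend E P f =
      ∑ l, ∑ j, S.mulDelta (S.extend E (Function.update P l (S.rho (v j).1 (P l)))) l
        (toG G (vs j)) w.1 g f := by
  rw [sum_mulDelta_rho E v hv hP, extend_comm E hP]
  simp only [hE.comm]

theorem bosonic_algebraMap (c : ℂ) : S.Bosonic gr (c • (1 : G)) := fun _ x _ =>
  (Commute.one_left x).smul_left c

variable [GradedAlgebra gr]

open scoped Classical in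
/-- The commutator of a Wick monomial with a free field. -/
theorem IsWickMonomials.comm (hG : S.IsGrassmann gr) {E : S.Ensemble gr 1 r}
    (hE : S.IsWickMonomials E) (W : S.Config gr 1 r) (w : S.Jet gr r) (f : Test 1) (g : Test1)
    (ψ χ : S.poly) :
    S.mel ψ χ (E W f * S.superField w.1 g - S.superField w.1 g * E W f) =
      S.mel ψ χ (W.map fun p => S.mulDelta (E (W.erase p)) p.1 p.2.1 w.1 g f).sum := by
  let I : Test 1 →ₗ[ℂ] G :=
    { toFun := fun f => (∫ x, f x) • (1 : G)
      map_add' := fun f f' => by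
        have : (MeasureTheory.volume : MeasureTheory.Measure (Fin 1 → Mink)).IsAddHaarMeasure :=
          MeasureTheory.Measure.pi.isAddHaarMeasure _
        have : (MeasureTheory.volume :
          MeasureTheory.Measure (Fin 1 → Mink)).HasTemperateGrowth := inferInstance
        rw [← add_smul, ← MeasureTheory.integral_add f.integrable f'.integrable]; rfl
      map_smul' := fun c f => by
        rw [RingHom.id_apply, smul_smul, ← MeasureTheory.integral_const_mul]; rfl }
  have hI : ∀ f, S.Bosonic gr (I f) := fun f => bosonic_algebraMap _
  have hm : ∀ W (ψ χ : S.poly) f, S.mel ψ χ (E W f) = S.mulNormal I (S.letters W) ψ χ f := by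
    intro W ψ χ f
    rw [hE W f ψ ψ.2 χ χ.2, mulNormal]
    refine Finset.sum_congr rfl fun a _ => ?_
    simp only [I, LinearMap.coe_mk, AddHom.coe_mk, smul_mul_assoc, one_mul]
    congr 1
    refine MeasureTheory.integral_congr_ae (Filter.Eventually.of_forall fun x => ?_)
    have ht := S.kerAt_hasTemperateGrowth
      (List.ofFn fun i => (a i, ((S.letters W).get i).1)) ψ χ
    rw [← kernel_comp_eq_kerAt] at ht
    simp only [SchwartzMap.smulLeftCLM_apply_apply ht, smul_eq_mul]
    ring
  have hO : ∀ b : JetIdx N r, _ := fun b => (S.isFieldLike_plusP b g).add (S.isFieldLike_minusP b g)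
  have h1 : ∀ b, S.mel ψ χ (E W f * w.1 b ⊗ₜ[ℂ] (S.jetPlus b g + S.jetMinus b g)) -
      S.mel ψ χ (w.1 b ⊗ₜ[ℂ] (S.jetPlus b g + S.jetMinus b g) * E W f) =
      (W.map fun p => ∑ a, S.mel ψ χ (E (W.erase p) (SchwartzMap.smulLeftCLM ℂ
        (fun x : Fin 1 → Mink => smear (S.jetD a b) g (x p.1)) f)) * (p.2.1 a * w.1 b)).sum := by
    intro b
    have h := mulNormal_comm hG hI (hO b) (w.2 b) W ψ χ f
    rw [mel_mul_tmul, mel_tmul_mul S (ψ' := ((S.plusAdj b g + S.minusAdj b g) ψ : S.poly))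
      (fun χ => by
        rw [LinearMap.add_apply, Submodule.coe_add, inner_add_left, S.inner_minusAdj,
          S.inner_plusAdj, LinearMap.add_apply, inner_add_right]), sub_eq_iff_eq_add', hm]
    refine Eq.trans (congrArg (· * w.1 b) (hm W ψ ((S.plusP b g + S.minusP b g) χ) f)) ?_
    rw [h]
    congr 2
    refine Multiset.map_congr rfl fun p _ => Finset.sum_congr rfl fun a _ => ?_
    rw [hm]
    congr 4
    funext x
    rw [smear_jetD]
    simp [add_comm]
  rw [map_sub, superField, Finset.mul_sum, Finset.sum_mul, map_sum, map_sum,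
    ← Finset.sum_sub_distrib, Finset.sum_congr rfl fun b _ => h1 b, map_multiset_sum,
    Multiset.map_map, ← Multiset.sum_map_sum]
  refine congrArg _ (Multiset.map_congr rfl fun p _ => ?_)
  rw [Function.comp_apply, mel_mulDelta, Finset.sum_comm]

/-- The commutator of a Wick polynomial with a free field, through derivative operators. -/
theorem IsWickMonomials.extend_comm_eq (hG : S.IsGrassmann gr) {E : S.Ensemble gr 1 r}
    (hE : S.IsWickMonomials E) {d : ℕ}
    (v : Module.Basis (Fin d) ℂ (S.polar r)) {vs : Fin d → JetIdx N r → ℂ}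
    (hv : ∀ i j, pair (v i).1 (vs j) = if i = j then (1 : ℂ) else 0) {P : S.WickPoly gr r}
    (hP : ∀ U, S.Bosonic gr (P U)) (w : S.Jet gr r) (f : Test 1) (g : Test1) (ψ χ : S.poly) :
    S.mel ψ χ (S.extend E (fun _ => P) f * S.superField w.1 g -
        S.superField w.1 g * S.extend E (fun _ => P) f) =
      ∑ j, S.mel ψ χ (S.mulDelta (S.extend E (fun _ => S.rho (v j).1 P)) 0
        (toG G (vs j)) w.1 g f) := by
  have h1 := sum_mulDelta_rho E v hv (P := fun _ => P) (fun _ => hP) w f g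
  have h2 : ∀ Q : S.WickPoly gr r, Function.update (fun _ : Fin 1 => P) 0 Q = fun _ => Q :=
    fun Q => funext fun i => by rw [Subsingleton.elim i 0, Function.update_self]
  simp only [Fin.sum_univ_one, h2] at h1
  rw [← map_sum, h1, extend_comm E (P := fun _ => P) fun _ => hP]
  have hT := fun Θ => polySum_map (S.mel (G := G) (ψ : S.dom) χ).toAddMonoidHom
    (fun _ : Fin 1 => P) Θ
  refine (hT _).trans (Eq.trans ?_ (hT _).symm)
  congr 1
  funext U c
  refine (mel_tmul_one S _ _ _ _).trans (Eq.trans ?_ (mel_tmul_one S _ _ _ _).symm)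
  rw [hE.comm hG]

end FreeFields

/-! ### Products over multisets of commuting elements -/

section Semiring

variable {α Q : Type*} [Semiring Q]

/-- The product of the elements `x u`, `u ∈ U`, which are meant to commute. -/
def mprod (x : α → Q) (U : Multiset α) : Q := (U.toList.map x).prod

theorem mprod_coe {x : α → Q} (hx : ∀ u u', Commute (x u) (x u')) (L : List α) :
    mprod x (L : Multiset α) = (L.map x).prod :=
  ((Multiset.coe_eq_coe.1 (Multiset.coe_toList (L : Multiset α))).map x).prod_eq' <|
    List.pairwise_map.2 (List.pairwise_of_forall fun u u' => hx u u')

theorem mprod_cons {x : α → Q} (hx : ∀ u u', Commute (x u) (x u')) (a : α) (U : Multiset α) :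
    mprod x (a ::ₘ U) = x a * mprod x U := by
  induction U using Quotient.inductionOn with
  | _ L =>
    refine (mprod_coe hx (a :: L)).trans ?_
    rw [List.map_cons, List.prod_cons]
    exact congrArg (x a * ·) (mprod_coe hx L).symm

theorem mprod_zero (x : α → Q) : mprod x 0 = 1 := by simp [mprod]

theorem commute_mprod {x : α → Q} {y : Q} (h : ∀ u, Commute y (x u)) (U : Multiset α) :
    Commute y (mprod x U) :=
  Commute.list_prod_right _ _ fun z hz => by
    obtain ⟨u, -, rfl⟩ := List.mem_map.1 hz
    exact h u

/-- The product of the sums `x u + M {u}`, `u ∈ U`, multiplied out. -/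
def expand (x : α → Q) (M : Multiset α → Q) (U : Multiset α) : Q :=
  (U.antidiagonal.map fun p => mprod x p.1 * M p.2).sum

/-- The terms of `expand x M U` that contain `k` factors `x u`. -/
def expandTerm (x : α → Q) (M : Multiset α → Q) (k : ℕ) (U : Multiset α) : Q :=
  (U.antidiagonal.map fun p => if p.1.card = k then mprod x p.1 * M p.2 else 0).sum

variable {x : α → Q} {M : Multiset α → Q}

theorem expandTerm_zero (U : Multiset α) : expandTerm x M 0 U = M U := by
  rw [expandTerm, sum_antidiagonal_eq]
  · simp [mprod_zero]
  · intro p hp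
    simp [hp]

open scoped Classical in
theorem sum_expandTerm_mul (hx : ∀ u u', Commute (x u) (x u')) (hM : ∀ u U, Commute (x u) (M U))
    (k : ℕ) (U : Multiset α) :
    (U.map fun u => expandTerm x M k (U.erase u) * x u).sum =
      (k + 1) • expandTerm x M (k + 1) U := by
  simp only [expandTerm, ← Multiset.sum_map_mul_right]
  rw [← sum_antidiagonal_fst U fun u p q => (if p.card = k then mprod x p * M q else 0) * x u,
    ← Multiset.sum_map_nsmul]
  refine congrArg _ (Multiset.map_congr rfl fun p _ => ?_)
  have h : (p.1.map fun u => (if (p.1.erase u).card = k then mprod x (p.1.erase u) * M p.2 else 0) *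
      x u) = p.1.map fun _ => if p.1.card = k + 1 then mprod x p.1 * M p.2 else 0 := by
    refine Multiset.map_congr rfl fun u hu => ?_
    have hc : (p.1.erase u).card + 1 = p.1.card := Multiset.card_erase_add_one hu
    by_cases hk : (p.1.erase u).card = k
    · rw [if_pos hk, if_pos (by omega)]
      conv_rhs => rw [← Multiset.cons_erase hu, mprod_cons hx]
      rw [mul_assoc, ← (hM u _).eq, ← mul_assoc, ← (commute_mprod (hx u) _).eq]
    · rw [if_neg hk, if_neg (by omega), zero_mul]
  rw [h, Multiset.map_const', Multiset.sum_replicate]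
  split_ifs with hk
  · rw [hk]
  · simp

theorem expand_eq_sum {U : Multiset α} {K : ℕ} (hK : U.card ≤ K) :
    expand x M U = ∑ k ∈ Finset.range (K + 1), expandTerm x M k U := by
  simp only [expand, expandTerm, ← Multiset.sum_map_sum]
  refine congrArg _ (Multiset.map_congr rfl fun p hp => ?_)
  rw [Finset.sum_ite_eq, if_pos]
  have h := congrArg Multiset.card (Multiset.mem_antidiagonal.1 hp)
  rw [Multiset.card_add] at h
  rw [Finset.mem_range]
  omega

theorem expand_cons (hx : ∀ u u', Commute (x u) (x u')) (hM : ∀ u U, Commute (x u) (M U))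
    (hadd : ∀ U U', M (U + U') = M U * M U') (a : α) (U : Multiset α) :
    expand x M (a ::ₘ U) = (x a + M {a}) * expand x M U := by
  have h : ∀ U, M (a ::ₘ U) = M {a} * M U := fun U => by
    rw [← Multiset.singleton_add, hadd]
  have hc : ∀ U, Commute (M {a}) (mprod x U) := fun U =>
    commute_mprod (fun u => (hM u _).symm) U
  simp only [expand, Multiset.antidiagonal_cons, Multiset.map_add, Multiset.sum_add,
    Multiset.map_map, Function.comp_def, Prod.map, id, mprod_cons hx, h, add_mul,
    ← Multiset.sum_map_mul_left, mul_assoc]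
  rw [add_comm, ← Multiset.sum_map_add]
  refine congrArg _ (Multiset.map_congr rfl fun p _ => ?_)
  rw [← mul_assoc (M {a}), (hc _).eq, mul_assoc (mprod x p.1)]

theorem expand_zero (h0 : M 0 = 1) : expand x M 0 = 1 := by
  simp [expand, mprod_zero, h0]

theorem expand_add (hx : ∀ u u', Commute (x u) (x u')) (hM : ∀ u U, Commute (x u) (M U))
    (hadd : ∀ U U', M (U + U') = M U * M U') (h0 : M 0 = 1) (U U' : Multiset α) :
    expand x M (U + U') = expand x M U * expand x M U' := by
  induction U using Multiset.induction_on with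
  | empty => rw [zero_add, expand_zero h0, one_mul]
  | cons a U ih => rw [Multiset.cons_add, expand_cons hx hM hadd, expand_cons hx hM hadd, ih,
      mul_assoc]

theorem expand_map {β : Type*} (e : β → α) (hx : ∀ u u', Commute (x u) (x u'))
    (hM : ∀ u U, Commute (x u) (M U))
    (hadd : ∀ U U', M (U + U') = M U * M U') (h0 : M 0 = 1) (U : Multiset β) :
    expand x M (U.map e) = expand (fun u => x (e u)) (fun U => M (U.map e)) U := by
  induction U using Multiset.induction_on with
  | empty => rw [Multiset.map_zero, expand_zero h0, expand_zero (by simpa using h0)]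
  | cons a U ih =>
    rw [Multiset.map_cons, expand_cons hx hM hadd, ih, expand_cons (fun _ _ => hx _ _)
      (fun _ _ => hM _ _) (fun U U' => by rw [Multiset.map_add, hadd]), Multiset.map_singleton]

theorem map_finsetSum_eq_prod_ofFn (h0 : M 0 = 1) (hadd : ∀ U U', M (U + U') = M U * M U') {m : ℕ}
    (W : Fin m → Multiset α) : M (∑ l, W l) = (List.ofFn fun l => M (W l)).prod := by
  induction m with
  | zero => simp [h0]
  | succ m ih => rw [Fin.sum_univ_succ, hadd, ih, List.ofFn_succ, List.prod_cons]

/-- The expansion of an ordered product of sums. -/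
theorem prod_ofFn_sum {β : Type*} [DecidableEq β] {m : ℕ} (T : Fin m → Finset β)
    (g : Fin m → β → Q) : (List.ofFn fun l => ∑ V ∈ T l, g l V).prod =
      ∑ V ∈ Fintype.piFinset T, (List.ofFn fun l => g l (V l)).prod := by
  induction m with
  | zero => simp
  | succ m ih =>
    rw [sum_piFinset_succ, List.ofFn_succ, List.prod_cons, ih, Finset.sum_mul_sum]
    simp [List.ofFn_succ]

theorem prod_ofFn_smul_mul [Algebra ℂ Q] {m : ℕ} (c : Fin m → ℂ) {s y : Fin m → Q}
    (h : ∀ l l', Commute (y l) (s l')) : (List.ofFn fun l => c l • (s l * y l)).prod =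
      (∏ l, c l) • ((List.ofFn s).prod * (List.ofFn y).prod) := by
  induction m with
  | zero => simp
  | succ m ih =>
    have hc : Commute (y 0) (List.ofFn fun l : Fin m => s l.succ).prod :=
      Commute.list_prod_right _ _ fun z hz => by
        obtain ⟨l, rfl⟩ := (List.mem_ofFn' _ _).1 hz
        exact h 0 l.succ
    simp only [List.ofFn_succ, List.prod_cons, ih (c := fun l => c l.succ) fun l l' => h l.succ l'.succ,
      Fin.prod_univ_succ, smul_mul_assoc, mul_smul_comm, smul_smul]
    rw [mul_assoc, ← mul_assoc (y 0), hc.eq]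
    simp only [mul_assoc, mul_comm (c 0)]

end Semiring

namespace FreeFields

variable {N r : ℕ} {F : Type*} [NormedAddCommGroup F] [InnerProductSpace ℂ F] [CompleteSpace F]
  {S : FreeFields N F} {G : Type*} [Ring G] [Algebra ℂ G] {gr : ℤ → Submodule ℂ G}

/-! ### The algebra of symbols of normal products -/

variable (S gr) in
/-- The families of numbers `K(bs, W, g)` that behave like the matrix elements of
`⟨Ω, E(W) Ω⟩ N(∂φ^{b₁}(x_{l₁}), …) g`: they are linear in `g`, graded symmetric in the list
`bs = (b₁, l₁), …`, and they vanish on the mass-shell with respect to each of the indices, which is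
expressed through the projection `∑ v_j ⊗ v_j^*`. -/
def symbols (n : ℕ) {d : ℕ} (v vs : Fin d → JetIdx N r → ℂ) :
    Submodule ℂ (List (JetIdx N r × Fin n) → S.Config gr n r → G →ₗ[ℂ] G) where
  carrier := {K | (∀ pre a b post W, K (pre ++ a :: b :: post) W =
      sgn (S.z a.1.1 * S.z b.1.1) • K (pre ++ b :: a :: post) W) ∧
    ∀ pre a l post W, K (pre ++ (a, l) :: post) W =
      ∑ j, ∑ b, (v j a * vs j b) • K (pre ++ (b, l) :: post) W}
  zero_mem' := ⟨by simp, by simp⟩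
  add_mem' := by
    intro K K' hK hK'
    refine ⟨fun pre a b post W => ?_, fun pre a l post W => ?_⟩
    · simp only [Pi.add_apply, smul_add]
      rw [hK.1, hK'.1]
    · simp only [Pi.add_apply, smul_add, Finset.sum_add_distrib]
      rw [hK.2, hK'.2]
  smul_mem' := by
    intro c K hK
    refine ⟨fun pre a b post W => ?_, fun pre a l post W => ?_⟩
    · simp only [Pi.smul_apply]
      rw [hK.1, smul_comm]
    · simp only [Pi.smul_apply, smul_comm _ c, ← Finset.smul_sum]
      rw [hK.2]

variable {n d : ℕ} {v vs : Fin d → JetIdx N r → ℂ}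

variable (S gr n v vs) in
/-- The algebra of operators on symbols. -/
abbrev SymbolOp : Type _ := Module.End ℂ (S.symbols gr n v vs)

/-- The operator on symbols that appends a factor to the normal product. -/
def opX (b : JetIdx N r × Fin n) : SymbolOp S gr n v vs where
  toFun K := ⟨fun bs W => K.1 (bs ++ [b]) W, by
    refine ⟨fun pre a b' post W => ?_, fun pre a l post W => ?_⟩
    · simpa using K.2.1 pre a b' (post ++ [b]) W
    · simpa using K.2.2 pre a l (post ++ [b]) W⟩
  map_add' _ _ := rfl
  map_smul' _ _ := rfl

/-- The operator on symbols that adds letters to the expression in the vacuum expectation value. -/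
def opM (W : S.Config gr n r) : SymbolOp S gr n v vs where
  toFun K := ⟨fun bs W' => K.1 bs (W' + W), fun pre a b post _ => K.2.1 pre a b post _,
    fun pre a l post _ => K.2.2 pre a l post _⟩
  map_add' _ _ := rfl
  map_smul' _ _ := rfl

/-- The operator on symbols that multiplies by a coefficient from the right. -/
def opC (c : G) : SymbolOp S gr n v vs where
  toFun K := ⟨fun bs W => K.1 bs W ∘ₗ LinearMap.mulRight ℂ c, by
    refine ⟨fun pre a b post W => ?_, fun pre a l post W => ?_⟩
    · dsimp only
      rw [K.2.1, LinearMap.smul_comp]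
    · dsimp only
      rw [K.2.2]
      ext g
      simp [LinearMap.sum_apply]⟩
  map_add' _ _ := rfl
  map_smul' _ _ := rfl

@[simp]
theorem opX_apply (b : JetIdx N r × Fin n) (K : S.symbols gr n v vs)
    (bs : List (JetIdx N r × Fin n)) (W : S.Config gr n r) (g : G) :
    (opX b K).1 bs W g = K.1 (bs ++ [b]) W g := rfl

@[simp]
theorem opM_apply (W' : S.Config gr n r) (K : S.symbols gr n v vs)
    (bs : List (JetIdx N r × Fin n)) (W : S.Config gr n r) (g : G) :
    (opM W' K).1 bs W g = K.1 bs (W + W') g := rfl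

@[simp]
theorem opC_apply (c : G) (K : S.symbols gr n v vs)
    (bs : List (JetIdx N r × Fin n)) (W : S.Config gr n r) (g : G) :
    (opC c K).1 bs W g = K.1 bs W (g * c) := rfl

theorem symbols_ext {A B : SymbolOp S gr n v vs}
    (h : ∀ K bs W g, (A K).1 bs W g = (B K).1 bs W g) : A = B :=
  LinearMap.ext fun K => Subtype.ext <| funext fun bs => funext fun W => LinearMap.ext (h K bs W)

theorem opM_zero : (opM 0 : SymbolOp S gr n v vs) = 1 :=
  symbols_ext fun K bs W g => by simp

theorem opM_add (W W' : S.Config gr n r) :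
    (opM (W + W') : SymbolOp S gr n v vs) = opM W * opM W' :=
  symbols_ext fun K bs W'' g => by simp [add_assoc]

theorem opC_one : (opC 1 : SymbolOp S gr n v vs) = 1 :=
  symbols_ext fun K bs W g => by simp

theorem opC_mul (c c' : G) :
    (opC (c * c') : SymbolOp S gr n v vs) = opC c * opC c' :=
  symbols_ext fun K bs W g => by simp [mul_assoc]

theorem opC_add (c c' : G) :
    (opC (c + c') : SymbolOp S gr n v vs) = opC c + opC c' :=
  symbols_ext fun K bs W g => by simp [mul_add]

theorem opC_smul (a : ℂ) (c : G) :
    (opC (a • c) : SymbolOp S gr n v vs) = a • (opC c : SymbolOp S gr n v vs) :=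
  symbols_ext fun K bs W g => by simp

variable (S gr n v vs) in
/-- `opC` as a linear map. -/
def opCₗ : G →ₗ[ℂ] SymbolOp S gr n v vs where
  toFun := opC
  map_add' := opC_add
  map_smul' := opC_smul

theorem commute_opX_opM (b : JetIdx N r × Fin n) (W : S.Config gr n r) :
    Commute (opX b : SymbolOp S gr n v vs) (opM W) :=
  symbols_ext fun K bs W g => by simp

theorem commute_opX_opC (b : JetIdx N r × Fin n) (c : G) :
    Commute (opX b : SymbolOp S gr n v vs) (opC c) :=
  symbols_ext fun K bs W g => by simp

theorem commute_opM_opC (W : S.Config gr n r) (c : G) :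
    Commute (opM W : SymbolOp S gr n v vs) (opC c) :=
  symbols_ext fun K bs W g => by simp

theorem opX_mul_opX (a b : JetIdx N r × Fin n) :
    (opX a * opX b : SymbolOp S gr n v vs) =
      sgn (S.z a.1.1 * S.z b.1.1) • (opX b * opX a) :=
  symbols_ext fun K bs W g => by
    have h := LinearMap.congr_fun (K.2.1 bs a b [] W) g
    simpa using h

theorem opX_eq_sum (a : JetIdx N r) (l : Fin n) :
    (opX (a, l) : SymbolOp S gr n v vs) =
      ∑ j, ∑ b, (v j a * vs j b) • opX (b, l) :=
  symbols_ext fun K bs W g => by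
    have h := LinearMap.congr_fun (K.2.2 bs a l [] W) g
    simp only [LinearMap.sum_apply, LinearMap.smul_apply] at h
    simpa [LinearMap.sum_apply, Finset.sum_apply] using h

/-- The operator on symbols that appends a factor `φ_u(x_l)` to the normal product. -/
def opLetter (p : Fin n × (JetIdx N r → G)) : SymbolOp S gr n v vs :=
  ∑ a, opX (a, p.1) * opC (p.2 a)

theorem prod_opLetter_apply (L : List (Fin n × (JetIdx N r → G))) (K : S.symbols gr n v vs)
    (bs : List (JetIdx N r × Fin n)) (W : S.Config gr n r) (g : G) :
    ((L.map opLetter).prod K).1 bs W g = csum L fun bs' g' => K.1 (bs ++ bs') W (g * g') := by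
  induction L generalizing bs g with
  | nil => simp [csum]
  | cons p L ih =>
    simp only [List.map_cons, List.prod_cons, opLetter, Finset.sum_mul, csum]
    simp only [LinearMap.sum_apply, Finset.sum_apply, AddSubmonoidClass.coe_finsetSum,
      Module.End.mul_apply, opX_apply, opC_apply]
    refine Finset.sum_congr rfl fun a _ => ?_
    have := ih (bs ++ [(a, p.1)]) (g * p.2 a)
    simpa [mul_assoc] using this

theorem commute_opLetter_opM (p : Fin n × (JetIdx N r → G)) (W : S.Config gr n r) :
    Commute (opLetter p : SymbolOp S gr n v vs) (opM W) :=
  Commute.sum_left _ _ _ fun _ _ => (commute_opX_opM _ _).mul_left (commute_opM_opC _ _).symm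

theorem commute_opLetter_opC {p : Fin n × (JetIdx N r → G)} {c : G} (h : ∀ a, Commute (p.2 a) c) :
    Commute (opLetter p : SymbolOp S gr n v vs) (opC c) :=
  Commute.sum_left _ _ _ fun a _ => (commute_opX_opC _ _).mul_left <| by
    rw [Commute, SemiconjBy, ← opC_mul, ← opC_mul, (h a).eq]

theorem opX_mul_opC_mul (x y : JetIdx N r × Fin n) (c c' : G) :
    (opX x * opC c * (opX y * opC c') : SymbolOp S gr n v vs) = opX x * opX y * opC (c * c') :=
  symbols_ext fun K bs W g => by simp [mul_assoc]

/-- The super-commutation relations of the components make the letters commute. -/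
theorem commute_opLetter [GradedAlgebra gr] (hG : S.IsGrassmann gr) (p q : Fin n × S.Jet gr r) :
    Commute (opLetter (p.1, p.2.1) : SymbolOp S gr n v vs)
      (opLetter (q.1, q.2.1)) := by
  simp only [Commute, SemiconjBy, opLetter, Finset.sum_mul_sum]
  rw [Finset.sum_comm]
  refine Finset.sum_congr rfl fun b _ => Finset.sum_congr rfl fun a _ => ?_
  rw [opX_mul_opC_mul, opX_mul_opC_mul, opX_mul_opX, hG.graded_comm _ _ _ (p.2.2 a) _ (q.2.2 b), opC_smul]
  rw [smul_mul_assoc, mul_smul_comm, smul_smul, sgn_mul_self, one_smul]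

/-- On symbols, a letter is a combination of the letters `v_j^*`, with the coefficients
`⟨v_j, u⟩`. -/
theorem opLetter_eq_sum (l : Fin n) (u : JetIdx N r → G) :
    (opLetter (l, u) : SymbolOp S gr n v vs) =
      ∑ j, opLetter (l, toG G (vs j)) * opC (pair (v j) u) := by
  have h1 : ∀ j, (opLetter (l, toG G (vs j)) : SymbolOp S gr n v vs) =
      ∑ b, vs j b • (opX (b, l) : SymbolOp S gr n v vs) := fun j => Finset.sum_congr rfl fun b _ => by
    dsimp only [toG]
    rw [Algebra.algebraMap_eq_smul_one, opC_smul, opC_one]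
    rw [mul_smul_comm, mul_one]
  have h2 : ∀ j, (opC (pair (v j) u) : SymbolOp S gr n v vs) =
      ∑ a, v j a • (opC (u a) : SymbolOp S gr n v vs) := fun j => by
    have := map_sum (opCₗ S gr n v vs) (fun a => v j a • u a) Finset.univ
    simp only [map_smul] at this
    exact this
  simp only [h1, h2, Finset.sum_mul_sum, smul_mul_smul_comm]
  rw [opLetter, Finset.sum_congr rfl fun a _ => by rw [opX_eq_sum a l]]
  simp only [Finset.sum_mul, smul_mul_assoc]
  rw [Finset.sum_comm]
  refine Finset.sum_congr rfl fun j _ => ?_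
  rw [Finset.sum_comm]
  simp only [mul_comm (v j _)]

end FreeFields

namespace FreeFields

variable {N r : ℕ} {F : Type*} [NormedAddCommGroup F] [InnerProductSpace ℂ F] [CompleteSpace F]
  {S : FreeFields N F} {G : Type*} [Ring G] [Algebra ℂ G] {gr : ℤ → Submodule ℂ G}
  {n d : ℕ} {v vs : Fin d → JetIdx N r → ℂ}

/-! ### The Taylor expansion of Wick polynomials -/

variable (gr v vs) in
/-- The operator on symbols that appends the letter `u` at the point `x_l` to the normal product. -/
def letterAt (l : Fin n) (u : S.Jet gr r) : SymbolOp S gr n v vs := opLetter (l, u.1)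

variable (gr v vs) in
/-- The operator on symbols that inserts `W_U(x_l)` into the vacuum expectation value. -/
def insertAt (l : Fin n) (U : Multiset (S.Jet gr r)) : SymbolOp S gr n v vs :=
  opM (U.map fun u => (l, u))

variable (v vs) in
/-- The operator on symbols that inserts the Wick polynomial `P(x_l)` into the vacuum expectation
value. -/
def opPoly (l : Fin n) (P : S.WickPoly gr r) : SymbolOp S gr n v vs :=
  P.sum fun U c => insertAt gr v vs l U * opC c

theorem commute_dual_opC (l : Fin n) (j : Fin d) (c : G) :
    Commute (opLetter (l, toG G (vs j)) : SymbolOp S gr n v vs) (opC c) :=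
  commute_opLetter_opC fun a => Algebra.commutes (vs j a) c

theorem commute_dual_opPoly (l l' : Fin n) (j : Fin d) (P : S.WickPoly gr r) :
    Commute (opLetter (l', toG G (vs j)) : SymbolOp S gr n v vs) (opPoly v vs l P) :=
  Commute.sum_right _ _ _ fun _ _ => (commute_opLetter_opM _ _).mul_right (commute_dual_opC _ _ _)

theorem rhoSeq_append_singleton (V : List (Fin d)) (j : Fin d) (P : S.WickPoly gr r) :
    S.rhoSeq v (V ++ [j]) P = S.rhoSeq v V (S.rho (v j) P) := by
  simp [rhoSeq]

/-- The product of the letters `v^*` at the point `x_l`, for a sequence of elements of the basis. -/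
def dualProd (l : Fin n) (V : List (Fin d)) : SymbolOp S gr n v vs :=
  (V.map fun j => opLetter (l, toG G (vs j))).prod

/-- The terms of order `k` of the Taylor expansion: both sides are the sum over all the ways to
move `k` letters of `P` from the vacuum expectation value to the normal product, one after the
other. -/
theorem sum_dualProd_mul_opPoly [GradedAlgebra gr] (hG : S.IsGrassmann gr) (l : Fin n) (k : ℕ)
    (P : S.WickPoly gr r) :
    ∑ V : Fin k → Fin d, dualProd l (List.ofFn V) * opPoly v vs l (S.rhoSeq v (List.ofFn V) P) =
      P.sum fun U c => k.factorial •
        expandTerm (letterAt gr v vs l) (insertAt gr v vs l) k U *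
          (opC c : SymbolOp S gr n v vs) := by
  classical
  induction k generalizing P with
  | zero =>
    simp [dualProd, rhoSeq, opPoly, expandTerm_zero]
  | succ k ih =>
    rw [← (Fin.snocEquiv fun _ : Fin (k + 1) => Fin d).sum_comp, Fintype.sum_prod_type]
    have h1 : ∀ (j : Fin d) (V : Fin k → Fin d),
        List.ofFn (Fin.snocEquiv (fun _ : Fin (k + 1) => Fin d) (j, V)) = List.ofFn V ++ [j] := by
      intro j V
      rw [List.ofFn_succ', List.concat_eq_append]
      simp [Fin.snocEquiv]
    have h2 : ∀ (j : Fin d) (V : List (Fin d)) (Q : S.WickPoly gr r),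
        dualProd l (V ++ [j]) * opPoly v vs l Q =
          dualProd l V * opPoly v vs l Q * opLetter (l, toG G (vs j)) := by
      intro j V Q
      rw [dualProd, List.map_append, List.prod_append, List.map_singleton, List.prod_singleton,
        mul_assoc, (commute_dual_opPoly l l j Q).eq, ← mul_assoc, dualProd]
    simp only [h1, h2, rhoSeq_append_singleton, ← Finset.sum_mul, ih]
    have h3 : ∀ j, ((S.rho (v j) P).sum fun U c => k.factorial •
        expandTerm (letterAt gr v vs l) (insertAt gr v vs l) k U * (opC c : SymbolOp S gr n v vs)) =
        P.sum fun U c => (U.map fun u => k.factorial •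
          expandTerm (letterAt gr v vs l) (insertAt gr v vs l) k (U.erase u) *
            (opC (pair (v j) u.1 * c) : SymbolOp S gr n v vs)).sum := fun j =>
      rho_sum (v j) P fun U => (AddMonoidHom.mulLeft (k.factorial •
        expandTerm (letterAt gr v vs l) (insertAt gr v vs l) k U)).comp (opCₗ S gr n v vs).toAddMonoidHom
    simp only [h3]
    simp only [Finsupp.sum, Finset.sum_mul]
    rw [Finset.sum_comm]
    refine Finset.sum_congr rfl fun U _ => ?_
    have hx := sum_expandTerm_mul (x := letterAt gr v vs l) (M := insertAt gr v vs l)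
      (fun u u' => commute_opLetter hG (l, u) (l, u')) (fun u U => commute_opLetter_opM _ _) k U
    rw [Nat.factorial_succ, mul_comm, mul_smul, ← hx]
    simp only [← Multiset.sum_map_mul_right, ← Multiset.sum_map_nsmul, ← Multiset.sum_map_sum]
    refine congrArg _ (Multiset.map_congr rfl fun u _ => ?_)
    rw [letterAt, opLetter_eq_sum l u.1]
    simp only [Finset.mul_sum, Finset.sum_mul, Finset.smul_sum]
    refine Finset.sum_congr rfl fun j _ => ?_
    rw [opC_mul]
    simp only [smul_mul_assoc, mul_assoc]
    rw [← (commute_dual_opC l j _).eq, ← mul_assoc (opC _), ← (commute_dual_opC l j _).eq,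
      mul_assoc]

/-- The sequences of length at most `K`. -/
def seqs (d K : ℕ) : Finset (List (Fin d)) :=
  ((Finset.range (K + 1)).sigma fun _ => Finset.univ).map
    List.equivSigmaTuple.symm.toEmbedding

theorem mem_seqs {K : ℕ} {V : List (Fin d)} : V ∈ seqs d K ↔ V.length ≤ K := by
  rw [seqs, Finset.mem_map_equiv]
  simp [List.equivSigmaTuple]

theorem sum_seqs {X : Type*} [AddCommMonoid X] (K : ℕ) (Φ : List (Fin d) → X) :
    ∑ V ∈ seqs d K, Φ V = ∑ k ∈ Finset.range (K + 1), ∑ V : Fin k → Fin d, Φ (List.ofFn V) := by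
  rw [seqs, Finset.sum_map, Finset.sum_sigma]
  rfl

/-- The Taylor expansion of a Wick polynomial. -/
theorem sum_expand_eq [GradedAlgebra gr] (hG : S.IsGrassmann gr) (l : Fin n) {K : ℕ}
    {P : S.WickPoly gr r} (hK : ∀ U ∈ P.support, U.card ≤ K) :
    (P.sum fun U c => expand (letterAt gr v vs l) (insertAt gr v vs l) U * (opC c : SymbolOp S gr n v vs)) =
      ∑ V ∈ seqs d K, ((V.length.factorial : ℂ))⁻¹ •
        (dualProd l V * opPoly v vs l (S.rhoSeq v V P)) := by
  rw [sum_seqs]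
  simp only [List.length_ofFn, ← Finset.smul_sum, sum_dualProd_mul_opPoly hG, Finsupp.sum]
  simp only [Finset.smul_sum]
  rw [Finset.sum_comm]
  refine Finset.sum_congr rfl fun U hU => ?_
  rw [expand_eq_sum (hK U hU), Finset.sum_mul]
  refine Finset.sum_congr rfl fun k _ => ?_
  rw [smul_mul_assoc, ← Nat.cast_smul_eq_nsmul ℂ, smul_smul,
    inv_mul_cancel₀ (Nat.cast_ne_zero.2 k.factorial_ne_zero), one_smul]

/-- An ordered product of Wick polynomials, multiplied out. -/
theorem prod_ofFn_sum_opC {m : ℕ} (P : Fin m → S.WickPoly gr r)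
    (f : Fin m → Multiset (S.Jet gr r) → SymbolOp S gr n v vs)
    (hf : ∀ l U l' U', Commute (opC (P l U)) (f l' U')) :
    (List.ofFn fun l => (P l).sum fun U c => f l U * opC c).prod =
      polySum P fun U c => (List.ofFn fun l => f l (U l)).prod * opC c := by
  induction m with
  | zero => rw [polySum_zero]; simp [opC_one]
  | succ m ih =>
    rw [List.ofFn_succ, List.prod_cons, ih _ _ fun l U l' U' => hf l.succ U l'.succ U', polySum_succ,
      Finsupp.sum, Finset.sum_mul]
    refine Finset.sum_congr rfl fun U _ => ?_
    refine (polySum_map (AddMonoidHom.mulLeft (f 0 U * opC (P 0 U))) _ _).trans ?_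
    refine Finset.sum_congr rfl fun U' _ => ?_
    have hc : Commute (opC (P 0 U)) (List.ofFn fun l : Fin m => f l.succ (U' l)).prod :=
      Commute.list_prod_right _ _ fun z hz => by
        obtain ⟨l, rfl⟩ := (List.mem_ofFn' _ _).1 hz
        exact hf 0 U l.succ (U' l)
    simp only [AddMonoidHom.coe_mulLeft, List.ofFn_succ, List.prod_cons, opC_mul, Fin.cons_zero,
      Fin.cons_succ]
    exact hc.mul_mul_mul_comm _ _

end FreeFields

namespace FreeFields

variable {N r : ℕ} {F : Type*} [NormedAddCommGroup F] [InnerProductSpace ℂ F] [CompleteSpace F]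
  {S : FreeFields N F} {G : Type*} [Ring G] [Algebra ℂ G] {gr : ℤ → Submodule ℂ G}
  {n d : ℕ} {v vs : Fin d → JetIdx N r → ℂ}

theorem card_lt_of_mem_support_rho {v : JetIdx N r → ℂ} {P : S.WickPoly gr r} {K : ℕ}
    (hP : ∀ U ∈ P.support, U.card < K + 1) : ∀ U ∈ (S.rho v P).support, U.card < K := by
  classical
  intro U hU
  by_contra hK
  refine Finsupp.mem_support_iff.1 hU ?_
  rw [rho, Finsupp.sum, Finsupp.finsetSum_apply]
  refine Finset.sum_eq_zero fun U' hU' => ?_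
  rw [← Finsupp.applyAddHom_apply, map_multiset_sum, Multiset.map_map]
  refine Multiset.sum_eq_zero fun x hx => ?_
  obtain ⟨u, hu, rfl⟩ := Multiset.mem_map.1 hx
  rw [Function.comp_apply, Finsupp.applyAddHom_apply, Finsupp.single_apply, if_neg]
  rintro rfl
  have h1 := hP U' hU'
  have h2 := Multiset.card_erase_add_one hu
  omega

theorem rhoSeq_eq_zero {V : List (Fin d)} {P : S.WickPoly gr r}
    (hP : ∀ U ∈ P.support, U.card < V.length) : S.rhoSeq v V P = 0 := by
  have h : ∀ (V : List (Fin d)) (K : ℕ), (∀ U ∈ P.support, U.card < K + V.length) →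
      ∀ U ∈ (S.rhoSeq v V P).support, U.card < K := by
    intro V
    induction V with
    | nil => exact fun K h => h
    | cons j V ih =>
      intro K h
      refine card_lt_of_mem_support_rho (ih (K + 1) fun U hU => ?_)
      have := h U hU
      rw [List.length_cons] at this
      omega
  refine Finsupp.support_eq_empty.1 (Finset.eq_empty_of_forall_notMem fun U hU => ?_)
  exact Nat.not_lt_zero _ (h V 0 (fun U hU => by simpa using hP U hU) U hU)

theorem extend_eq_zero (E : S.Ensemble gr n r) {P : Fin n → S.WickPoly gr r} {l : Fin n}
    (h : P l = 0) : S.extend E P = 0 := by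
  refine Finset.sum_eq_zero fun U hU => ?_
  have := Fintype.mem_piFinset.1 hU l
  simp [h] at this

/-- The symbol of the matrix elements of an expression of Wick type. -/
def wickSymbol (E : S.Ensemble gr n r) (v : Module.Basis (Fin d) ℂ (S.polar r))
    (hv : ∀ i j, pair (v i).1 (vs j) = if i = j then (1 : ℂ) else 0) (ψ χ : S.poly) (f : Test n) :
    S.symbols gr n (fun j => (v j).1) vs :=
  ⟨fun bs W => LinearMap.mulLeft ℂ (S.vev (E W) (SchwartzMap.smulLeftCLM ℂ (S.kerAt bs ψ χ) f)), by
    refine ⟨fun pre a b post W => ?_, fun pre a l post W => ?_⟩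
    · dsimp only
      rw [S.kerAt_swap, SchwartzMap.smulLeftCLM_smul (S.kerAt_hasTemperateGrowth _ _ _), smul_apply,
        map_smul]
      ext g
      simp
    · have : SchwartzMap.smulLeftCLM ℂ (S.kerAt (n := n) (pre ++ (a, l) :: post) ψ χ) f =
          ∑ j, ∑ b, ((v j).1 a * vs j b) •
            SchwartzMap.smulLeftCLM ℂ (S.kerAt (n := n) (pre ++ (b, l) :: post) ψ χ) f := by
        ext x
        simp only [sum_apply, smul_apply, smul_eq_mul,
          SchwartzMap.smulLeftCLM_apply_apply (S.kerAt_hasTemperateGrowth _ _ _)]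
        have h := fun a => apply_eq_sum_of_mem_polar v hv
          (S.kerL_mem_polar (atPts x pre) (atPts x post) (x l) ψ χ) a
        have e : ∀ b, S.kerAt (pre ++ (b, l) :: post) ψ χ x =
            S.kerL (atPts x pre ++ (b, x l) :: atPts x post) ψ χ := fun b => by
          simp [kerAt, atPts]
        simp only [e]
        rw [h a]
        simp only [Finset.sum_mul, mul_assoc]
      dsimp only
      rw [this]
      ext g
      simp only [map_sum, map_smul, LinearMap.sum_apply, LinearMap.smul_apply,
        LinearMap.mulLeft_apply, Finset.sum_mul, smul_mul_assoc]⟩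

/-- The value of an operator on symbols on a given symbol. -/
def symbolEval (K : S.symbols gr n v vs) : SymbolOp S gr n v vs →ₗ[ℂ] G where
  toFun A := (A K).1 [] 0 1
  map_add' _ _ := rfl
  map_smul' _ _ := rfl

theorem symbolEval_apply (K : S.symbols gr n v vs) (A : SymbolOp S gr n v vs) :
    symbolEval K A = (A K).1 [] 0 1 := rfl

theorem symbolEval_prod_opLetter (K : S.symbols gr n v vs) (L : List (Fin n × (JetIdx N r → G)))
    (W : S.Config gr n r) (c : G) :
    symbolEval K ((L.map opLetter).prod * (opM W * opC c)) =
      csum L fun bs g => K.1 bs W (g * c) := by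
  rw [symbolEval_apply, Module.End.mul_apply, prod_opLetter_apply]
  simp

variable (gr v vs) in
/-- The operator on symbols that appends a letter to the normal product. -/
def letterOp (p : Fin n × S.Jet gr r) : SymbolOp S gr n v vs := opLetter (p.1, p.2.1)

/-- The Taylor expansions at the points `x₁, …, xₙ`, multiplied with each other. The order of the
factors does not matter, since the letters commute and the coefficients are bosonic. -/
theorem polySum_wickExpansion [GradedAlgebra gr] (hG : S.IsGrassmann gr)
    {P : Fin n → S.WickPoly gr r} (hP : ∀ l U, S.Bosonic gr (P l U)) {K : ℕ}
    (hK : ∀ l, ∀ U ∈ (P l).support, U.card ≤ K) :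
    polySum P (fun U c => expand (letterOp gr v vs) opM (S.config U) *
        (opC c : SymbolOp S gr n v vs)) =
      ∑ V ∈ Fintype.piFinset fun _ : Fin n => seqs d K, (∏ l, ((V l).length.factorial : ℂ)⁻¹) •
        (((dualLetters G vs V).map opLetter).prod *
          polySum (fun l => S.rhoSeq v (V l) (P l)) fun U c => opM (S.config U) * opC c) := by
  classical
  have hx : ∀ p q : Fin n × S.Jet gr r,
    Commute (letterOp gr v vs p) (letterOp gr v vs q) := commute_opLetter hG
  have hM : ∀ (p : Fin n × S.Jet gr r) (U : S.Config gr n r),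
    Commute (letterOp gr v vs p) (opM U) := fun p U => commute_opLetter_opM _ U
  have h1 : ∀ U : Fin n → Multiset (S.Jet gr r), expand (letterOp gr v vs) opM (S.config U) =
      (List.ofFn fun l => expand (letterAt gr v vs l) (insertAt gr v vs l) (U l)).prod := by
    intro U
    refine (map_finsetSum_eq_prod_ofFn (expand_zero opM_zero)
      (expand_add hx hM opM_add opM_zero) _).trans ?_
    congr 2
    funext l
    exact expand_map _ hx hM opM_add opM_zero _
  have h2 : ∀ U : Fin n → Multiset (S.Jet gr r), (opM (S.config U) : SymbolOp S gr n v vs) =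
      (List.ofFn fun l => insertAt gr v vs l (U l)).prod := fun U =>
    map_finsetSum_eq_prod_ofFn opM_zero opM_add _
  simp only [h1, h2]
  rw [← prod_ofFn_sum_opC P fun l U => expand (letterAt gr v vs l) (insertAt gr v vs l) U]
  · simp only [fun l => sum_expand_eq (v := v) (vs := vs) hG l (hK l)]
    rw [prod_ofFn_sum]
    refine Finset.sum_congr rfl fun V _ => ?_
    rw [prod_ofFn_smul_mul (fun l => ((V l).length.factorial : ℂ)⁻¹)]
    · rw [← prod_ofFn_sum_opC (fun l => S.rhoSeq v (V l) (P l)) (insertAt gr v vs)]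
      · congr 2
        rw [dualLetters, List.map_flatten, List.prod_flatten, List.map_map, List.map_ofFn]
        congr 2
        funext l
        simp [dualProd, Function.comp_def]
      · exact fun l U l' U' => (commute_opM_opC _ _).symm
    · intro l l'
      refine Commute.list_prod_right _ _ fun z hz => ?_
      obtain ⟨j, -, rfl⟩ := List.mem_map.1 hz
      exact (commute_dual_opPoly _ _ _ _).symm
  · intro l U l' U'
    refine Multiset.sum_induction (fun z => Commute (opC (P l U)) z) _
      (fun _ _ => Commute.add_right) (Commute.zero_right _) fun z hz => ?_
    obtain ⟨p, -, rfl⟩ := Multiset.mem_map.1 hz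
    refine (commute_mprod (fun u => ?_) _).mul_right (commute_opM_opC _ _).symm
    exact (commute_opLetter_opC fun a => (hP l U a.1 _ (u.2 a)).symm).symm

/-- The Wick expansion through derivative operators. -/
theorem IsWickType.mel_extend_eq [GradedAlgebra gr] (hG : S.IsGrassmann gr)
    {E : S.Ensemble gr n r} (hE : S.IsWickType E) (v : Module.Basis (Fin d) ℂ (S.polar r))
    (hv : ∀ i j, pair (v i).1 (vs j) = if i = j then (1 : ℂ) else 0) {P : Fin n → S.WickPoly gr r}
    (hP : ∀ l U, S.Bosonic gr (P l U)) (f : Test n) (ψ χ : S.poly) :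
    S.mel ψ χ (S.extend E P f) =
      ∑ᶠ V : Fin n → List (Fin d), (∏ l, (((V l).length.factorial : ℂ))⁻¹) •
        S.mulNormal (S.vev (S.extend E fun l => S.rhoSeq (fun j => (v j).1) (V l) (P l)))
          (dualLetters G vs V) ψ χ f := by
  classical
  let K := Finset.univ.sup fun l => (P l).support.sup Multiset.card
  have hK : ∀ l, ∀ U ∈ (P l).support, U.card ≤ K := fun l U hU =>
    (Finset.le_sup (f := Multiset.card) hU).trans
      (Finset.le_sup (f := fun l => (P l).support.sup Multiset.card) (Finset.mem_univ l))
  rw [finsum_eq_sum_of_support_subset (s := Fintype.piFinset fun _ : Fin n => seqs d K)]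
  swap
  · intro V hV
    by_contra h
    rw [Finset.mem_coe, Fintype.mem_piFinset, not_forall] at h
    obtain ⟨l, hl⟩ := h
    rw [mem_seqs, not_le] at hl
    have h0 := rhoSeq_eq_zero (v := fun j => (v j).1) (V := V l) (P := P l) fun U hU =>
      (hK l U hU).trans_lt hl
    refine hV ?_
    dsimp only
    rw [extend_eq_zero E (P := fun l => S.rhoSeq (fun j => (v j).1) (V l) (P l)) h0]
    simp [mulNormal, vev]
  let ev := symbolEval (wickSymbol E v hv ψ χ f)
  have h1 : S.mel ψ χ (S.extend E P f) = ev (polySum P fun U c =>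
      expand (letterOp gr (fun j => (v j).1) vs) opM (S.config U) * opC c) := by
    rw [extend_apply]
    refine (polySum_map (S.mel (G := G) (ψ : S.dom) χ).toAddMonoidHom P _).trans ?_
    refine Eq.trans ?_ (polySum_map ev.toAddMonoidHom P _).symm
    congr 1
    funext U c
    refine (S.mel_tmul_one _ _ _ _).trans ?_
    rw [mel_eq_wickSum hG hE, wickSum, ← Multiset.sum_map_mul_right, expand,
      ← Multiset.sum_map_mul_right]
    refine Eq.trans ?_ (map_multiset_sum ev _).symm
    rw [Multiset.map_map]
    refine congrArg _ (Multiset.map_congr rfl fun p _ => ?_)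
    have h : mprod (letterOp gr (fun j => (v j).1) vs) p.1 =
        ((S.letters p.1).map opLetter).prod := by
      rw [mprod, letters, List.map_map]
      rfl
    rw [Function.comp_apply, h, mul_assoc, symbolEval_prod_opLetter, mulNormal_eq_csum, csum_mul]
    simp only [mul_assoc]
    rfl
  rw [h1, polySum_wickExpansion hG hP hK, map_sum]
  refine Finset.sum_congr rfl fun V _ => ?_
  rw [map_smul]
  congr 1
  have h2 := polySum_map ((ev.toAddMonoidHom).comp
    (AddMonoidHom.mulLeft ((dualLetters G vs V).map opLetter).prod))
    (fun l => S.rhoSeq (fun j => (v j).1) (V l) (P l)) fun U c => opM (S.config U) * opC c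
  refine h2.trans ?_
  have h3 : ∀ (U : Fin n → Multiset (S.Jet gr r)) (c : G),
      ev (((dualLetters G vs V).map opLetter).prod * (opM (S.config U) * opC c)) =
      csum (dualLetters G vs V) fun bs g => S.vev (E (S.config U))
        (SchwartzMap.smulLeftCLM ℂ (S.kerAt bs ψ χ) f) * (g * c) := fun U c =>
    symbolEval_prod_opLetter _ _ _ _
  simp only [AddMonoidHom.comp_apply, AddMonoidHom.coe_mulLeft, LinearMap.toAddMonoidHom_coe, h3]
  rw [polySum, ← csum_finsetSum, mulNormal_eq_csum]
  refine csum_congr_of_forall_commute (fun p hp a c => ?_) fun bs g hg => ?_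
  · obtain ⟨L, hL, hp⟩ := List.mem_flatten.1 hp
    obtain ⟨l, rfl⟩ := (List.mem_ofFn' _ _).1 hL
    obtain ⟨j, -, rfl⟩ := List.mem_map.1 hp
    exact Algebra.commutes _ _
  · rw [vev, LinearMap.comp_apply, extend_apply]
    refine Eq.trans ?_ (congrArg (· * g) (polySum_map
      (S.mel (G := G) (S.vac : S.dom) S.vac).toAddMonoidHom _ _)).symm
    rw [polySum, Finset.sum_mul]
    refine Finset.sum_congr rfl fun U _ => ?_
    rw [(hg _).eq, ← mul_assoc]
    exact congrArg (· * g) (S.mel_tmul_one _ _ _ _).symm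

end FreeFields

end

end WickFormalism

theorem mainTheorem5 {N : ℕ} {F : Type*} [NormedAddCommGroup F] [InnerProductSpace ℂ F]
    [CompleteSpace F] (S : WickFormalism.FreeFields N F)
    {G : Type*} [Ring G] [Algebra ℂ G] (gr : ℤ → Submodule ℂ G) [GradedAlgebra gr]
    (hG : S.IsGrassmann gr) (n r : ℕ) (E : S.Ensemble gr n r) (hE : S.IsWickType E) :
    -- the Wick expansion over all sub-configurations `p.1`, with complement `p.2`
    (∀ (W : S.Config gr n r) (f : WickFormalism.Test n), ∀ ψ ∈ S.poly, ∀ χ ∈ S.poly,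
      S.mel ψ χ (E W f) =
        (W.antidiagonal.map fun p =>
          S.mulNormal (S.vev (E p.2)) (S.letters p.1) ψ χ f).sum) ∧
    -- a basis of the polar of the mass-shell and a dual basis in a supplement of the mass-shell
    ∀ (d : ℕ) (v : Module.Basis (Fin d) ℂ (S.polar r)) (vs : Fin d → WickFormalism.JetIdx N r → ℂ),
      (∀ i j, WickFormalism.FreeFields.pair (v i).1 (vs j) = if i = j then (1 : ℂ) else 0) →
      -- the commutators with the free fields through derivative operators
      (∀ P : Fin n → S.WickPoly gr r, (∀ l U, S.Bosonic gr (P l U)) →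
        ∀ (w : S.Jet gr r) (f : WickFormalism.Test n) (g : WickFormalism.Test1),
          S.extend E P f * S.superField w.1 g - S.superField w.1 g * S.extend E P f =
            ∑ l, ∑ j, S.mulDelta (S.extend E (Function.update P l (S.rho (v j).1 (P l)))) l
              (WickFormalism.FreeFields.toG G (vs j)) w.1 g f) ∧
      -- in particular, for the Wick polynomials themselves
      (∀ E₁ : S.Ensemble gr 1 r, S.IsWickMonomials E₁ →
        ∀ P : S.WickPoly gr r, (∀ U, S.Bosonic gr (P U)) →
        ∀ (w : S.Jet gr r) (f : WickFormalism.Test 1) (g : WickFormalism.Test1),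
        ∀ ψ ∈ S.poly, ∀ χ ∈ S.poly,
          S.mel ψ χ (S.extend E₁ (fun _ => P) f * S.superField w.1 g -
              S.superField w.1 g * S.extend E₁ (fun _ => P) f) =
            ∑ j, S.mel ψ χ (S.mulDelta (S.extend E₁ (fun _ => S.rho (v j).1 P)) 0
              (WickFormalism.FreeFields.toG G (vs j)) w.1 g f)) ∧
      -- the Wick expansion through derivative operators
      (∀ P : Fin n → S.WickPoly gr r, (∀ l U, S.Bosonic gr (P l U)) →
        ∀ (f : WickFormalism.Test n), ∀ ψ ∈ S.poly, ∀ χ ∈ S.poly,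
          S.mel ψ χ (S.extend E P f) =
            ∑ᶠ V : Fin n → List (Fin d), (∏ l, (((V l).length.factorial : ℂ))⁻¹) •
              S.mulNormal
                (S.vev (S.extend E fun l => S.rhoSeq (fun j => (v j).1) (V l) (P l)))
                (WickFormalism.FreeFields.dualLetters G vs V) ψ χ f) := by
  refine ⟨fun W f ψ hψ χ hχ => ?_, fun d v vs hv => ⟨fun P hP w f g => ?_,
    fun E₁ hE₁ P hP w f g ψ hψ χ hχ => ?_, fun P hP f ψ hψ χ hχ => ?_⟩⟩
  · exact WickFormalism.FreeFields.mel_eq_wickSum hG hE W ⟨ψ, hψ⟩ ⟨χ, hχ⟩ f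
  · exact hE.extend_comm_eq v hv hP w f g
  · exact hE₁.extend_comm_eq hG v hv hP w f g ⟨ψ, hψ⟩ ⟨χ, hχ⟩
  · exact hE.mel_extend_eq hG v hv hP f ⟨ψ, hψ⟩ ⟨χ, hχ⟩
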